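/- Let $m,n\ge 1$ be integers, $N=m+n$ and $0\le s<1$. Write points of $\mathbb R^N=\mathbb R^m\times\mathbb R^n$ as $x=(y,z)$, and for $\alpha>0$ let $E_\alpha=\{|z|>\alpha|y|\}$ and $C_\alpha=\partial E_\alpha=\{|z|=\alpha|y|\}$. For $0<s<1$ call $C_\alpha$ a nonlocal minimal cone (of order $s$) if $$\mathrm{p.v.}\int_{\mathbb R^N}\frac{\chi_{E_\alpha}(x)-\chi_{\mathbb R^N\setminus E_\alpha}(x)}{|x-p|^{N+s}}\,dx=0\qquad\text{for all }p\in C_\alpha\setminus\{0\}.$$ For $0<s<1$ let $C_m^n(s)=C_\alpha$ be the nonlocal minimal cone of order $s$, with parameter $\alpha=\alpha_s>0$ (it is known that there is exactly one). For $s=0$ let $C_m^n(0)=C_{\alpha_0}$ be the limiting cone, where $\alpha_0=\lim_{s\to0^+}\alpha_s>0$. Let $\Sigma=C_m^n(s)$, with surface measure $dx$ and unit normal $\nu$ exterior to the solid cone. For $h\in C_0^\infty(\Sigma\setminus\{0\})$ and $p\in\Sigma\setminus\{0\}$ let $$\mathcal J^s_\Sigma[h](p)=\mathrm{p.v.}\int_\Sigma\frac{h(x)-h(p)}{|x-p|^{N+s}}\,dx+h(p)\int_\Sigma\frac{\langle\nu(p)-\nu(x),\nu(p)\rangle}{|p-x|^{N+s}}\,dx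 .$$ Call $\Sigma$ stable if $-\int_\Sigma\mathcal J^s_\Sigma[h]\,h\ge 0$ for all $h\in C_0^\infty(\Sigma\setminus\{0\})$. Choose any $\hat p\in\Sigma$ with $|\hat p|=1$ and put $$A_0(m,n,s)^2=\int_\Sigma\frac{\langle\nu(\hat p)-\nu(x),\nu(\hat p)\rangle}{|\hat p-x|^{N+s}}\,dx,\qquad H(m,n,s)=\mathrm{p.v.}\int_\Sigma\frac{1-|y|^{-\frac{N-2-s}{2}}}{|\hat p-y|^{N+s}}\,dy .$$ Then all these integrals and principal values over $\Sigma$ exist, the values $A_0(m,n,s)^2$ and $H(m,n,s)$ do not depend on the choice of $\hat p$, the potential in $\mathcal J^s_\Sigma$ is homogeneous, $$\int_\Sigma\frac{\langle\nu(p)-\nu(x),\nu(p)\rangle}{|p-x|^{N+s}}\,dx=\frac{A_0(m,n,s)^2}{|p|^{1+s}}\qquad\text{for all }p\in\Sigma\setminus\{0\},$$ and $\Sigma=C_m^n(s)$ is stable if and only if $H(m,n,s)\ge A_0(m,n,s)^2$. -/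

import Mathlib

open MeasureTheory Filter Topology
open scoped ContDiff

noncomputable section

namespace NonlocalCone

/-- The Euclidean space `ℝ^N = ℝ^m × ℝ^n`, with `N = m + n`. -/
abbrev Space (m n : ℕ) : Type := EuclideanSpace ℝ (Fin m ⊕ Fin n)

/-- The component `y ∈ ℝ^m` of `x = (y, z)`. -/
def yPart {m n : ℕ} (x : Space m n) : EuclideanSpace ℝ (Fin m) :=
  WithLp.toLp 2 fun i => x (Sum.inl i)

/-- The component `z ∈ ℝ^n` of `x = (y, z)`. -/
def zPart {m n : ℕ} (x : Space m n) : EuclideanSpace ℝ (Fin n) :=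
  WithLp.toLp 2 fun j => x (Sum.inr j)

/-- The solid cone `{(y, z) : |z| > α |y|}`. -/
def solidCone (m n : ℕ) (α : ℝ) : Set (Space m n) :=
  {x | α * ‖yPart x‖ < ‖zPart x‖}

/-- The cone `{(y, z) : |z| = α |y|}`, the boundary of the solid cone. -/
def cone (m n : ℕ) (α : ℝ) : Set (Space m n) :=
  {x | ‖zPart x‖ = α * ‖yPart x‖}

/-- The kernel `|x - p|^{-(N+s)}`. -/
def kernel {m n : ℕ} (s : ℝ) (p x : Space m n) : ℝ :=
  1 / ‖x - p‖ ^ ((m : ℝ) + (n : ℝ) + s)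

/-- `L` is the principal value at `p` of `∫ f dμ`: the limit as `ε → 0⁺` of the integrals of `f`
outside the ball of radius `ε` about `p`, where `f` is integrable outside each such ball. -/
def HasPV {m n : ℕ} (μ : Measure (Space m n)) (p : Space m n) (f : Space m n → ℝ) (L : ℝ) :
    Prop :=
  (∀ ε : ℝ, 0 < ε → IntegrableOn f (Metric.ball p ε)ᶜ μ) ∧
    Tendsto (fun ε : ℝ => ∫ x in (Metric.ball p ε)ᶜ, f x ∂μ) (𝓝[>] 0) (𝓝 L)

open Classical in
/-- The principal value at `p` of `∫ f dμ` (with value `0` if it does not exist). -/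
def pv {m n : ℕ} (μ : Measure (Space m n)) (p : Space m n) (f : Space m n → ℝ) : ℝ :=
  if h : ∃ L, HasPV μ p f L then h.choose else 0

/-- The function `χ_E - χ_{ℝ^N ∖ E}`. -/
def signIndicator {m n : ℕ} (E : Set (Space m n)) (x : Space m n) : ℝ :=
  E.indicator (fun _ => 1) x - Eᶜ.indicator (fun _ => 1) x

/-- `α > 0`, and the nonlocal mean curvature of order `s` of the cone with opening parameter `α`
vanishes at all its points other than the vertex. -/
def IsNonlocalMinimalCone (m n : ℕ) (s α : ℝ) : Prop :=
  0 < α ∧ ∀ p ∈ cone m n α, p ≠ 0 →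
    HasPV volume p (fun x => signIndicator (solidCone m n α) x * kernel s p x) 0

/-- `α` is the opening parameter of the cone `C_m^n(s)`, for `0 ≤ s < 1`. For `s > 0` this is the
nonlocal minimal cone; for `s = 0` it is the limit of these cones as `s → 0⁺`. -/
def IsConeParameter (m n : ℕ) (s α : ℝ) : Prop :=
  (0 < s ∧ IsNonlocalMinimalCone m n s α) ∨
    (s = 0 ∧ 0 < α ∧ ∃ a : ℝ → ℝ,
      (∀ t ∈ Set.Ioo (0 : ℝ) 1, IsNonlocalMinimalCone m n t (a t)) ∧
        Tendsto a (𝓝[>] 0) (𝓝 α))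

/-- The surface measure of the cone: the `(N-1)`-dimensional Hausdorff measure, normalized as the
Euclidean `(N-1)`-volume, restricted to the cone. -/
def surfaceMeasure (m n : ℕ) (α : ℝ) : Measure (Space m n) :=
  (Measure.euclideanHausdorffMeasure (m + n - 1)).restrict (cone m n α)

/-- The unit normal `(α y/|y|, -z/|z|) / √(1+α²)` of the cone at `x = (y, z) ≠ 0`; it points to
the exterior of the solid cone, being the normalized gradient of `α |y| - |z|`. -/
def normal {m n : ℕ} (α : ℝ) (x : Space m n) : Space m n :=
  (1 / Real.sqrt (1 + α ^ 2)) • WithLp.toLp 2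
    (Sum.elim (fun i => α * yPart x i / ‖yPart x‖) (fun j => -(zPart x j / ‖zPart x‖)))

/-- The integrand `⟨ν(p) - ν(x), ν(p)⟩ / |p - x|^{N+s}`. -/
def potentialIntegrand {m n : ℕ} (s α : ℝ) (p x : Space m n) : ℝ :=
  inner ℝ (normal α p - normal α x) (normal α p) * kernel s p x

/-- The integral `∫_Σ ⟨ν(p) - ν(x), ν(p)⟩ / |p - x|^{N+s} dx`. For `p ∈ Σ` with `|p| = 1` it is
the constant `A₀(m,n,s)²`. -/
def potential {m n : ℕ} (s α : ℝ) (p : Space m n) : ℝ :=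
  ∫ x, potentialIntegrand s α p x ∂(surfaceMeasure m n α)

/-- The nonlocal Jacobi operator of the cone. -/
def jacobi {m n : ℕ} (s α : ℝ) (h : Space m n → ℝ) (p : Space m n) : ℝ :=
  pv (surfaceMeasure m n α) p (fun x => (h x - h p) * kernel s p x) + h p * potential s α p

/-- Smooth functions with compact support in `ℝ^N ∖ {0}`. As `Σ ∖ {0}` is a closed embedded
submanifold of `ℝ^N ∖ {0}`, their restrictions to `Σ` are exactly the functions in
`C_0^∞(Σ ∖ {0})`; only the values on `Σ` enter below. -/
def IsTestFunction {m n : ℕ} (h : Space m n → ℝ) : Prop :=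
  ContDiff ℝ ∞ h ∧ HasCompactSupport h ∧ (0 : Space m n) ∉ tsupport h

/-- Stability of the cone (away from its vertex). -/
def IsStable (m n : ℕ) (s α : ℝ) : Prop :=
  ∀ h : Space m n → ℝ, IsTestFunction h →
    0 ≤ -∫ p, jacobi s α h p * h p ∂(surfaceMeasure m n α)

/-- The integrand `(1 - |y|^{-(N-2-s)/2}) / |p - y|^{N+s}`. -/
def hardyIntegrand {m n : ℕ} (s : ℝ) (p y : Space m n) : ℝ :=
  (1 - ‖y‖ ^ (-(((m : ℝ) + (n : ℝ) - 2 - s) / 2))) * kernel s p y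

/-- The integral `p.v. ∫_Σ (1 - |y|^{-(N-2-s)/2}) / |p - y|^{N+s} dy`. For `p ∈ Σ` with `|p| = 1`
it is the constant `H(m,n,s)`. -/
def hardyConstant {m n : ℕ} (s α : ℝ) (p : Space m n) : ℝ :=
  pv (surfaceMeasure m n α) p (hardyIntegrand s p)

end NonlocalCone

end

noncomputable section

namespace NonlocalCone
open scoped ENNReal NNReal Pointwise

variable {m n : ℕ} {s α : ℝ}

/-! Write w(x) = |x|^{-(N-2-s)/2}, K for the kernel, A for `potential` and H for `hardyConstant` at
the unit point q. The theorem rests on a ground state representation: for every test function h, -∫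
J[h] h = (H - A) ∫ h(p)²/|p|^{1+s} dp + ½ ∬ w(p) w(x) (h(p)/w(p) - h(x)/w(x))² K(p,x) dp dx, where
the double integral is taken as the limit of its truncations to |x-p| ≥ ε (`tendsto_groundState`).
Dilations and O(m)×O(n) act transitively on the cone minus its vertex, so the potential at p is
A/|p|^{1+s}, and the principal value of ∫ (1 - w(x)/w(p)) K is H/|p|^{1+s}. Under the truncated
integral sign, -h(p)(h(x) - h(p)) - h(p)²(1 - w(x)/w(p)) = h(p)² w(x)/w(p) - h(p)h(x), and
symmetrizing in (p,x) produces the square.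

If H ≥ A, both terms on the right are nonnegative (`isStable_of_le`). For the converse, w is a
virtual extremal: w²/|p|^{1+s} = |p|^{-(N-1)} is scale invariant, so its mass is linear in the
logarithm of the radius. Testing with w·η(log|x|/k), the single integral is at least of order k,
while the remainder carries (C/k)² from the cutoff times a logarithmic mass of order k, hence is
O(1/k). If H < A, this contradicts stability for large k (`le_of_isStable`).

The analytic work lies in the principal values (`exists_hasPV`). The kernel has order N+s on a
surface of dimension N-1, so a second order Taylor remainder is integrable because s < 1, but the
linear term must cancel. The cancellation comes from the explicit map `coneInvolution`: it preserves
the cone, the distance to q, and near q the measure |x|^{-(N-2)}dσ, and it agrees with x ↦ 2q - x up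
to O(|x-q|²). The resulting bounds are uniform in the truncation radius, which allows dominated
convergence in p. The surface measure σ enters only through its invariance under isometries, its
scaling, an upper bound on small balls and the nullity of points; polar coordinates follow from the
scaling alone. -/

/-! ### Block components -/

/-- `yPart` as a continuous linear map. -/
def yPartL : Space m n →L[ℝ] EuclideanSpace ℝ (Fin m) :=
  LinearMap.toContinuousLinearMap
    { toFun := yPart
      map_add' := fun _ _ => rfl
      map_smul' := fun _ _ => rfl }

/-- `zPart` as a continuous linear map. -/
def zPartL : Space m n →L[ℝ] EuclideanSpace ℝ (Fin n) :=
  LinearMap.toContinuousLinearMap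
    { toFun := zPart
      map_add' := fun _ _ => rfl
      map_smul' := fun _ _ => rfl }

lemma yPartL_apply (x : Space m n) : yPartL x = yPart x := rfl

lemma zPartL_apply (x : Space m n) : zPartL x = zPart x := rfl

lemma yPart_add (x x' : Space m n) : yPart (x + x') = yPart x + yPart x' := rfl

lemma zPart_add (x x' : Space m n) : zPart (x + x') = zPart x + zPart x' := rfl

lemma yPart_sub (x x' : Space m n) : yPart (x - x') = yPart x - yPart x' := rfl

lemma zPart_sub (x x' : Space m n) : zPart (x - x') = zPart x - zPart x' := rfl

lemma yPart_smul (c : ℝ) (x : Space m n) : yPart (c • x) = c • yPart x := rfl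

lemma zPart_smul (c : ℝ) (x : Space m n) : zPart (c • x) = c • zPart x := rfl

/-- The point `(y, z)`. -/
def join (y : EuclideanSpace ℝ (Fin m)) (z : EuclideanSpace ℝ (Fin n)) : Space m n :=
  WithLp.toLp 2 (Sum.elim y z)

@[simp] lemma yPart_join (y : EuclideanSpace ℝ (Fin m)) (z : EuclideanSpace ℝ (Fin n)) :
    yPart (join y z) = y := rfl

@[simp] lemma zPart_join (y : EuclideanSpace ℝ (Fin m)) (z : EuclideanSpace ℝ (Fin n)) :
    zPart (join y z) = z := rfl

lemma ext_parts {x x' : Space m n} (hy : yPart x = yPart x') (hz : zPart x = zPart x') :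
    x = x' := by
  ext i
  rcases i with i | j
  · exact congrArg (fun v : EuclideanSpace ℝ (Fin m) => v i) hy
  · exact congrArg (fun v : EuclideanSpace ℝ (Fin n) => v j) hz

lemma inner_eq_parts (x x' : Space m n) :
    inner ℝ x x' = inner ℝ (yPart x) (yPart x') + inner ℝ (zPart x) (zPart x') := by
  simp [PiLp.inner_apply, Fintype.sum_sum_type, yPart, zPart]

lemma norm_sq_eq_parts (x : Space m n) : ‖x‖ ^ 2 = ‖yPart x‖ ^ 2 + ‖zPart x‖ ^ 2 := by
  rw [← real_inner_self_eq_norm_sq, ← real_inner_self_eq_norm_sq, ← real_inner_self_eq_norm_sq,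
    inner_eq_parts]

lemma norm_yPart_le (x : Space m n) : ‖yPart x‖ ≤ ‖x‖ := by
  apply le_of_sq_le_sq _ (norm_nonneg _)
  nlinarith [norm_sq_eq_parts x, sq_nonneg ‖zPart x‖, sq_nonneg ‖yPart x‖]

lemma norm_zPart_le (x : Space m n) : ‖zPart x‖ ≤ ‖x‖ := by
  apply le_of_sq_le_sq _ (norm_nonneg _)
  nlinarith [norm_sq_eq_parts x, sq_nonneg ‖zPart x‖, sq_nonneg ‖yPart x‖]

lemma continuous_yPart : Continuous (yPart : Space m n → _) := yPartL.continuous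

lemma continuous_zPart : Continuous (zPart : Space m n → _) := zPartL.continuous

lemma isClosed_cone : IsClosed (cone m n α) :=
  isClosed_eq continuous_zPart.norm (continuous_const.mul continuous_yPart.norm)

lemma measurableSet_cone : MeasurableSet (cone m n α) := isClosed_cone.measurableSet

lemma smul_mem_cone {c : ℝ} {x : Space m n} (hx : x ∈ cone m n α) : c • x ∈ cone m n α := by
  simp only [cone, Set.mem_ofPred_eq, yPart_smul, zPart_smul, norm_smul] at hx ⊢
  rw [hx]; ring

lemma norm_sq_of_mem_cone {x : Space m n} (hx : x ∈ cone m n α) :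
    ‖x‖ ^ 2 = (1 + α ^ 2) * ‖yPart x‖ ^ 2 := by
  have : ‖zPart x‖ = α * ‖yPart x‖ := hx
  rw [norm_sq_eq_parts, this]; ring

/-! ### Similarities preserving the cone -/

/-- Linear isometries that preserve the norms of both block components. -/
def PreservesParts (Q : Space m n ≃ₗᵢ[ℝ] Space m n) : Prop :=
  ∀ x, ‖yPart (Q x)‖ = ‖yPart x‖ ∧ ‖zPart (Q x)‖ = ‖zPart x‖

lemma PreservesParts.mem_cone_iff {Q : Space m n ≃ₗᵢ[ℝ] Space m n} (hQ : PreservesParts Q)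
    (x : Space m n) : Q x ∈ cone m n α ↔ x ∈ cone m n α := by
  simp only [cone, Set.mem_ofPred_eq, (hQ x).1, (hQ x).2]

lemma PreservesParts.inner_yPart {Q : Space m n ≃ₗᵢ[ℝ] Space m n} (hQ : PreservesParts Q)
    (x x' : Space m n) :
    inner ℝ (yPart (Q x)) (yPart (Q x')) = inner ℝ (yPart x) (yPart x') := by
  have h := (hQ (x + x')).1
  rw [map_add, yPart_add, yPart_add] at h
  have h1 := norm_add_sq_real (yPart (Q x)) (yPart (Q x'))
  have h2 := norm_add_sq_real (yPart x) (yPart x')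
  rw [h, (hQ x).1, (hQ x').1] at h1
  linarith

lemma PreservesParts.inner_zPart {Q : Space m n ≃ₗᵢ[ℝ] Space m n} (hQ : PreservesParts Q)
    (x x' : Space m n) :
    inner ℝ (zPart (Q x)) (zPart (Q x')) = inner ℝ (zPart x) (zPart x') := by
  have h := (hQ (x + x')).2
  rw [map_add, zPart_add, zPart_add] at h
  have h1 := norm_add_sq_real (zPart (Q x)) (zPart (Q x'))
  have h2 := norm_add_sq_real (zPart x) (zPart x')
  rw [h, (hQ x).2, (hQ x').2] at h1
  linarith

lemma map_isometry_surfaceMeasure {Q : Space m n ≃ₗᵢ[ℝ] Space m n} (hQ : PreservesParts Q) :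
    (surfaceMeasure m n α).map Q = surfaceMeasure m n α := by
  have h := Q.toIsometryEquiv.measurePreserving_euclideanHausdorffMeasure (m + n - 1)
  have h' := (h.restrict_preimage (s := cone m n α) measurableSet_cone).map_eq
  have hpre : (Q.toIsometryEquiv : Space m n → Space m n) ⁻¹' cone m n α = cone m n α := by
    ext x; exact hQ.mem_cone_iff x
  rw [hpre] at h'
  exact h'

lemma map_smul_surfaceMeasure {r : ℝ} (hr : 0 < r) :
    (surfaceMeasure m n α).map (fun x => r • x)
      = ENNReal.ofReal (r ^ (m + n - 1))⁻¹ • surfaceMeasure m n α := by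
  ext A hA
  have hmeas : Measurable (fun x : Space m n => r • x) := (continuous_const_smul r).measurable
  rw [Measure.map_apply hmeas hA, surfaceMeasure, Measure.restrict_apply (hmeas hA),
    Measure.smul_apply, Measure.restrict_apply hA]
  have : (fun x : Space m n => r • x) ⁻¹' A ∩ cone m n α = r⁻¹ • (A ∩ cone m n α) := by
    ext x
    rw [Set.mem_inv_smul_set_iff₀ hr.ne']
    constructor
    · rintro ⟨h1, h2⟩
      exact ⟨h1, smul_mem_cone h2⟩
    · rintro ⟨h1, h2⟩
      refine ⟨h1, ?_⟩
      have := smul_mem_cone (c := r⁻¹) h2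
      rwa [inv_smul_smul₀ hr.ne'] at this
  rw [this, Measure.euclideanHausdorffMeasure_smul₀ _ (inv_ne_zero hr.ne')]
  rw [smul_eq_mul, ENNReal.smul_def, smul_eq_mul]
  congr 1
  rw [ENNReal.ofReal, ENNReal.coe_inj]
  ext
  rw [Real.coe_toNNReal _ (by positivity)]
  simp [abs_of_pos hr]

/-- The similarity `x ↦ r • Q x` as a homeomorphism. -/
def similarity {r : ℝ} (hr : 0 < r) (Q : Space m n ≃ₗᵢ[ℝ] Space m n) : Space m n ≃ₜ Space m n :=
  Q.toHomeomorph.trans (Homeomorph.smulOfNeZero r hr.ne')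

lemma similarity_apply {r : ℝ} (hr : 0 < r) (Q : Space m n ≃ₗᵢ[ℝ] Space m n) (x : Space m n) :
    similarity hr Q x = r • Q x := rfl

lemma map_similarity_surfaceMeasure {r : ℝ} (hr : 0 < r) {Q : Space m n ≃ₗᵢ[ℝ] Space m n}
    (hQ : PreservesParts Q) :
    (surfaceMeasure m n α).map (similarity hr Q)
      = ENNReal.ofReal (r ^ (m + n - 1))⁻¹ • surfaceMeasure m n α := by
  rw [← map_smul_surfaceMeasure hr]
  conv_rhs => rw [← map_isometry_surfaceMeasure hQ]
  rw [Measure.map_map (continuous_const_smul r).measurable Q.continuous.measurable]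
  rfl

/-- The similarity is a homeomorphism, hence a measurable embedding, so no measurability of f is
needed. The same holds for the Bochner versions below. -/
lemma lintegral_similarity {r : ℝ} (hr : 0 < r) {Q : Space m n ≃ₗᵢ[ℝ] Space m n}
    (hQ : PreservesParts Q) (f : Space m n → ℝ≥0∞) :
    ∫⁻ x, f (similarity hr Q x) ∂(surfaceMeasure m n α)
      = ENNReal.ofReal (r ^ (m + n - 1))⁻¹ * ∫⁻ x, f x ∂(surfaceMeasure m n α) := by
  rw [← (similarity hr Q).measurableEmbedding.lintegral_map, map_similarity_surfaceMeasure hr hQ,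
    lintegral_smul_measure, smul_eq_mul]

lemma integral_similarity {r : ℝ} (hr : 0 < r) {Q : Space m n ≃ₗᵢ[ℝ] Space m n}
    (hQ : PreservesParts Q) (f : Space m n → ℝ) :
    ∫ x, f (similarity hr Q x) ∂(surfaceMeasure m n α)
      = (r ^ (m + n - 1))⁻¹ * ∫ x, f x ∂(surfaceMeasure m n α) := by
  rw [← (similarity hr Q).measurableEmbedding.integral_map, map_similarity_surfaceMeasure hr hQ,
    integral_smul_measure, ENNReal.toReal_ofReal (by positivity), smul_eq_mul]

lemma integrable_similarity_iff {r : ℝ} (hr : 0 < r) {Q : Space m n ≃ₗᵢ[ℝ] Space m n}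
    (hQ : PreservesParts Q) (f : Space m n → ℝ) :
    Integrable (fun x => f (similarity hr Q x)) (surfaceMeasure m n α)
      ↔ Integrable f (surfaceMeasure m n α) := by
  have h := (similarity hr Q).measurableEmbedding.integrable_map_iff (g := f)
    (μ := surfaceMeasure m n α)
  rw [map_similarity_surfaceMeasure hr hQ,
    integrable_smul_measure (by simpa using pow_pos hr _) ENNReal.ofReal_ne_top] at h
  exact h.symm

lemma setIntegral_similarity {r : ℝ} (hr : 0 < r) {Q : Space m n ≃ₗᵢ[ℝ] Space m n}
    (hQ : PreservesParts Q) (f : Space m n → ℝ) {S : Set (Space m n)} (hS : MeasurableSet S) :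
    ∫ x in similarity hr Q ⁻¹' S, f (similarity hr Q x) ∂(surfaceMeasure m n α)
      = (r ^ (m + n - 1))⁻¹ * ∫ x in S, f x ∂(surfaceMeasure m n α) := by
  rw [← integral_indicator hS, ← integral_indicator ((similarity hr Q).measurable hS),
    ← integral_similarity hr hQ]
  rfl

lemma integrableOn_similarity_iff {r : ℝ} (hr : 0 < r) {Q : Space m n ≃ₗᵢ[ℝ] Space m n}
    (hQ : PreservesParts Q) (f : Space m n → ℝ) {S : Set (Space m n)} (hS : MeasurableSet S) :
    IntegrableOn (fun x => f (similarity hr Q x)) (similarity hr Q ⁻¹' S) (surfaceMeasure m n α)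
      ↔ IntegrableOn f S (surfaceMeasure m n α) := by
  rw [← integrable_indicator_iff hS, ← integrable_indicator_iff ((similarity hr Q).measurable hS),
    ← integrable_similarity_iff hr hQ (S.indicator f)]
  rfl

lemma reflection_orthogonal_singleton (v x : Space m n) :
    (ℝ ∙ v)ᗮ.reflection x = x - (2 * (inner ℝ v x / ‖v‖ ^ 2)) • v := by
  rw [Submodule.reflection_orthogonal_apply, Submodule.reflection_singleton_apply]
  simp [two_mul, add_smul]
  abel

/-- A reflection along a vector lying in one block leaves the other block untouched; since it
preserves the full norm, it preserves the norm of the block that it moves. -/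
lemma preservesParts_reflection {v : Space m n} (hv : yPart v = 0 ∨ zPart v = 0) :
    PreservesParts ((ℝ ∙ v)ᗮ.reflection) := by
  intro x
  have hn : ‖(ℝ ∙ v)ᗮ.reflection x‖ ^ 2 = ‖x‖ ^ 2 := by
    rw [LinearIsometryEquiv.norm_map]
  have hform := reflection_orthogonal_singleton v x
  rw [norm_sq_eq_parts, norm_sq_eq_parts x] at hn
  rcases hv with hv | hv
  · have hy : yPart ((ℝ ∙ v)ᗮ.reflection x) = yPart x := by
      rw [hform, yPart_sub, yPart_smul, hv]; simp
    refine ⟨by rw [hy], ?_⟩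
    rw [hy] at hn
    exact (sq_eq_sq₀ (norm_nonneg _) (norm_nonneg _)).1 (by linarith)
  · have hz : zPart ((ℝ ∙ v)ᗮ.reflection x) = zPart x := by
      rw [hform, zPart_sub, zPart_smul, hv]; simp
    refine ⟨?_, by rw [hz]⟩
    rw [hz] at hn
    exact (sq_eq_sq₀ (norm_nonneg _) (norm_nonneg _)).1 (by linarith)

/-- Points of the cone with equal norm have equal block norms. One reflection rotates the y-block of
q to that of p, a second one the z-block; r is the intermediate point. -/
lemma exists_preservesParts {p q : Space m n} (hp : p ∈ cone m n α) (hq : q ∈ cone m n α)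
    (hpq : ‖p‖ = ‖q‖) : ∃ Q : Space m n ≃ₗᵢ[ℝ] Space m n, PreservesParts Q ∧ Q q = p := by
  have h1 := norm_sq_of_mem_cone hp
  have h2 := norm_sq_of_mem_cone hq
  have hy : ‖yPart q‖ = ‖yPart p‖ := by
    rw [hpq, h2] at h1
    exact (sq_eq_sq₀ (norm_nonneg _) (norm_nonneg _)).1
      (mul_left_cancel₀ (by positivity : (1 + α ^ 2) ≠ 0) h1)
  have hz : ‖zPart q‖ = ‖zPart p‖ := by
    rw [show ‖zPart q‖ = α * ‖yPart q‖ from hq, show ‖zPart p‖ = α * ‖yPart p‖ from hp, hy]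
  set r : Space m n := join (yPart p) (zPart q) with hr
  have hqr : ‖q‖ = ‖r‖ := by
    apply (sq_eq_sq₀ (norm_nonneg _) (norm_nonneg _)).1
    rw [norm_sq_eq_parts, norm_sq_eq_parts r, hr, yPart_join, zPart_join, hy]
  have hrp : ‖r‖ = ‖p‖ := by rw [← hqr, hpq]
  have hA : PreservesParts (ℝ ∙ (q - r))ᗮ.reflection :=
    preservesParts_reflection (Or.inr (by rw [zPart_sub, hr, zPart_join, sub_self]))
  have hB : PreservesParts (ℝ ∙ (r - p))ᗮ.reflection :=
    preservesParts_reflection (Or.inl (by rw [yPart_sub, hr, yPart_join, sub_self]))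
  refine ⟨(ℝ ∙ (q - r))ᗮ.reflection.trans (ℝ ∙ (r - p))ᗮ.reflection, fun x => ?_, ?_⟩
  · simp only [LinearIsometryEquiv.trans_apply]
    exact ⟨(hB _).1.trans (hA _).1, (hB _).2.trans (hA _).2⟩
  · rw [LinearIsometryEquiv.trans_apply, Submodule.reflection_sub hqr, Submodule.reflection_sub hrp]

/-- Every statement about a general point p is reduced by this to a single unit point q. -/
lemma exists_similarity {p q : Space m n} (hp : p ∈ cone m n α) (hp0 : p ≠ 0)
    (hq : q ∈ cone m n α) (hq1 : ‖q‖ = 1) :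
    ∃ Q : Space m n ≃ₗᵢ[ℝ] Space m n, PreservesParts Q ∧
      similarity (norm_pos_iff.2 hp0) Q q = p := by
  have hp' : 0 < ‖p‖ := norm_pos_iff.2 hp0
  obtain ⟨Q, hQ, hQq⟩ := exists_preservesParts (p := ‖p‖⁻¹ • p) (smul_mem_cone hp) hq
    (by rw [norm_smul, norm_inv, norm_norm, inv_mul_cancel₀ hp'.ne', hq1])
  refine ⟨Q, hQ, ?_⟩
  rw [similarity_apply, hQq, smul_inv_smul₀ hp'.ne']

/-! ### Local finiteness of the surface measure -/

/-- The inclusion `y ↦ (y, 0)`. -/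
def inclY : EuclideanSpace ℝ (Fin m) →L[ℝ] Space m n :=
  LinearMap.toContinuousLinearMap
    { toFun := fun y => join y 0
      map_add' := fun _ _ => ext_parts rfl (by simp [zPart_add])
      map_smul' := fun _ _ => ext_parts rfl (by simp [zPart_smul]) }

/-- The inclusion `z ↦ (0, z)`. -/
def inclZ : EuclideanSpace ℝ (Fin n) →L[ℝ] Space m n :=
  LinearMap.toContinuousLinearMap
    { toFun := fun z => join 0 z
      map_add' := fun _ _ => ext_parts (by simp [yPart_add]) rfl
      map_smul' := fun _ _ => ext_parts (by simp [yPart_smul]) rfl }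

lemma inclY_apply (y : EuclideanSpace ℝ (Fin m)) : (inclY y : Space m n) = join y 0 := rfl

lemma inclZ_apply (z : EuclideanSpace ℝ (Fin n)) : (inclZ z : Space m n) = join 0 z := rfl

lemma norm_yPart_pos {q : Space m n} (hq : q ∈ cone m n α) (hq0 : q ≠ 0) :
    0 < ‖yPart q‖ := by
  have h1 : 0 < ‖q‖ ^ 2 := by positivity
  rw [norm_sq_of_mem_cone hq] at h1
  rcases (norm_nonneg (yPart q)).eq_or_lt with h | h
  · rw [← h] at h1; simp at h1
  · exact h

lemma norm_zPart_pos {q : Space m n} (hα : 0 < α) (hq : q ∈ cone m n α) (hq0 : q ≠ 0) :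
    0 < ‖zPart q‖ := by
  rw [show ‖zPart q‖ = α * ‖yPart q‖ from hq]
  exact mul_pos hα (norm_yPart_pos hq hq0)

/-- The map `(y, z) ↦ (y, α |y| z / |z|)` onto the cone. -/
def toCone (α : ℝ) (u : Space m n) : Space m n :=
  inclY (yPartL u) + (α * ‖yPartL u‖ / ‖zPartL u‖) • inclZ (zPartL u)

lemma contDiffAt_toCone {q : Space m n} (hy : yPart q ≠ 0) (hz : zPart q ≠ 0) :
    ContDiffAt ℝ 1 (toCone α) q := by
  unfold toCone
  have h1 : ContDiffAt ℝ 1 (fun u : Space m n => ‖yPartL u‖) q :=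
    yPartL.contDiff.contDiffAt.norm ℝ hy
  have h2 : ContDiffAt ℝ 1 (fun u : Space m n => ‖zPartL u‖) q :=
    zPartL.contDiff.contDiffAt.norm ℝ hz
  have h3 : ContDiffAt ℝ 1 (fun u : Space m n => (inclY (yPartL u) : Space m n)) q :=
    (inclY.comp yPartL).contDiff.contDiffAt
  have h4 : ContDiffAt ℝ 1 (fun u : Space m n => (inclZ (zPartL u) : Space m n)) q :=
    (inclZ.comp zPartL).contDiff.contDiffAt
  exact h3.add (((contDiffAt_const.mul h1).div h2 (norm_ne_zero_iff.2 hz)).smul h4)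

/-- The central projection in the `z`-component to the affine hyperplane through `q` orthogonal
to `(0, zPart q)`, relative to `q`. -/
def toHyperplane (q x : Space m n) : Space m n :=
  inclY (yPartL x) + (‖zPart q‖ ^ 2 / inner ℝ (zPart q) (zPartL x)) • inclZ (zPartL x) - q

lemma contDiffAt_toHyperplane {q : Space m n} (hz : zPart q ≠ 0) :
    ContDiffAt ℝ 1 (toHyperplane q) q := by
  unfold toHyperplane
  have h2 : ContDiffAt ℝ 1 (fun u : Space m n => (inner ℝ (zPart q) (zPartL u) : ℝ)) q :=
    contDiffAt_const.inner ℝ zPartL.contDiff.contDiffAt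
  have h3 : ContDiffAt ℝ 1 (fun u : Space m n => (inclY (yPartL u) : Space m n)) q :=
    (inclY.comp yPartL).contDiff.contDiffAt
  have h4 : ContDiffAt ℝ 1 (fun u : Space m n => (inclZ (zPartL u) : Space m n)) q :=
    (inclZ.comp zPartL).contDiff.contDiffAt
  have h5 : (inner ℝ (zPart q) (zPartL q) : ℝ) ≠ 0 := by
    rw [zPartL_apply, real_inner_self_eq_norm_sq]
    exact pow_ne_zero _ (norm_ne_zero_iff.2 hz)
  exact (h3.add ((contDiffAt_const.div h2 h5).smul h4)).sub contDiffAt_const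

lemma toHyperplane_self {q : Space m n} (hz : zPart q ≠ 0) : toHyperplane q q = 0 := by
  have h : ‖zPart q‖ ^ 2 ≠ 0 := pow_ne_zero _ (norm_ne_zero_iff.2 hz)
  rw [toHyperplane, zPartL_apply, real_inner_self_eq_norm_sq, div_self h, one_smul, sub_eq_zero]
  exact ext_parts (by simp [inclY_apply, inclZ_apply, yPart_add, yPartL_apply])
    (by simp [inclY_apply, inclZ_apply, zPart_add])

lemma inner_toHyperplane {q x : Space m n} (hx : 0 < inner ℝ (zPart q) (zPart x)) :
    inner ℝ (inclZ (zPart q) : Space m n) (toHyperplane q x) = 0 := by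
  rw [inner_eq_parts]
  simp only [toHyperplane, inclY_apply, inclZ_apply, yPart_join, zPart_join, zPart_add, zPart_sub,
    zPart_smul, zPartL_apply, inner_zero_left, zero_add, inner_sub_right, inner_smul_right,
    real_inner_self_eq_norm_sq]
  rw [div_mul_cancel₀ _ hx.ne', sub_self]

/-- `toHyperplane` keeps y and multiplies z by a positive scalar, while `toCone` sees z only through
its direction and restores the length α|y|. -/
lemma toCone_toHyperplane {q x : Space m n} (hxc : x ∈ cone m n α)
    (hq : zPart q ≠ 0) (hx : 0 < inner ℝ (zPart q) (zPart x)) :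
    toCone α (q + toHyperplane q x) = x := by
  have hz : zPart x ≠ 0 := by
    intro h; rw [h] at hx; simp at hx
  have hz' : ‖zPart x‖ ≠ 0 := norm_ne_zero_iff.2 hz
  have hq' : ‖zPart q‖ ≠ 0 := norm_ne_zero_iff.2 hq
  have hy1 : yPart (q + toHyperplane q x) = yPart x := by
    simp [toHyperplane, inclY_apply, inclZ_apply, yPart_smul, yPart_add, yPartL_apply]
  have hz1 : zPart (q + toHyperplane q x)
      = (‖zPart q‖ ^ 2 / inner ℝ (zPart q) (zPart x)) • zPart x := by
    simp [toHyperplane, inclY_apply, inclZ_apply, zPart_smul, zPart_add, zPartL_apply]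
  refine ext_parts ?_ ?_
  · simp [toCone, inclY_apply, inclZ_apply, yPart_add, yPart_smul, yPartL_apply, hy1]
  · simp only [toCone, inclY_apply, inclZ_apply, zPart_add, zPart_smul, zPartL_apply, yPartL_apply,
      hy1, hz1, zPart_join, zero_add, smul_smul, norm_smul]
    rw [show α * ‖yPart x‖ = ‖zPart x‖ from hxc.symm, Real.norm_of_nonneg (by positivity)]
    have : ‖zPart x‖ / (‖zPart q‖ ^ 2 / inner ℝ (zPart q) (zPart x) * ‖zPart x‖) *
        (‖zPart q‖ ^ 2 / inner ℝ (zPart q) (zPart x)) = 1 := by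
      have := hx.ne'
      field_simp
    rw [this, one_smul]

/-- Near q the cone is a Lipschitz image of a piece of the affine hyperplane orthogonal to (0, zPart
q), and projecting back to the hyperplane is Lipschitz too. So a ball of radius r in the cone is
covered by the image of a flat (N-1)-dimensional ball of radius K'r. -/
lemma hausdorff_ball_le {q : Space m n} (hα : 0 < α) (hq : q ∈ cone m n α) (hq0 : q ≠ 0) :
    ∃ C : ℝ≥0∞, C ≠ ⊤ ∧ ∃ r₀ > 0, ∀ r, 0 ≤ r → r ≤ r₀ →
      Measure.hausdorffMeasure ((m + n - 1 : ℕ) : ℝ) (Metric.ball q r ∩ cone m n α)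
        ≤ C * ENNReal.ofReal (r ^ (m + n - 1)) := by
  have hy : yPart q ≠ 0 := norm_pos_iff.1 (norm_yPart_pos hq hq0)
  have hz : zPart q ≠ 0 := norm_pos_iff.1 (norm_zPart_pos hα hq hq0)
  obtain ⟨K, t, ht, hK⟩ := (contDiffAt_toCone (α := α) hy hz).exists_lipschitzOnWith
  obtain ⟨K', t', ht', hK'⟩ := (contDiffAt_toHyperplane hz).exists_lipschitzOnWith
  have hpos : ∀ᶠ x in 𝓝 q, 0 < inner ℝ (zPart q) (zPart x) := by
    have hc : Continuous fun x : Space m n => (inner ℝ (zPart q) (zPart x) : ℝ) :=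
      continuous_const.inner continuous_zPart
    apply hc.continuousAt.eventually_const_lt
    exact real_inner_self_pos.2 hz
  obtain ⟨δ, hδ, hδt⟩ := Metric.mem_nhds_iff.1 ht
  obtain ⟨r₁, hr₁, hr₁t⟩ := Metric.mem_nhds_iff.1 (inter_mem ht' hpos)
  set W : Submodule ℝ (Space m n) := (ℝ ∙ (inclZ (zPart q) : Space m n))ᗮ with hW
  have hzq : (inclZ (zPart q) : Space m n) ≠ 0 := by
    intro h
    apply hz
    have := congrArg zPart h
    exact this
  have hfin : Module.finrank ℝ W = m + n - 1 := by
    have h1 := Submodule.finrank_add_finrank_orthogonal (ℝ ∙ (inclZ (zPart q) : Space m n))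
    rw [finrank_span_singleton hzq, finrank_euclideanSpace] at h1
    simp only [Fintype.card_sum, Fintype.card_fin] at h1
    rw [hW]
    omega
  set d := m + n - 1 with hd
  set μW : Measure W := Measure.hausdorffMeasure (d : ℝ) with hμW
  have hhaar : μW.IsAddHaarMeasure := by
    rw [hμW, ← hfin]; infer_instance
  -- The flat ball of radius K'r must stay where `toCone` is Lipschitz; adding 1 to K' avoids a zero
  -- denominator.
  have hK'r : 0 < δ / (K' + 1) := by positivity
  refine ⟨(K : ℝ≥0∞) ^ d * (ENNReal.ofReal ((K' : ℝ) ^ d) * μW (Metric.ball 0 1)), ?_,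
    min r₁ (δ / (K' + 1)), lt_min hr₁ hK'r, fun r hr hrr => ?_⟩
  · exact ENNReal.mul_ne_top (ENNReal.pow_ne_top ENNReal.coe_ne_top)
      (ENNReal.mul_ne_top ENNReal.ofReal_ne_top measure_ball_lt_top.ne)
  have hsmall : K' * r < δ := by
    have h1 : r ≤ δ / (K' + 1) := hrr.trans (min_le_right _ _)
    rw [le_div_iff₀ (by positivity)] at h1
    rcases hr.eq_or_lt with h | h
    · rw [← h]; simpa using hδ
    · nlinarith
  have hsub : Metric.ball q r ∩ cone m n α
      ⊆ (toCone α) '' ((fun w : W => q + (w : Space m n)) '' Metric.closedBall 0 (K' * r)) := by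
    rintro x ⟨hxr, hxc⟩
    have hx' := hr₁t (Metric.ball_subset_ball (hrr.trans (min_le_left _ _)) hxr)
    have hmem : toHyperplane q x ∈ W := by
      rw [hW, Submodule.mem_orthogonal_singleton_iff_inner_right]
      exact inner_toHyperplane hx'.2
    refine ⟨q + toHyperplane q x, ⟨⟨toHyperplane q x, hmem⟩, ?_, rfl⟩,
      toCone_toHyperplane hxc hz hx'.2⟩
    have h2 := hK'.dist_le_mul x hx'.1 q (mem_of_mem_nhds ht')
    rw [toHyperplane_self hz, dist_zero_right] at h2
    rw [mem_closedBall_zero_iff]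
    refine h2.trans ?_
    have : dist x q ≤ r := (Metric.mem_ball.1 hxr).le
    gcongr
  have hiso : Isometry (fun w : W => q + (w : Space m n)) := by
    apply Isometry.of_dist_eq
    intro a b
    rw [dist_add_left]; rfl
  have hsub2 : (fun w : W => q + (w : Space m n)) '' Metric.closedBall 0 (K' * r) ⊆ t := by
    rintro _ ⟨w, hw, rfl⟩
    apply hδt
    rw [Metric.mem_ball, dist_self_add_left]
    rw [mem_closedBall_zero_iff] at hw
    exact lt_of_le_of_lt hw hsmall
  refine (measure_mono hsub).trans ?_
  refine ((hK.mono hsub2).hausdorffMeasure_image_le (Nat.cast_nonneg d)).trans ?_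
  rw [hiso.hausdorffMeasure_image (Or.inl (Nat.cast_nonneg d)), ENNReal.rpow_natCast,
    ← hμW, Measure.addHaar_closedBall μW _ (by positivity), hfin, mul_pow,
    ENNReal.ofReal_mul (by positivity)]
  apply le_of_eq
  ring

lemma surfaceMeasure_ball_le {q : Space m n} (hα : 0 < α) (hq : q ∈ cone m n α) (hq0 : q ≠ 0) :
    ∃ C : ℝ≥0∞, C ≠ ⊤ ∧ ∃ r₀ > 0, ∀ r, 0 ≤ r → r ≤ r₀ →
      surfaceMeasure m n α (Metric.ball q r) ≤ C * ENNReal.ofReal (r ^ (m + n - 1)) := by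
  obtain ⟨C, hC, r₀, hr₀, h⟩ := hausdorff_ball_le hα hq hq0
  refine ⟨_ , ENNReal.mul_ne_top (ENNReal.coe_ne_top (r := Measure.addHaarScalarFactor
    (volume : Measure (EuclideanSpace ℝ (Fin (m + n - 1))))
      (Measure.hausdorffMeasure ((m + n - 1 : ℕ) : ℝ)))) hC, r₀, hr₀, fun r hr hrr => ?_⟩
  rw [surfaceMeasure, Measure.restrict_apply Metric.isOpen_ball.measurableSet,
    Measure.euclideanHausdorffMeasure_def, Measure.smul_apply, ENNReal.smul_def, smul_eq_mul,
    mul_assoc]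
  gcongr
  exact h r hr hrr

lemma surfaceMeasure_compl_cone : surfaceMeasure m n α (cone m n α)ᶜ = 0 := by
  rw [surfaceMeasure, Measure.restrict_apply measurableSet_cone.compl]
  simp

lemma ae_mem_cone : ∀ᵐ x ∂(surfaceMeasure m n α), x ∈ cone m n α :=
  ae_restrict_mem measurableSet_cone

lemma surfaceMeasure_singleton (hN : 2 ≤ m + n) (x : Space m n) :
    surfaceMeasure m n α {x} = 0 := by
  have hd : (0 : ℝ) < ((m + n - 1 : ℕ) : ℝ) := by
    exact_mod_cast (by omega : 0 < m + n - 1)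
  have h := Measure.nullSingletonClass_hausdorff (Space m n) hd
  rw [surfaceMeasure, Measure.euclideanHausdorffMeasure_def]
  refine le_antisymm ((Measure.restrict_apply_le _ _).trans ?_) zero_le
  rw [Measure.smul_apply, measure_singleton, smul_zero]

lemma ae_ne_zero (hN : 2 ≤ m + n) : ∀ᵐ x ∂(surfaceMeasure m n α), x ≠ 0 := by
  rw [ae_iff]
  simpa using surfaceMeasure_singleton hN 0

lemma surfaceMeasure_lt_top_of_isCompact (hα : 0 < α) {S : Set (Space m n)}
    (hS : IsCompact S) (h0 : (0 : Space m n) ∉ S) : surfaceMeasure m n α S < ⊤ := by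
  refine hS.measure_lt_top_of_nhdsWithin fun p hp => ?_
  have hp0 : p ≠ 0 := fun h => h0 (h ▸ hp)
  by_cases hpc : p ∈ cone m n α
  · obtain ⟨C, hC, r₀, hr₀, h⟩ := surfaceMeasure_ball_le hα hpc hp0
    exact ⟨Metric.ball p r₀, mem_nhdsWithin_of_mem_nhds (Metric.ball_mem_nhds p hr₀),
      (h r₀ hr₀.le le_rfl).trans_lt (ENNReal.mul_lt_top hC.lt_top ENNReal.ofReal_lt_top)⟩
  · exact ⟨(cone m n α)ᶜ, mem_nhdsWithin_of_mem_nhds (isClosed_cone.isOpen_compl.mem_nhds hpc),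
      by rw [surfaceMeasure_compl_cone]; exact ENNReal.zero_lt_top⟩

lemma isCompact_annulus (a b : ℝ) : IsCompact {x : Space m n | a ≤ ‖x‖ ∧ ‖x‖ ≤ b} := by
  apply (isCompact_closedBall (0 : Space m n) b).of_isClosed_subset
  · exact (isClosed_le continuous_const continuous_norm).inter
      (isClosed_le continuous_norm continuous_const)
  · intro x hx
    rw [mem_closedBall_zero_iff]; exact hx.2

lemma surfaceMeasure_annulus_lt_top (hα : 0 < α) {a : ℝ} (ha : 0 < a) (b : ℝ) :
    surfaceMeasure m n α {x | a ≤ ‖x‖ ∧ ‖x‖ ≤ b} < ⊤ := by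
  apply surfaceMeasure_lt_top_of_isCompact hα (isCompact_annulus a b)
  simp only [Set.mem_ofPred_eq, norm_zero, not_and]
  intro h; linarith

/-- The vertex is a null point and the rest is exhausted by compact annuli, so no bound on the
measure near the vertex is required. -/
lemma sigmaFinite_surfaceMeasure (hα : 0 < α) (hN : 2 ≤ m + n) :
    SigmaFinite (surfaceMeasure m n α) := by
  refine Measure.sigmaFinite_of_countable (S := insert {0} (Set.range fun k : ℕ =>
    {x : Space m n | 1 / ((k : ℝ) + 1) ≤ ‖x‖ ∧ ‖x‖ ≤ k + 1})) ?_ ?_ ?_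
  · exact (Set.countable_range _).insert _
  · rintro S (rfl | ⟨k, rfl⟩)
    · rw [surfaceMeasure_singleton hN]; exact ENNReal.zero_lt_top
    · exact surfaceMeasure_annulus_lt_top hα (by positivity) _
  · apply Set.eq_univ_of_forall
    intro x
    by_cases hx : x = 0
    · exact ⟨{0}, Set.mem_insert _ _, hx⟩
    · have hx' : 0 < ‖x‖ := norm_pos_iff.2 hx
      obtain ⟨k, hk⟩ := exists_nat_gt (max ‖x‖ (1 / ‖x‖))
      refine ⟨_, Set.mem_insert_of_mem _ ⟨k, rfl⟩, ?_, ?_⟩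
      · rw [div_le_iff₀ (by positivity)]
        have := (le_max_right _ _).trans hk.le
        rw [div_le_iff₀ hx'] at this
        nlinarith
      · linarith [(le_max_left ‖x‖ (1 / ‖x‖)).trans hk.le]

/-! ### Polar coordinates -/

lemma lintegral_smul_surfaceMeasure {r : ℝ} (hr : 0 < r) (f : Space m n → ℝ≥0∞) :
    ∫⁻ x, f (r • x) ∂(surfaceMeasure m n α)
      = ENNReal.ofReal (r ^ (m + n - 1))⁻¹ * ∫⁻ x, f x ∂(surfaceMeasure m n α) :=
  lintegral_similarity hr (Q := LinearIsometryEquiv.refl ℝ _) (fun _ => ⟨rfl, rfl⟩) f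

/-- The shell `{1 ≤ |x| < e}`. -/
def shell (m n : ℕ) : Set (Space m n) := {x | 1 ≤ ‖x‖ ∧ ‖x‖ < Real.exp 1}

lemma measurableSet_shell : MeasurableSet (shell m n) :=
  (measurableSet_le measurable_const measurable_norm).inter
    (measurableSet_lt measurable_norm measurable_const)

lemma surfaceMeasure_shell_lt_top (hα : 0 < α) : surfaceMeasure m n α (shell m n) < ⊤ :=
  (measure_mono (t := {x | 1 ≤ ‖x‖ ∧ ‖x‖ ≤ Real.exp 1}) fun _ hx => ⟨hx.1, hx.2.le⟩).trans_lt
    (surfaceMeasure_annulus_lt_top hα one_pos (Real.exp 1))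

/-- The dilates l⁻¹x lie in the shell exactly for l in (|x|/e, |x|], an interval of length 1 for
dl/l. This is a continuous partition of unity along rays. -/
lemma lintegral_shell_inv_smul {x : Space m n} (hx : x ≠ 0) :
    ∫⁻ l in Set.Ioi (0 : ℝ), (shell m n).indicator (fun _ => ENNReal.ofReal l⁻¹) (l⁻¹ • x) = 1 := by
  have hx' : 0 < ‖x‖ := norm_pos_iff.2 hx
  have hlt : ‖x‖ / Real.exp 1 < ‖x‖ := div_lt_self hx' (by simp)
  have h0 : 0 < ‖x‖ / Real.exp 1 := by positivity
  calc ∫⁻ l in Set.Ioi (0 : ℝ), (shell m n).indicator (fun _ => ENNReal.ofReal l⁻¹) (l⁻¹ • x)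
      = ∫⁻ l in Set.Ioi (0 : ℝ), (Set.Ioc (‖x‖ / Real.exp 1) ‖x‖).indicator
          (fun l => ENNReal.ofReal l⁻¹) l := by
        refine setLIntegral_congr_fun measurableSet_Ioi fun l hl => ?_
        have hl : 0 < l := hl
        have hiff : l⁻¹ • x ∈ shell m n ↔ l ∈ Set.Ioc (‖x‖ / Real.exp 1) ‖x‖ := by
          simp only [shell, Set.mem_ofPred_eq, norm_smul, norm_inv, Real.norm_of_nonneg hl.le,
            Set.mem_Ioc]
          rw [inv_mul_eq_div, le_div_iff₀ hl, one_mul, div_lt_iff₀ hl,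
            div_lt_iff₀ (Real.exp_pos 1), mul_comm, and_comm]
        by_cases h : l⁻¹ • x ∈ shell m n
        · simp only [Set.indicator_of_mem h, Set.indicator_of_mem (hiff.1 h)]
        · simp only [Set.indicator_of_notMem h, Set.indicator_of_notMem (fun h' => h (hiff.2 h'))]
    _ = ∫⁻ l in Set.Ioc (‖x‖ / Real.exp 1) ‖x‖, ENNReal.ofReal l⁻¹ := by
        rw [lintegral_indicator measurableSet_Ioc, Measure.restrict_restrict measurableSet_Ioc,
          Set.inter_eq_self_of_subset_left]
        intro l hl
        exact h0.trans hl.1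
    _ = 1 := by
        have hcont : ContinuousOn (fun l : ℝ => l⁻¹) (Set.Icc (‖x‖ / Real.exp 1) ‖x‖) :=
          continuousOn_inv₀.mono fun l hl => (h0.trans_le hl.1).ne'
        have hint : IntegrableOn (fun l : ℝ => l⁻¹) (Set.Ioc (‖x‖ / Real.exp 1) ‖x‖) :=
          hcont.integrableOn_Icc.mono_set Set.Ioc_subset_Icc_self
        rw [← ofReal_integral_eq_lintegral_ofReal hint]
        · rw [← intervalIntegral.integral_of_le hlt.le, integral_inv_of_pos h0 hx']
          rw [div_div_cancel₀ hx'.ne', Real.log_exp, ENNReal.ofReal_one]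
        · filter_upwards [ae_restrict_mem measurableSet_Ioc] with l hl
          exact (inv_pos.2 (h0.trans hl.1)).le

/-- Insert the factor 1 of `lintegral_shell_inv_smul`, exchange the integrals, and substitute x ↦ lx
at fixed l: scaling gives l^{N-1}, and the density 1/l turns it into l^{N-2}. The shell plays the
role of the unit sphere. -/
theorem lintegral_polar (hα : 0 < α) (hN : 2 ≤ m + n) {f : Space m n → ℝ≥0∞}
    (hf : Measurable f) :
    ∫⁻ x, f x ∂(surfaceMeasure m n α)
      = ∫⁻ x in shell m n, (∫⁻ l in Set.Ioi (0 : ℝ),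
          f (l • x) * ENNReal.ofReal (l ^ (m + n - 2))) ∂(surfaceMeasure m n α) := by
  have := sigmaFinite_surfaceMeasure (m := m) (n := n) hα hN
  set σ := surfaceMeasure m n α
  have hsm : Measurable fun z : ℝ × Space m n => z.1⁻¹ • z.2 :=
    measurable_fst.inv.smul measurable_snd
  have hsm' : Measurable fun z : ℝ × Space m n => z.1 • z.2 :=
    measurable_fst.smul measurable_snd
  calc ∫⁻ x, f x ∂σ
      = ∫⁻ x, (∫⁻ l in Set.Ioi (0 : ℝ),
          f x * (shell m n).indicator (fun _ => ENNReal.ofReal l⁻¹) (l⁻¹ • x)) ∂σ := by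
        refine lintegral_congr_ae ?_
        filter_upwards [ae_ne_zero hN] with x hx
        rw [lintegral_const_mul, lintegral_shell_inv_smul hx, mul_one]
        have h1 : (fun l : ℝ => (shell m n).indicator (fun _ => ENNReal.ofReal l⁻¹) (l⁻¹ • x))
          = ((fun l : ℝ => l⁻¹ • x) ⁻¹' shell m n).indicator (fun l => ENNReal.ofReal l⁻¹) := rfl
        rw [h1]
        exact (measurable_inv.ennreal_ofReal).indicator
          (measurableSet_shell.preimage (measurable_inv.smul_const x))
    _ = ∫⁻ l in Set.Ioi (0 : ℝ), ∫⁻ x,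
          f x * (shell m n).indicator (fun _ => ENNReal.ofReal l⁻¹) (l⁻¹ • x) ∂σ := by
        rw [lintegral_lintegral_swap]
        apply Measurable.aemeasurable
        apply (hf.comp measurable_fst).mul
        have h1 : (fun z : Space m n × ℝ =>
            (shell m n).indicator (fun _ => ENNReal.ofReal z.2⁻¹) (z.2⁻¹ • z.1))
          = ((fun z : Space m n × ℝ => z.2⁻¹ • z.1) ⁻¹' shell m n).indicator
            (fun z => ENNReal.ofReal z.2⁻¹) := rfl
        have h2 : Measurable fun z : Space m n × ℝ => z.2⁻¹ • z.1 :=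
          measurable_snd.inv.smul measurable_fst
        exact h1 ▸ (measurable_snd.inv.ennreal_ofReal).indicator (h2 measurableSet_shell)
    _ = ∫⁻ l in Set.Ioi (0 : ℝ), ∫⁻ x in shell m n,
          f (l • x) * ENNReal.ofReal (l ^ (m + n - 2)) ∂σ := by
        refine setLIntegral_congr_fun measurableSet_Ioi fun l hl => ?_
        have hl : 0 < l := hl
        have h1 := lintegral_smul_surfaceMeasure (m := m) (n := n) (α := α) hl (fun x =>
          f x * (shell m n).indicator (fun _ => ENNReal.ofReal l⁻¹) (l⁻¹ • x))
        simp only [inv_smul_smul₀ hl.ne'] at h1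
        have h2 : ∀ x, f x * (shell m n).indicator (fun _ => ENNReal.ofReal l⁻¹) x
            = (shell m n).indicator (fun x => f x * ENNReal.ofReal l⁻¹) x := by
          intro x; by_cases hx : x ∈ shell m n <;> simp [hx]
        have h3 : ∀ x, f (l • x) * (shell m n).indicator (fun _ => ENNReal.ofReal l⁻¹) x
            = (shell m n).indicator (fun x => f (l • x) * ENNReal.ofReal l⁻¹) x := by
          intro x; by_cases hx : x ∈ shell m n <;> simp [hx]
        have h4 : ENNReal.ofReal (l ^ (m + n - 1)) * ENNReal.ofReal (l ^ (m + n - 1))⁻¹ = 1 := by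
          rw [← ENNReal.ofReal_mul (by positivity), mul_inv_cancel₀ (by positivity),
            ENNReal.ofReal_one]
        have h5 : ENNReal.ofReal (l ^ (m + n - 2))
            = ENNReal.ofReal (l ^ (m + n - 1)) * ENNReal.ofReal l⁻¹ := by
          rw [← ENNReal.ofReal_mul (by positivity)]
          congr 1
          rw [show m + n - 1 = m + n - 2 + 1 by omega, pow_succ, mul_assoc,
            mul_inv_cancel₀ hl.ne', mul_one]
        calc _ = ENNReal.ofReal (l ^ (m + n - 1)) * (ENNReal.ofReal (l ^ (m + n - 1))⁻¹ *
              ∫⁻ x, f x * (shell m n).indicator (fun _ => ENNReal.ofReal l⁻¹) (l⁻¹ • x) ∂σ) := by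
              rw [← mul_assoc, h4, one_mul]
          _ = ENNReal.ofReal (l ^ (m + n - 1)) *
              ∫⁻ x in shell m n, f (l • x) * ENNReal.ofReal l⁻¹ ∂σ := by
              rw [← h1, ← lintegral_indicator measurableSet_shell]
              simp only [h3, σ]
          _ = _ := by
              rw [← lintegral_const_mul']
              · refine lintegral_congr fun x => ?_
                rw [h5]; ring
              · exact ENNReal.ofReal_ne_top
    _ = _ := by
        rw [lintegral_lintegral_swap]
        apply Measurable.aemeasurable
        exact (hf.comp hsm').mul ((measurable_fst.pow_const _).ennreal_ofReal)

/-! ### An involution fixing a point of the cone and preserving the distance to it -/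

lemma preservesParts_neg : PreservesParts (LinearIsometryEquiv.neg ℝ : Space m n ≃ₗᵢ[ℝ] Space m n) :=
  fun x => ⟨by
    rw [LinearIsometryEquiv.coe_neg]
    exact (congrArg norm (map_neg yPartL x)).trans (norm_neg _), by
    rw [LinearIsometryEquiv.coe_neg]
    exact (congrArg norm (map_neg zPartL x)).trans (norm_neg _)⟩

/-- The reflection in the plane spanned by `(yPart q, 0)` and `(0, zPart q)`. -/
def planeReflection (q : Space m n) : Space m n ≃ₗᵢ[ℝ] Space m n :=
  ((ℝ ∙ (join (yPart q) 0 : Space m n))ᗮ.reflection.trans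
    (ℝ ∙ (join 0 (zPart q) : Space m n))ᗮ.reflection).trans (LinearIsometryEquiv.neg ℝ)

lemma preservesParts_planeReflection (q : Space m n) : PreservesParts (planeReflection q) := by
  intro x
  have hA := preservesParts_reflection (v := (join (yPart q) 0 : Space m n)) (Or.inr rfl) x
  have hB := preservesParts_reflection (v := (join 0 (zPart q) : Space m n)) (Or.inl rfl)
    ((ℝ ∙ (join (yPart q) 0 : Space m n))ᗮ.reflection x)
  have hC := preservesParts_neg ((ℝ ∙ (join 0 (zPart q) : Space m n))ᗮ.reflection
    ((ℝ ∙ (join (yPart q) 0 : Space m n))ᗮ.reflection x))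
  exact ⟨hC.1.trans (hB.1.trans hA.1), hC.2.trans (hB.2.trans hA.2)⟩

lemma norm_join_zero (y : EuclideanSpace ℝ (Fin m)) : ‖(join y 0 : Space m n)‖ = ‖y‖ := by
  apply (sq_eq_sq₀ (norm_nonneg _) (norm_nonneg _)).1
  rw [norm_sq_eq_parts]; simp

lemma norm_join_zero' (z : EuclideanSpace ℝ (Fin n)) : ‖(join 0 z : Space m n)‖ = ‖z‖ := by
  apply (sq_eq_sq₀ (norm_nonneg _) (norm_nonneg _)).1
  rw [norm_sq_eq_parts]; simp

lemma planeReflection_apply (q x : Space m n) :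
    planeReflection q x = -(x - (2 * (inner ℝ (yPart q) (yPart x) / ‖yPart q‖ ^ 2)) • join (yPart q) 0
      - (2 * (inner ℝ (zPart q) (zPart x) / ‖zPart q‖ ^ 2)) • join 0 (zPart q)) := by
  simp only [planeReflection, LinearIsometryEquiv.trans_apply, LinearIsometryEquiv.coe_neg,
    reflection_orthogonal_singleton, norm_join_zero, norm_join_zero', inner_eq_parts, yPart_join,
    zPart_join, yPart_sub, zPart_sub, yPart_smul, zPart_smul, inner_zero_left, smul_zero, sub_zero,
    add_zero, zero_add]

lemma yPart_planeReflection (q x : Space m n) : yPart (planeReflection q x)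
    = (2 * (inner ℝ (yPart q) (yPart x) / ‖yPart q‖ ^ 2)) • yPart q - yPart x := by
  rw [planeReflection_apply, ← yPartL_apply, map_neg, yPartL_apply, yPart_sub, yPart_sub,
    yPart_smul, yPart_smul, yPart_join, yPart_join, smul_zero]
  abel

lemma zPart_planeReflection (q x : Space m n) : zPart (planeReflection q x)
    = (2 * (inner ℝ (zPart q) (zPart x) / ‖zPart q‖ ^ 2)) • zPart q - zPart x := by
  rw [planeReflection_apply, ← zPartL_apply, map_neg, zPartL_apply, zPart_sub, zPart_sub,
    zPart_smul, zPart_smul, zPart_join, zPart_join, smul_zero]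
  abel

lemma planeReflection_self {q : Space m n} (hy : yPart q ≠ 0) (hz : zPart q ≠ 0) :
    planeReflection q q = q := by
  have hy' : ‖yPart q‖ ^ 2 ≠ 0 := pow_ne_zero _ (norm_ne_zero_iff.2 hy)
  have hz' : ‖zPart q‖ ^ 2 ≠ 0 := pow_ne_zero _ (norm_ne_zero_iff.2 hz)
  apply ext_parts
  · rw [yPart_planeReflection, real_inner_self_eq_norm_sq, div_self hy', mul_one, two_smul]
    abel
  · rw [zPart_planeReflection, real_inner_self_eq_norm_sq, div_self hz', mul_one, two_smul]
    abel

/-- The factor by which `rayInvolution q` scales `x`. -/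
def rayFactor (q x : Space m n) : ℝ := 2 * inner ℝ q x / ‖x‖ ^ 2 - 1

/-- On each ray, the reflection in the point closest to `q`. -/
def rayInvolution (q x : Space m n) : Space m n := rayFactor q x • x

/-- The composition of `rayInvolution q` and `planeReflection q`. -/
def coneInvolution (q x : Space m n) : Space m n := planeReflection q (rayInvolution q x)

lemma measurable_rayInvolution (q : Space m n) : Measurable (rayInvolution q) := by
  unfold rayInvolution rayFactor
  have h1 : Measurable fun x : Space m n => (inner ℝ q x : ℝ) :=
    (continuous_const.inner continuous_id).measurable
  exact (((h1.const_mul 2).div (measurable_norm.pow_const 2)).sub_const 1).smul measurable_id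

lemma measurable_coneInvolution (q : Space m n) : Measurable (coneInvolution q) :=
  (planeReflection q).continuous.measurable.comp (measurable_rayInvolution q)

/-- On the line through 0 and x the point nearest to q is ⟨q,x⟩/|x|² · x; reflecting in it keeps the
distance to q by Pythagoras. -/
lemma norm_rayInvolution_sub {q x : Space m n} (hx : x ≠ 0) :
    ‖rayInvolution q x - q‖ = ‖x - q‖ := by
  have hx' : ‖x‖ ^ 2 ≠ 0 := pow_ne_zero _ (norm_ne_zero_iff.2 hx)
  apply (sq_eq_sq₀ (norm_nonneg _) (norm_nonneg _)).1
  rw [norm_sub_sq_real, norm_sub_sq_real, rayInvolution, norm_smul, mul_pow, real_inner_smul_left,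
    Real.norm_eq_abs, sq_abs, rayFactor, real_inner_comm]
  field_simp
  ring

lemma norm_coneInvolution_sub {q x : Space m n} (hy : yPart q ≠ 0) (hz : zPart q ≠ 0)
    (hx : x ≠ 0) : ‖coneInvolution q x - q‖ = ‖x - q‖ := by
  conv_lhs => rw [coneInvolution, ← planeReflection_self hy hz, planeReflection_self hy hz]
  rw [← norm_rayInvolution_sub hx, ← (planeReflection q).norm_map (rayInvolution q x - q), map_sub,
    planeReflection_self hy hz]

lemma coneInvolution_mem_cone {q x : Space m n} (hx : x ∈ cone m n α) :
    coneInvolution q x ∈ cone m n α :=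
  ((preservesParts_planeReflection q).mem_cone_iff _).2 (smul_mem_cone hx)

/-- Here l = |x|, D = |x - q| and k = `rayFactor q x`. The next lemma treats the coefficient along a
block of q, with a the projection coefficient of the block of x and B the inverse square of the norm
of the block of q. -/
lemma abs_one_sub_factor_le {l D k : ℝ} (hD0 : 0 ≤ D) (hD2 : D ≤ 1 / 2) (hl : |l - 1| ≤ D)
    (hk : k = (1 - D ^ 2) / l ^ 2) : |1 - k| ≤ 12 * D := by
  obtain ⟨hl1, hl2⟩ := abs_le.1 hl
  have hl0 : 1 / 2 ≤ l := by linarith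
  have hll : 1 / 4 ≤ l ^ 2 := by nlinarith
  have hlpos : 0 < l ^ 2 := by linarith
  have h1 : 1 - k = (l ^ 2 - 1 + D ^ 2) / l ^ 2 := by
    rw [hk, eq_div_iff hlpos.ne', sub_mul, div_mul_cancel₀ _ hlpos.ne']
    ring
  rw [h1, abs_div, abs_of_pos hlpos, div_le_iff₀ hlpos]
  have h2 : |l ^ 2 - 1 + D ^ 2| ≤ 3 * D := by
    rw [abs_le]; constructor <;> nlinarith
  have h3 : 12 * D * (1 / 4) ≤ 12 * D * l ^ 2 := by gcongr
  linarith

lemma abs_reflect_coeff_le {l D k a B δ : ℝ} (hD0 : 0 ≤ D) (hD2 : D ≤ 1 / 2)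
    (hl : |l - 1| ≤ D) (hB : 0 ≤ B) (hδ0 : 0 ≤ δ) (hδ1 : δ ≤ D ^ 2 * B / 2)
    (hk : k = (1 - D ^ 2) / l ^ 2) (ha : a = (1 + l ^ 2) / 2 - δ) :
    |(1 + k) * a - 2| ≤ (19 + 14 * B) * D ^ 2 := by
  obtain ⟨hl1, hl2⟩ := abs_le.1 hl
  have hl0 : 1 / 2 ≤ l := by linarith
  have hll : 1 / 4 ≤ l ^ 2 := by nlinarith
  have hlpos : 0 < l ^ 2 := by linarith
  have hl3 : l ^ 2 ≤ 9 / 4 := by nlinarith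
  have hX0 : 0 ≤ D ^ 2 := by positivity
  have hX1 : D ^ 2 ≤ 1 / 4 := by nlinarith
  -- All first order terms cancel here: each summand of the numerator contains (1 - l²)², δ or D²,
  -- and all of these are O(D²).
  have h1 : (1 + k) * a - 2
      = ((1 - l ^ 2) ^ 2 / 2 - (1 + l ^ 2) * δ - D ^ 2 * (1 + l ^ 2) / 2 + D ^ 2 * δ) / l ^ 2 := by
    rw [hk, ha]; field_simp; ring
  have h3 : (1 - l ^ 2) ^ 2 ≤ D ^ 2 * (25 / 4) := by
    have h5 : (1 + l) ^ 2 ≤ 25 / 4 := by nlinarith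
    calc (1 - l ^ 2) ^ 2 = (l - 1) ^ 2 * (1 + l) ^ 2 := by ring
      _ ≤ D ^ 2 * (25 / 4) := mul_le_mul (sq_le_sq' hl1 hl2) h5 (sq_nonneg _) hX0
  have h12 := sq_nonneg (1 - l ^ 2)
  generalize hX : D ^ 2 = X at *
  generalize hY : l ^ 2 = Y at *
  have hXB : 0 ≤ X * B := by positivity
  have h6 : (1 + Y) * δ ≤ 13 / 4 * (X * B / 2) :=
    mul_le_mul (by linarith) hδ1 hδ0 (by norm_num)
  have h6' : 0 ≤ (1 + Y) * δ := by positivity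
  have h7 : X * (1 + Y) ≤ X * (13 / 4) := mul_le_mul_of_nonneg_left (by linarith) hX0
  have h7' : 0 ≤ X * (1 + Y) := by positivity
  have h8 : X * δ ≤ 1 / 4 * (X * B / 2) := mul_le_mul hX1 hδ1 hδ0 (by norm_num)
  have h8' : 0 ≤ X * δ := by positivity
  have h9 : (19 + 14 * B) * X * (1 / 4) ≤ (19 + 14 * B) * X * Y :=
    mul_le_mul_of_nonneg_left hll (by positivity)
  have h10 : (19 + 14 * B) * X * (1 / 4) = 19 / 4 * X + 7 / 2 * (X * B) := by ring
  rw [h1, abs_div, abs_of_pos hlpos, div_le_iff₀ hlpos, abs_le]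
  constructor <;> linarith

/-- Second order estimate for the block components of `coneInvolution`. -/
lemma norm_reflect_add_sub_le {E : Type*} [NormedAddCommGroup E] [InnerProductSpace ℝ E]
    {v w : E} {l D k : ℝ} (hv : v ≠ 0) (hv1 : ‖v‖ ≤ 1) (hw : ‖w‖ = l * ‖v‖) (hD : ‖w - v‖ ≤ D)
    (hD2 : D ≤ 1 / 2) (hl : |l - 1| ≤ D) (hk : k = (1 - D ^ 2) / l ^ 2) :
    ‖k • ((2 * (inner ℝ v w / ‖v‖ ^ 2)) • v - w) + w - (2 : ℝ) • v‖
      ≤ (43 + 14 / ‖v‖ ^ 2) * D ^ 2 := by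
  have hv' : 0 < ‖v‖ := norm_pos_iff.2 hv
  have hD0 : 0 ≤ D := (norm_nonneg _).trans hD
  obtain ⟨hl1, hl2⟩ := abs_le.1 hl
  have hl0 : 1 / 2 ≤ l := by linarith
  have hlpos : 0 < l := by linarith
  have hll : 1 / 4 ≤ l ^ 2 := by nlinarith
  set a : ℝ := inner ℝ v w / ‖v‖ ^ 2 with ha
  set B : ℝ := 1 / ‖v‖ ^ 2 with hB
  have hBpos : 0 < B := by positivity
  set δ : ℝ := ‖w - v‖ ^ 2 * B / 2 with hδ
  have hδ0 : 0 ≤ δ := by positivity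
  have hδ1 : δ ≤ D ^ 2 * B / 2 := by rw [hδ]; gcongr
  have haδ : a = (1 + l ^ 2) / 2 - δ := by
    have h1 := norm_sub_sq_real w v
    rw [hw, real_inner_comm] at h1
    rw [ha, hδ, h1, hB]
    field_simp
    ring
  have hk1 : |1 - k| ≤ 12 * D := abs_one_sub_factor_le hD0 hD2 hl hk
  have hka : |(1 + k) * a - 2| ≤ (19 + 14 * B) * D ^ 2 :=
    abs_reflect_coeff_le hD0 hD2 hl hBpos.le hδ0 hδ1 hk haδ
  have hperp : ‖w - a • v‖ ≤ 2 * D := by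
    have h1 : w - a • v = (w - v) + (1 - a) • v := by rw [sub_smul, one_smul]; abel
    have h2 : |1 - a| * ‖v‖ ≤ D := by
      have h3 : 1 - a = - inner ℝ v (w - v) / ‖v‖ ^ 2 := by
        rw [inner_sub_right, real_inner_self_eq_norm_sq, ha]; field_simp; ring
      rw [h3, abs_div, abs_neg, abs_of_pos (by positivity : 0 < ‖v‖ ^ 2), pow_two, div_mul_eq_mul_div,
        mul_div_mul_right _ _ hv'.ne', div_le_iff₀ hv']
      calc |inner ℝ v (w - v)| ≤ ‖v‖ * ‖w - v‖ := abs_real_inner_le_norm _ _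
        _ ≤ D * ‖v‖ := by rw [mul_comm]; gcongr
    rw [h1]
    refine (norm_add_le _ _).trans ?_
    rw [norm_smul, Real.norm_eq_abs]
    linarith
  -- Split along v and orthogonally to it. The orthogonal term is a product of two first order
  -- quantities, and the coefficient of v is of second order by `hka`.
  have hdec : k • ((2 * a) • v - w) + w - (2 : ℝ) • v
      = (1 - k) • (w - a • v) + ((1 + k) * a - 2) • v := by
    module
  rw [hdec]
  refine (norm_add_le _ _).trans ?_
  rw [norm_smul, norm_smul, Real.norm_eq_abs, Real.norm_eq_abs]
  have e1 : |1 - k| * ‖w - a • v‖ ≤ 12 * D * (2 * D) := by gcongr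
  have e2 : |(1 + k) * a - 2| * ‖v‖ ≤ (19 + 14 * B) * D ^ 2 * 1 := by gcongr
  have e3 : 14 / ‖v‖ ^ 2 = 14 * B := by rw [hB]; ring
  rw [e3]
  nlinarith

lemma norm_le_parts (x : Space m n) : ‖x‖ ≤ ‖yPart x‖ + ‖zPart x‖ := by
  apply le_of_sq_le_sq _ (by positivity)
  rw [norm_sq_eq_parts]
  nlinarith [norm_nonneg (yPart x), norm_nonneg (zPart x)]

lemma parts_of_mem_cone {q x : Space m n} (hq : q ∈ cone m n α) (hq1 : ‖q‖ = 1)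
    (hx : x ∈ cone m n α) :
    ‖yPart x‖ = ‖x‖ * ‖yPart q‖ ∧ ‖zPart x‖ = ‖x‖ * ‖zPart q‖ := by
  have hyy : ‖yPart x‖ = ‖x‖ * ‖yPart q‖ := by
    apply (sq_eq_sq₀ (norm_nonneg _) (by positivity)).1
    have h1 := norm_sq_of_mem_cone hx
    have h2 := norm_sq_of_mem_cone hq
    rw [hq1] at h2
    rw [mul_pow, h1]
    linear_combination ‖yPart x‖ ^ 2 * h2
  refine ⟨hyy, ?_⟩
  rw [show ‖zPart x‖ = α * ‖yPart x‖ from hx, show ‖zPart q‖ = α * ‖yPart q‖ from hq, hyy]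
  ring

/-- At q, `rayInvolution` reverses the radial direction and `planeReflection` reverses the
directions orthogonal to the plane of (yPart q, 0) and (0, zPart q). Together these span the tangent
space of the cone, so the involution has differential -1 there. -/
lemma norm_coneInvolution_add_sub_le {q : Space m n} (hα : 0 < α) (hq : q ∈ cone m n α)
    (hq1 : ‖q‖ = 1) : ∃ C : ℝ, 0 ≤ C ∧ ∀ x ∈ cone m n α, ‖x - q‖ ≤ 1 / 2 →
      ‖coneInvolution q x + x - (2 : ℝ) • q‖ ≤ C * ‖x - q‖ ^ 2 := by
  have hq0 : q ≠ 0 := by rintro rfl; simp at hq1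
  have hy : yPart q ≠ 0 := norm_pos_iff.1 (norm_yPart_pos hq hq0)
  have hz : zPart q ≠ 0 := norm_pos_iff.1 (norm_zPart_pos hα hq hq0)
  refine ⟨(43 + 14 / ‖yPart q‖ ^ 2) + (43 + 14 / ‖zPart q‖ ^ 2), by positivity,
    fun x hx hxq => ?_⟩
  have hl : |‖x‖ - 1| ≤ ‖x - q‖ := by rw [← hq1]; exact abs_norm_sub_norm_le x q
  have hx0 : 0 < ‖x‖ := by linarith [(abs_le.1 hl).1]
  obtain ⟨hyy, hzz⟩ := parts_of_mem_cone hq hq1 hx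
  have hk : rayFactor q x = (1 - ‖x - q‖ ^ 2) / ‖x‖ ^ 2 := by
    rw [rayFactor, norm_sub_sq_real, hq1, real_inner_comm]
    field_simp
    ring
  have key : coneInvolution q x + x - (2 : ℝ) • q
      = rayFactor q x • planeReflection q x + x - (2 : ℝ) • q := by
    rw [coneInvolution, rayInvolution, map_smul]
  have e1 := norm_reflect_add_sub_le hy (by rw [← hq1]; exact norm_yPart_le q) hyy
    (by rw [← yPart_sub]; exact norm_yPart_le _) hxq hl hk
  have e2 := norm_reflect_add_sub_le hz (by rw [← hq1]; exact norm_zPart_le q) hzz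
    (by rw [← zPart_sub]; exact norm_zPart_le _) hxq hl hk
  rw [key]
  refine (norm_le_parts _).trans ?_
  rw [yPart_sub, yPart_add, yPart_smul, yPart_smul, yPart_planeReflection,
    zPart_sub, zPart_add, zPart_smul, zPart_smul, zPart_planeReflection]
  linarith

/-! ### Invariance of the weighted surface measure -/

/-- The surface measure with density `|x|^{-(N-2)}`. -/
def weightedMeasure (m n : ℕ) (α : ℝ) : Measure (Space m n) :=
  (surfaceMeasure m n α).withDensity fun x => ENNReal.ofReal (‖x‖ ^ (m + n - 2))⁻¹

lemma measurable_weight :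
    Measurable fun x : Space m n => ENNReal.ofReal (‖x‖ ^ (m + n - 2))⁻¹ :=
  ((measurable_norm.pow_const _).inv).ennreal_ofReal

/-- The density |x|^{-(N-2)} cancels the polar Jacobian l^{N-2}, leaving Lebesgue measure dl on each
ray. This is the reason for that weight. -/
lemma lintegral_weightedMeasure (hα : 0 < α) (hN : 2 ≤ m + n) {f : Space m n → ℝ≥0∞}
    (hf : Measurable f) :
    ∫⁻ x, f x ∂(weightedMeasure m n α)
      = ∫⁻ x in shell m n, (ENNReal.ofReal (‖x‖ ^ (m + n - 2))⁻¹ *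
          ∫⁻ l in Set.Ioi (0 : ℝ), f (l • x)) ∂(surfaceMeasure m n α) := by
  rw [weightedMeasure, lintegral_withDensity_eq_lintegral_mul _ measurable_weight hf,
    lintegral_polar hα hN (measurable_weight.mul hf)]
  refine setLIntegral_congr_fun measurableSet_shell fun x hx => ?_
  have hx0 : 0 < ‖x‖ := one_pos.trans_le hx.1
  rw [← lintegral_const_mul' _ _ ENNReal.ofReal_ne_top]
  refine setLIntegral_congr_fun measurableSet_Ioi fun l hl => ?_
  have hl : 0 < l := hl
  simp only [Pi.mul_apply]
  rw [mul_right_comm, ← ENNReal.ofReal_mul (by positivity), norm_smul, Real.norm_of_nonneg hl.le,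
    mul_pow, mul_inv, mul_comm (l ^ _)⁻¹, mul_assoc, inv_mul_cancel₀ (by positivity), mul_one]

/-- Since |q| = 1, the sphere of radius 1 about q passes through the vertex, and the ball cuts each
open ray in an initial segment (0, L), possibly empty. -/
lemma smul_mem_ball_iff {q x : Space m n} (hq1 : ‖q‖ = 1) (hx : x ≠ 0) {l : ℝ} (hl : 0 < l) :
    l • x ∈ Metric.ball q 1 ↔ l < 2 * inner ℝ q x / ‖x‖ ^ 2 := by
  have hx' : 0 < ‖x‖ := norm_pos_iff.2 hx
  rw [mem_ball_iff_norm, ← sq_lt_sq₀ (norm_nonneg _) zero_le_one, norm_sub_sq_real, hq1, norm_smul,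
    real_inner_smul_left, real_inner_comm, Real.norm_of_nonneg hl.le,
    lt_div_iff₀ (by positivity : 0 < ‖x‖ ^ 2)]
  constructor
  · intro h
    have h2 : l * (l * ‖x‖ ^ 2) < l * (2 * inner ℝ q x) := by nlinarith
    exact lt_of_mul_lt_mul_left h2 hl.le
  · intro h
    have h2 : l * (l * ‖x‖ ^ 2) < l * (2 * inner ℝ q x) := by gcongr
    nlinarith

lemma rayInvolution_smul {q x : Space m n} (hx : x ≠ 0) {l : ℝ} (hl : 0 < l) :
    rayInvolution q (l • x) = (2 * inner ℝ q x / ‖x‖ ^ 2 - l) • x := by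
  have hx' : ‖x‖ ≠ 0 := norm_ne_zero_iff.2 hx
  rw [rayInvolution, rayFactor, smul_smul, norm_smul, real_inner_smul_right,
    Real.norm_of_nonneg hl.le]
  congr 1
  field_simp

/-- On each ray the involution is l ↦ L - l, which maps the segment (0, L) to itself and preserves
dl. -/
lemma lintegral_rayInvolution (hα : 0 < α) (hN : 2 ≤ m + n) {q : Space m n} (hq1 : ‖q‖ = 1)
    {f : Space m n → ℝ≥0∞} (hf : Measurable f) :
    ∫⁻ x in Metric.ball q 1, f (rayInvolution q x) ∂(weightedMeasure m n α)
      = ∫⁻ x in Metric.ball q 1, f x ∂(weightedMeasure m n α) := by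
  have hB : MeasurableSet (Metric.ball q 1) := Metric.isOpen_ball.measurableSet
  change ∫⁻ x in Metric.ball q 1, (f ∘ rayInvolution q) x ∂(weightedMeasure m n α) = _
  rw [← lintegral_indicator hB, ← lintegral_indicator hB,
    lintegral_weightedMeasure hα hN (f := (Metric.ball q 1).indicator (f ∘ rayInvolution q))
      ((hf.comp (measurable_rayInvolution q)).indicator hB),
    lintegral_weightedMeasure hα hN (hf.indicator hB)]
  refine setLIntegral_congr_fun measurableSet_shell fun x hx => ?_
  have hx0 : x ≠ 0 := norm_pos_iff.1 (one_pos.trans_le hx.1)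
  congr 1
  set L : ℝ := 2 * inner ℝ q x / ‖x‖ ^ 2 with hL
  set g : ℝ → ℝ≥0∞ := (Set.Ioo 0 L).indicator fun l => f (l • x) with hg
  have h1 : ∫⁻ l in Set.Ioi (0 : ℝ), (Metric.ball q 1).indicator (f ∘ rayInvolution q) (l • x)
      = ∫⁻ l, g (L - l) := by
    rw [← lintegral_indicator measurableSet_Ioi]
    refine lintegral_congr fun l => ?_
    by_cases hl : 0 < l
    · rw [Set.indicator_of_mem (Set.mem_Ioi.2 hl)]
      by_cases hl2 : l < L
      · rw [Set.indicator_of_mem ((smul_mem_ball_iff hq1 hx0 hl).2 hl2), hg,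
          Set.indicator_of_mem (by constructor <;> linarith), Function.comp_apply,
          rayInvolution_smul hx0 hl]
      · rw [Set.indicator_of_notMem (fun h => hl2 ((smul_mem_ball_iff hq1 hx0 hl).1 h)), hg,
          Set.indicator_of_notMem (fun h => by linarith [h.1])]
    · rw [Set.indicator_of_notMem (by simpa using hl), hg,
        Set.indicator_of_notMem (fun h => by linarith [h.2])]
  have h2 : ∫⁻ l in Set.Ioi (0 : ℝ), (Metric.ball q 1).indicator f (l • x) = ∫⁻ l, g l := by
    rw [← lintegral_indicator measurableSet_Ioi]
    refine lintegral_congr fun l => ?_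
    by_cases hl : 0 < l
    · rw [Set.indicator_of_mem (Set.mem_Ioi.2 hl)]
      by_cases hl2 : l < L
      · rw [Set.indicator_of_mem ((smul_mem_ball_iff hq1 hx0 hl).2 hl2), hg,
          Set.indicator_of_mem (show l ∈ Set.Ioo 0 L from ⟨hl, hl2⟩)]
      · rw [Set.indicator_of_notMem (fun h => hl2 ((smul_mem_ball_iff hq1 hx0 hl).1 h)), hg,
          Set.indicator_of_notMem (fun h => hl2 h.2)]
    · rw [Set.indicator_of_notMem (by simpa using hl), hg,
        Set.indicator_of_notMem (fun h => hl h.1)]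
  rw [h1, h2,
    lintegral_sub_left_eq_self g L]

lemma map_isometry_weightedMeasure {Q : Space m n ≃ₗᵢ[ℝ] Space m n} (hQ : PreservesParts Q) :
    MeasurePreserving Q (weightedMeasure m n α) (weightedMeasure m n α) := by
  refine ⟨Q.continuous.measurable, ?_⟩
  ext A hA
  rw [Measure.map_apply Q.continuous.measurable hA, weightedMeasure, withDensity_apply _ hA,
    withDensity_apply _ (Q.continuous.measurable hA), ← lintegral_indicator hA,
    ← lintegral_indicator (Q.continuous.measurable hA)]
  conv_rhs => rw [← map_isometry_surfaceMeasure hQ]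
  rw [lintegral_map (measurable_weight.indicator hA) Q.continuous.measurable]
  refine lintegral_congr fun x => ?_
  by_cases hx : Q x ∈ A
  · rw [Set.indicator_of_mem hx, Set.indicator_of_mem (show x ∈ Q ⁻¹' A from hx), Q.norm_map]
  · rw [Set.indicator_of_notMem hx, Set.indicator_of_notMem (show x ∉ Q ⁻¹' A from hx)]

theorem measurePreserving_coneInvolution (hα : 0 < α) (hN : 2 ≤ m + n) {q : Space m n}
    (hq : q ∈ cone m n α) (hq1 : ‖q‖ = 1) :
    MeasurePreserving (coneInvolution q) ((weightedMeasure m n α).restrict (Metric.ball q 1))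
      ((weightedMeasure m n α).restrict (Metric.ball q 1)) := by
  have hq0 : q ≠ 0 := by rintro rfl; simp at hq1
  have hy : yPart q ≠ 0 := norm_pos_iff.1 (norm_yPart_pos hq hq0)
  have hz : zPart q ≠ 0 := norm_pos_iff.1 (norm_zPart_pos hα hq hq0)
  have h1 : MeasurePreserving (rayInvolution q)
      ((weightedMeasure m n α).restrict (Metric.ball q 1))
      ((weightedMeasure m n α).restrict (Metric.ball q 1)) := by
    refine ⟨measurable_rayInvolution q, ?_⟩
    ext A hA
    rw [← lintegral_indicator_one hA, ← lintegral_indicator_one hA,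
      lintegral_map (measurable_one.indicator hA) (measurable_rayInvolution q),
      lintegral_rayInvolution hα hN hq1 (measurable_one.indicator hA)]
  have h2 := (map_isometry_weightedMeasure (α := α)
    (preservesParts_planeReflection q)).restrict_preimage
    (s := Metric.ball q 1) Metric.isOpen_ball.measurableSet
  have h3 : planeReflection q ⁻¹' Metric.ball q 1 = Metric.ball q 1 := by
    ext x
    rw [Set.mem_preimage, mem_ball_iff_norm, mem_ball_iff_norm,
      ← (planeReflection q).norm_map (x - q), map_sub, planeReflection_self hy hz]
  rw [h3] at h2
  exact h2.comp h1

/-! ### The kernel -/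

lemma kernel_nonneg (p x : Space m n) : 0 ≤ kernel s p x := by
  unfold kernel; positivity

lemma kernel_comm (p x : Space m n) : kernel s p x = kernel s x p := by
  rw [kernel, kernel, norm_sub_rev]

lemma measurable_kernel : Measurable fun z : Space m n × Space m n => kernel s z.1 z.2 := by
  unfold kernel
  exact ((measurable_snd.sub measurable_fst).norm.pow_const _).const_div 1

lemma measurable_kernel_left (p : Space m n) : Measurable (kernel s p) :=
  ((measurable_id.sub_const p).norm.pow_const _).const_div 1

/-- The bound is uniform over |p| ≤ b, as needed for double integrals in which p ranges over the
support of a test function. -/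
lemma kernel_le (hs0 : 0 ≤ s) {p x : Space m n} {b ε : ℝ} (hε : 0 < ε) (hb : 0 ≤ b)
    (hp : ‖p‖ ≤ b) (hx : ε ≤ ‖x - p‖) :
    kernel s p x ≤ ((1 + b) / ε + 1) ^ ((m : ℝ) + n + s) * (1 + ‖x‖) ^ (-((m : ℝ) + n + s)) := by
  have hN : 0 ≤ (m : ℝ) + n + s := by positivity
  have h0 : 0 < ‖x - p‖ := hε.trans_le hx
  have h1 : 1 + ‖x‖ ≤ ((1 + b) / ε + 1) * ‖x - p‖ := by
    have h2 : ‖x‖ ≤ ‖x - p‖ + ‖p‖ := by simpa using norm_add_le (x - p) p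
    have h3 : 1 + b ≤ (1 + b) / ε * ‖x - p‖ := by
      rw [div_mul_eq_mul_div, le_div_iff₀ hε]; gcongr
    linarith
  have h4 := Real.rpow_le_rpow (by positivity) h1 hN
  rw [Real.mul_rpow (by positivity) (by positivity)] at h4
  rw [kernel, Real.rpow_neg (by positivity), div_le_iff₀ (by positivity), mul_right_comm,
    ← div_eq_mul_inv, le_div_iff₀ (by positivity), one_mul]
  exact h4

/-! ### Integrability of radial functions -/

lemma rpow_le_exp_abs {x : Space m n} (hx : x ∈ shell m n) (γ : ℝ) :
    ‖x‖ ^ γ ≤ Real.exp |γ| := by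
  have h0 : 0 < ‖x‖ := one_pos.trans_le hx.1
  rw [Real.rpow_def_of_pos h0, Real.exp_le_exp]
  have h1 : 0 ≤ Real.log ‖x‖ := Real.log_nonneg hx.1
  have h2 : Real.log ‖x‖ ≤ 1 := by
    rw [← Real.log_exp 1]; exact Real.log_le_log h0 hx.2.le
  calc Real.log ‖x‖ * γ ≤ Real.log ‖x‖ * |γ| := by gcongr; exact le_abs_self γ
    _ ≤ 1 * |γ| := by gcongr
    _ = |γ| := one_mul _

/-- In polar coordinates the integral becomes one of l^{γ+N-2} over Λ, since |x|^γ is bounded on the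
shell, which has finite measure. -/
lemma setLIntegral_rpow_norm_lt_top (hα : 0 < α) (hN : 2 ≤ m + n) {γ : ℝ} {S : Set (Space m n)}
    (hS : MeasurableSet S) {Λ : Set ℝ} (hΛ : MeasurableSet Λ) (hΛ0 : Λ ⊆ Set.Ioi 0)
    (hSΛ : ∀ x ∈ shell m n, ∀ l : ℝ, 0 < l → l • x ∈ S → l ∈ Λ)
    (hint : IntegrableOn (fun l : ℝ => l ^ (γ + (m + n - 2 : ℕ))) Λ) :
    ∫⁻ x in S, ENNReal.ofReal (‖x‖ ^ γ) ∂(surfaceMeasure m n α) < ⊤ := by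
  have hmeas : Measurable fun x : Space m n => ENNReal.ofReal (‖x‖ ^ γ) :=
    (measurable_norm.pow_const _).ennreal_ofReal
  rw [← lintegral_indicator hS, lintegral_polar hα hN (hmeas.indicator hS)]
  have hbound : ∀ x ∈ shell m n, ∫⁻ l in Set.Ioi (0 : ℝ),
      S.indicator (fun x : Space m n => ENNReal.ofReal (‖x‖ ^ γ)) (l • x) *
        ENNReal.ofReal (l ^ (m + n - 2))
      ≤ ENNReal.ofReal (Real.exp |γ|) *
        ∫⁻ l in Λ, ENNReal.ofReal (l ^ (γ + (m + n - 2 : ℕ))) := by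
    intro x hx
    rw [← lintegral_const_mul' _ _ ENNReal.ofReal_ne_top, ← lintegral_indicator hΛ,
      ← lintegral_indicator measurableSet_Ioi]
    refine lintegral_mono fun l => ?_
    by_cases hl : 0 < l
    · rw [Set.indicator_of_mem (Set.mem_Ioi.2 hl)]
      by_cases hlS : l • x ∈ S
      · rw [Set.indicator_of_mem hlS, Set.indicator_of_mem (hSΛ x hx l hl hlS),
          ← ENNReal.ofReal_mul (by positivity), ← ENNReal.ofReal_mul (by positivity)]
        apply ENNReal.ofReal_le_ofReal
        rw [norm_smul, Real.norm_of_nonneg hl.le, Real.mul_rpow hl.le (norm_nonneg _),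
          Real.rpow_add hl, Real.rpow_natCast]
        have := rpow_le_exp_abs hx γ
        calc l ^ γ * ‖x‖ ^ γ * l ^ (m + n - 2) = ‖x‖ ^ γ * (l ^ γ * l ^ (m + n - 2)) := by ring
          _ ≤ _ := by gcongr
      · rw [Set.indicator_of_notMem hlS, zero_mul]; exact zero_le
    · rw [Set.indicator_of_notMem (by simpa using hl)]; exact zero_le
  refine (setLIntegral_mono measurable_const hbound).trans_lt ?_
  rw [setLIntegral_const]
  refine ENNReal.mul_lt_top (ENNReal.mul_lt_top ENNReal.ofReal_lt_top ?_)
    (surfaceMeasure_shell_lt_top hα)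
  rw [← ofReal_integral_eq_lintegral_ofReal hint]
  · exact ENNReal.ofReal_lt_top
  · filter_upwards [ae_restrict_mem hΛ] with l hl
    exact Real.rpow_nonneg (le_of_lt (hΛ0 hl)) _

lemma integrableOn_rpow_norm_ball (hα : 0 < α) (hN : 2 ≤ m + n) {γ : ℝ}
    (hγ : 1 - ((m : ℝ) + n) < γ) :
    IntegrableOn (fun x : Space m n => ‖x‖ ^ γ) (Metric.ball 0 1) (surfaceMeasure m n α) := by
  have hcast : ((m + n - 2 : ℕ) : ℝ) = (m : ℝ) + n - 2 := by rw [Nat.cast_sub hN]; push_cast; rfl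
  refine ⟨(measurable_norm.pow_const _).aestronglyMeasurable, ?_⟩
  rw [hasFiniteIntegral_iff_ofReal (ae_of_all _ fun x => Real.rpow_nonneg (norm_nonneg _) _)]
  refine setLIntegral_rpow_norm_lt_top hα hN Metric.isOpen_ball.measurableSet
    (Λ := Set.Ioc 0 1) measurableSet_Ioc (fun l hl => hl.1) ?_ ?_
  · intro x hx l hl hlx
    refine ⟨hl, ?_⟩
    rw [mem_ball_zero_iff, norm_smul, Real.norm_of_nonneg hl.le] at hlx
    nlinarith [hx.1]
  · rw [← intervalIntegrable_iff_integrableOn_Ioc_of_le zero_le_one]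
    apply intervalIntegral.intervalIntegrable_rpow'
    rw [hcast]; linarith

lemma integrableOn_rpow_norm_compl_ball (hα : 0 < α) (hN : 2 ≤ m + n) {γ : ℝ}
    (hγ : γ < 1 - ((m : ℝ) + n)) :
    IntegrableOn (fun x : Space m n => ‖x‖ ^ γ) (Metric.ball 0 1)ᶜ (surfaceMeasure m n α) := by
  have hcast : ((m + n - 2 : ℕ) : ℝ) = (m : ℝ) + n - 2 := by rw [Nat.cast_sub hN]; push_cast; rfl
  refine ⟨(measurable_norm.pow_const _).aestronglyMeasurable, ?_⟩
  rw [hasFiniteIntegral_iff_ofReal (ae_of_all _ fun x => Real.rpow_nonneg (norm_nonneg _) _)]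
  -- Points of the shell have norm below e, so a dilate of norm at least 1 requires only l > 1/e.
  refine setLIntegral_rpow_norm_lt_top hα hN Metric.isOpen_ball.measurableSet.compl
    (Λ := Set.Ioi (Real.exp 1)⁻¹) measurableSet_Ioi
    (fun l hl => lt_trans (by positivity) (Set.mem_Ioi.1 hl)) ?_ ?_
  · intro x hx l hl hlx
    rw [Set.mem_compl_iff, mem_ball_zero_iff, norm_smul, Real.norm_of_nonneg hl.le, not_lt] at hlx
    rw [Set.mem_Ioi, inv_lt_iff_one_lt_mul₀' (Real.exp_pos 1), mul_comm]
    exact hlx.trans_lt (by gcongr; exact hx.2)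
  · refine integrableOn_Ioi_rpow_of_lt ?_ (by positivity)
    rw [hcast]; linarith

/-- The lower bound on γ gives integrability at the vertex, the upper bound integrability at
infinity against the decay of order N+s on a surface of dimension N-1. -/
lemma integrable_rpow_mul_decay (hα : 0 < α) (hN : 2 ≤ m + n) (hs0 : 0 ≤ s) {γ : ℝ}
    (hγ : 1 - ((m : ℝ) + n) < γ) (hγ' : γ < 1 + s) :
    Integrable (fun x : Space m n => ‖x‖ ^ γ * (1 + ‖x‖) ^ (-((m : ℝ) + n + s)))
      (surfaceMeasure m n α) := by
  have hmeas : Measurable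
      (fun x : Space m n => ‖x‖ ^ γ * (1 + ‖x‖) ^ (-((m : ℝ) + n + s))) :=
    (measurable_norm.pow_const _).mul ((measurable_norm.const_add 1).pow_const _)
  have hE : 0 ≤ (m : ℝ) + n + s := by positivity
  rw [← integrableOn_univ, ← Set.union_compl_self (Metric.ball (0 : Space m n) 1)]
  refine IntegrableOn.union ?_ ?_
  · refine (integrableOn_rpow_norm_ball hα hN hγ).mono' hmeas.aestronglyMeasurable
      (ae_of_all _ fun x => ?_)
    rw [Real.norm_of_nonneg (by positivity)]
    have : (1 + ‖x‖) ^ (-((m : ℝ) + n + s)) ≤ 1 :=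
      Real.rpow_le_one_of_one_le_of_nonpos (by linarith [norm_nonneg x]) (by linarith)
    have h2 : 0 ≤ ‖x‖ ^ γ := by positivity
    nlinarith
  · refine (integrableOn_rpow_norm_compl_ball hα hN (γ := γ - (m + n + s))
      (by linarith)).mono' hmeas.aestronglyMeasurable ?_
    filter_upwards [ae_restrict_mem Metric.isOpen_ball.measurableSet.compl] with x hx
    rw [Set.mem_compl_iff, mem_ball_zero_iff, not_lt] at hx
    have hx0 : 0 < ‖x‖ := one_pos.trans_le hx
    rw [Real.norm_of_nonneg (by positivity), sub_eq_add_neg, Real.rpow_add hx0]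
    have : (1 + ‖x‖) ^ (-((m : ℝ) + n + s)) ≤ ‖x‖ ^ (-((m : ℝ) + n + s)) :=
      Real.rpow_le_rpow_of_nonpos hx0 (by linarith) (by linarith)
    gcongr

/-! ### Integrability near a point of the cone -/

/-- Dyadic annuli about q: at radius t the integrand is of order t^{-(N+s-2)} and the measure at
most of order t^{N-1}. The contributions t^{1-s} form a convergent geometric series because s < 1.
-/
lemma exists_integrableOn_sq_mul_kernel (hα : 0 < α) (hN : 2 ≤ m + n) (hs0 : 0 ≤ s) (hs1 : s < 1)
    {q : Space m n} (hq : q ∈ cone m n α) (hq0 : q ≠ 0) :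
    ∃ r > 0, IntegrableOn (fun x => ‖x - q‖ ^ 2 * kernel s q x) (Metric.ball q r)
      (surfaceMeasure m n α) := by
  obtain ⟨C, hC, r₀, hr₀, hball⟩ := surfaceMeasure_ball_le hα hq hq0
  set σ := surfaceMeasure m n α
  have hE : 0 ≤ (m : ℝ) + n + s - 2 := by
    have : (2 : ℝ) ≤ (m : ℝ) + n := by exact_mod_cast hN
    linarith
  set γ : ℝ := (m : ℝ) + n + s - 2 with hγ
  have hcast : ((m + n - 1 : ℕ) : ℝ) = (m : ℝ) + n - 1 := by
    rw [Nat.cast_sub (by omega)]; push_cast; rfl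
  -- Starting at r₀/2 makes the open ball of radius 2t_k, which contains the k-th annulus,
  -- admissible for the ball bound.
  set t : ℕ → ℝ := fun k => r₀ / 2 * (1 / 2) ^ k with ht
  have ht0 : ∀ k, 0 < t k := fun k => by positivity
  set A : ℕ → Set (Space m n) := fun k => {x | t (k + 1) < ‖x - q‖ ∧ ‖x - q‖ ≤ t k} with hA
  have hAm : ∀ k, MeasurableSet (A k) := fun k =>
    (measurableSet_lt measurable_const (measurable_id.sub_const q).norm).inter
      (measurableSet_le (measurable_id.sub_const q).norm measurable_const)
  have hmeas : Measurable fun x => ‖x - q‖ ^ 2 * kernel s q x :=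
    ((measurable_id.sub_const q).norm.pow_const 2).mul (measurable_kernel_left q)
  refine ⟨r₀ / 2, by positivity, hmeas.aestronglyMeasurable, ?_⟩
  rw [hasFiniteIntegral_iff_ofReal
    (ae_of_all _ fun x => mul_nonneg (by positivity) (kernel_nonneg _ _))]
  have hcover : Metric.ball q (r₀ / 2) ⊆ {q} ∪ ⋃ k, A k := by
    intro x hx
    by_cases hxq : x = q
    · exact Or.inl hxq
    right
    have h0 : 0 < ‖x - q‖ := norm_pos_iff.2 (sub_ne_zero.2 hxq)
    rw [mem_ball_iff_norm] at hx
    obtain ⟨k, hk1, hk2⟩ := exists_nat_pow_near_of_lt_one (x := ‖x - q‖ / (r₀ / 2)) (y := 1 / 2)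
      (by positivity) ((div_le_one (by positivity)).2 hx.le) (by norm_num) (by norm_num)
    rw [lt_div_iff₀ (by positivity)] at hk1
    rw [div_le_iff₀ (by positivity)] at hk2
    exact Set.mem_iUnion.2 ⟨k, by simp only [ht]; linarith, by simp only [ht]; linarith⟩
  have hterm : ∀ k, ∫⁻ x in A k, ENNReal.ofReal (‖x - q‖ ^ 2 * kernel s q x) ∂σ
      ≤ C * ENNReal.ofReal ((r₀ / 4) ^ (-γ) * r₀ ^ (m + n - 1) * ((1 / 2) ^ (1 - s)) ^ k) := by
    intro k
    have h1 : ∀ x ∈ A k, ENNReal.ofReal (‖x - q‖ ^ 2 * kernel s q x)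
        ≤ ENNReal.ofReal ((t (k + 1)) ^ (-γ)) := by
      intro x hx
      apply ENNReal.ofReal_le_ofReal
      have h0 : 0 < ‖x - q‖ := (ht0 _).trans hx.1
      have h2 : ‖x - q‖ ^ 2 * kernel s q x = ‖x - q‖ ^ (-γ) := by
        rw [kernel, one_div, ← Real.rpow_neg h0.le, ← Real.rpow_natCast, ← Real.rpow_add h0]
        congr 1; push_cast; rw [hγ]; ring
      rw [h2]
      exact Real.rpow_le_rpow_of_nonpos (ht0 _) hx.1.le (by linarith)
    refine (setLIntegral_mono measurable_const h1).trans ?_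
    rw [setLIntegral_const]
    have h3 : A k ⊆ Metric.ball q (2 * t k) := by
      intro x hx
      rw [mem_ball_iff_norm]
      linarith [hx.2, ht0 k]
    have h4 : 2 * t k ≤ r₀ := by
      simp only [ht]
      have : ((1 : ℝ) / 2) ^ k ≤ 1 := pow_le_one₀ (by norm_num) (by norm_num)
      nlinarith
    have h5 := (measure_mono h3).trans (hball (2 * t k) (by linarith [ht0 k]) h4)
    calc ENNReal.ofReal ((t (k + 1)) ^ (-γ)) * σ (A k)
        ≤ ENNReal.ofReal ((t (k + 1)) ^ (-γ)) * (C * ENNReal.ofReal ((2 * t k) ^ (m + n - 1))) := by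
          gcongr
      _ = C * ENNReal.ofReal ((t (k + 1)) ^ (-γ) * (2 * t k) ^ (m + n - 1)) := by
          rw [ENNReal.ofReal_mul (by have := ht0 (k + 1); positivity)]; ring
      _ = _ := by
          congr 2
          have e1 : t (k + 1) = r₀ / 4 * (1 / 2) ^ k := by simp only [ht, pow_succ]; ring
          have e2 : 2 * t k = r₀ * (1 / 2) ^ k := by simp only [ht]; ring
          have e3 : (((1 : ℝ) / 2) ^ k) ^ (-γ) * (((1 : ℝ) / 2) ^ k) ^ (m + n - 1)
              = (((1 : ℝ) / 2) ^ (1 - s)) ^ k := by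
            have hpos : (0 : ℝ) < (1 / 2) ^ k := by positivity
            rw [← Real.rpow_natCast _ (m + n - 1), ← Real.rpow_add hpos, hcast,
              ← Real.rpow_natCast _ k, ← Real.rpow_natCast _ k, ← Real.rpow_mul (by norm_num),
              ← Real.rpow_mul (by norm_num)]
            congr 1
            rw [hγ]; ring
          rw [e1, e2, Real.mul_rpow (by positivity) (by positivity), mul_pow, ← e3]
          ring
  calc ∫⁻ x in Metric.ball q (r₀ / 2), ENNReal.ofReal (‖x - q‖ ^ 2 * kernel s q x) ∂σ
      ≤ ∫⁻ x in {q} ∪ ⋃ k, A k, ENNReal.ofReal (‖x - q‖ ^ 2 * kernel s q x) ∂σ :=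
        lintegral_mono_set hcover
    _ ≤ ∫⁻ x in {q}, ENNReal.ofReal (‖x - q‖ ^ 2 * kernel s q x) ∂σ +
        ∫⁻ x in ⋃ k, A k, ENNReal.ofReal (‖x - q‖ ^ 2 * kernel s q x) ∂σ :=
        lintegral_union_le _ _ _
    _ ≤ 0 + ∑' k, ∫⁻ x in A k, ENNReal.ofReal (‖x - q‖ ^ 2 * kernel s q x) ∂σ := by
        gcongr
        · rw [setLIntegral_measure_zero _ _ (surfaceMeasure_singleton hN q)]
        · exact lintegral_iUnion_le _ _
    _ ≤ ∑' k, C * ENNReal.ofReal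
          ((r₀ / 4) ^ (-γ) * r₀ ^ (m + n - 1) * ((1 / 2) ^ (1 - s)) ^ k) := by
        rw [zero_add]
        exact ENNReal.tsum_le_tsum hterm
    _ < ⊤ := by
        rw [ENNReal.tsum_mul_left]
        refine ENNReal.mul_lt_top hC.lt_top ?_
        have hsum : Summable fun k : ℕ =>
            (r₀ / 4) ^ (-γ) * r₀ ^ (m + n - 1) * (((1 : ℝ) / 2) ^ (1 - s)) ^ k := by
          apply Summable.mul_left
          exact summable_geometric_of_lt_one (by positivity)
            (Real.rpow_lt_one (by norm_num) (by norm_num) (by linarith))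
        rw [← ENNReal.ofReal_tsum_of_nonneg (fun k => by positivity) hsum]
        exact ENNReal.ofReal_lt_top

lemma integrableOn_kernel_mul_compl_ball (hα : 0 < α) (hN : 2 ≤ m + n) (hs0 : 0 ≤ s) {γ : ℝ}
    (hγ : 1 - ((m : ℝ) + n) < γ) (hγ' : γ < 1 + s) (p : Space m n) {ε : ℝ} (hε : 0 < ε) :
    IntegrableOn (fun x : Space m n => ‖x‖ ^ γ * kernel s p x) (Metric.ball p ε)ᶜ
      (surfaceMeasure m n α) := by
  refine ((integrable_rpow_mul_decay hα hN hs0 hγ hγ').const_mul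
    (((1 + ‖p‖) / ε + 1) ^ ((m : ℝ) + n + s))).integrableOn.mono'
    ((measurable_norm.pow_const _).mul (measurable_kernel_left p)).aestronglyMeasurable ?_
  filter_upwards [ae_restrict_mem Metric.isOpen_ball.measurableSet.compl] with x hx
  rw [Set.mem_compl_iff, mem_ball_iff_norm, not_lt] at hx
  rw [Real.norm_of_nonneg (mul_nonneg (by positivity) (kernel_nonneg _ _))]
  have h1 := kernel_le (m := m) (n := n) hs0 hε (norm_nonneg p) le_rfl hx
  have h2 : 0 ≤ ‖x‖ ^ γ := by positivity
  calc ‖x‖ ^ γ * kernel s p x ≤ ‖x‖ ^ γ * _ := mul_le_mul_of_nonneg_left h1 h2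
    _ = _ := by ring

lemma integrableOn_kernel_compl_ball (hα : 0 < α) (hN : 2 ≤ m + n) (hs0 : 0 ≤ s)
    (p : Space m n) {ε : ℝ} (hε : 0 < ε) :
    IntegrableOn (fun x : Space m n => kernel s p x) (Metric.ball p ε)ᶜ
      (surfaceMeasure m n α) := by
  have h : (2 : ℝ) ≤ (m : ℝ) + n := by exact_mod_cast hN
  simpa using integrableOn_kernel_mul_compl_ball (γ := 0) hα hN hs0 (by linarith) (by linarith) p hε

lemma integrableOn_sq_mul_kernel (hα : 0 < α) (hN : 2 ≤ m + n) (hs0 : 0 ≤ s) (hs1 : s < 1)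
    {q : Space m n} (hq : q ∈ cone m n α) (hq0 : q ≠ 0) (R : ℝ) :
    IntegrableOn (fun x => ‖x - q‖ ^ 2 * kernel s q x) (Metric.ball q R)
      (surfaceMeasure m n α) := by
  obtain ⟨r, hr, h⟩ := exists_integrableOn_sq_mul_kernel (s := s) hα hN hs0 hs1 hq hq0
  have hmeas : Measurable fun x => ‖x - q‖ ^ 2 * kernel s q x :=
    ((measurable_id.sub_const q).norm.pow_const 2).mul (measurable_kernel_left q)
  have h2 : IntegrableOn (fun x => ‖x - q‖ ^ 2 * kernel s q x)
      (Metric.ball q R ∩ (Metric.ball q r)ᶜ) (surfaceMeasure m n α) := by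
    refine (((integrableOn_kernel_compl_ball hα hN hs0 q hr).mono_set
      Set.inter_subset_right).const_mul (R ^ 2)).mono' hmeas.aestronglyMeasurable ?_
    filter_upwards [ae_restrict_mem (Metric.isOpen_ball.measurableSet.inter
      Metric.isOpen_ball.measurableSet.compl)] with x hx
    rw [Real.norm_of_nonneg (mul_nonneg (by positivity) (kernel_nonneg _ _))]
    have h3 := mem_ball_iff_norm.1 hx.1
    exact mul_le_mul_of_nonneg_right (by gcongr) (kernel_nonneg _ _)
  refine (h.union h2).mono_set fun x hx => ?_
  by_cases hxr : x ∈ Metric.ball q r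
  · exact Or.inl hxr
  · exact Or.inr ⟨hx, hxr⟩

/-! ### Existence of principal values -/

lemma HasPV.unique {μ : Measure (Space m n)} {p : Space m n} {f : Space m n → ℝ} {L L' : ℝ}
    (h : HasPV μ p f L) (h' : HasPV μ p f L') : L = L' :=
  tendsto_nhds_unique h.2 h'.2

lemma HasPV.pv_eq {μ : Measure (Space m n)} {p : Space m n} {f : Space m n → ℝ} {L : ℝ}
    (h : HasPV μ p f L) : pv μ p f = L := by
  have hex : ∃ L, HasPV μ p f L := ⟨L, h⟩
  rw [pv, dif_pos hex]
  exact hex.choose_spec.unique h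

lemma hasPV_pv {μ : Measure (Space m n)} {p : Space m n} {f : Space m n → ℝ}
    (h : ∃ L, HasPV μ p f L) : HasPV μ p f (pv μ p f) := by
  obtain ⟨L, hL⟩ := h
  rwa [hL.pv_eq]

lemma abs_pow_sub_one_le {a D : ℝ} (e : ℕ) (hD : |a - 1| ≤ D) (hD2 : D ≤ 1 / 2) :
    |a ^ e - 1| ≤ e * 2 ^ e * D := by
  have hD0 : 0 ≤ D := (abs_nonneg _).trans hD
  obtain ⟨h1, h2⟩ := abs_le.1 hD
  have ha : |a| ≤ 2 := abs_le.2 ⟨by linarith, by linarith⟩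
  induction e with
  | zero => simp
  | succ e ih =>
    have h3 : a ^ (e + 1) - 1 = a * (a ^ e - 1) + (a - 1) := by ring
    rw [h3]
    refine (abs_add_le _ _).trans ?_
    rw [abs_mul]
    have h4 : |a| * |a ^ e - 1| ≤ 2 * (e * 2 ^ e * D) := by gcongr
    have h5 : D ≤ 2 ^ (e + 1) * D := by
      have : (1 : ℝ) ≤ 2 ^ (e + 1) := one_le_pow₀ (by norm_num)
      nlinarith
    push_cast
    calc _ ≤ 2 * (e * 2 ^ e * D) + 2 ^ (e + 1) * D := by linarith
      _ = _ := by ring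

lemma integral_weightedMeasure_restrict {S : Set (Space m n)} (hS : MeasurableSet S)
    (f : Space m n → ℝ) :
    ∫ x in S, f x ∂(weightedMeasure m n α)
      = ∫ x in S, (‖x‖ ^ (m + n - 2))⁻¹ * f x ∂(surfaceMeasure m n α) := by
  rw [weightedMeasure, setIntegral_withDensity_eq_setIntegral_toReal_smul measurable_weight
    (ae_of_all _ fun _ => ENNReal.ofReal_lt_top) _ hS]
  refine setIntegral_congr_fun hS fun x _ => ?_
  simp only [smul_eq_mul]
  rw [ENNReal.toReal_ofReal (by positivity)]

lemma integrableOn_weightedMeasure_iff {S : Set (Space m n)} (hS : MeasurableSet S)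
    (f : Space m n → ℝ) :
    IntegrableOn f S (weightedMeasure m n α)
      ↔ IntegrableOn (fun x => (‖x‖ ^ (m + n - 2))⁻¹ * f x) S (surfaceMeasure m n α) := by
  rw [IntegrableOn, weightedMeasure, restrict_withDensity hS,
    integrable_withDensity_iff_integrable_smul' measurable_weight
      (ae_of_all _ fun _ => ENNReal.ofReal_lt_top), IntegrableOn]
  refine integrable_congr (ae_of_all _ fun x => ?_)
  simp only [smul_eq_mul]
  rw [ENNReal.toReal_ofReal (by positivity)]

lemma norm_bounds_of_near {q x : Space m n} (hq1 : ‖q‖ = 1) (hx : ‖x - q‖ ≤ 1 / 2) :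
    |‖x‖ - 1| ≤ ‖x - q‖ ∧ 1 / 2 ≤ ‖x‖ ∧ ‖x‖ ≤ 2 := by
  have h : |‖x‖ - 1| ≤ ‖x - q‖ := by rw [← hq1]; exact abs_norm_sub_norm_le x q
  obtain ⟨h1, h2⟩ := abs_le.1 h
  exact ⟨h, by linarith, by linarith⟩

/-- Pointwise bound for the symmetrization under `coneInvolution`. -/
lemma exists_abs_symmetrized_le (hα : 0 < α) {q : Space m n}
    (hq : q ∈ cone m n α) (hq1 : ‖q‖ = 1) (e : ℕ) :
    ∃ C : ℝ, 0 ≤ C ∧ ∀ (u : Space m n → ℝ) (L : Space m n →L[ℝ] ℝ) (M : ℝ), ‖L‖ ≤ M →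
      (∀ x ∈ cone m n α, ‖x - q‖ ≤ 1 / 2 → |u x - L (x - q)| ≤ M * ‖x - q‖ ^ 2) →
      ∀ x ∈ cone m n α, ‖x - q‖ ≤ 1 / 2 →
        |u x * ‖x‖ ^ e + u (coneInvolution q x) * ‖coneInvolution q x‖ ^ e|
          ≤ C * M * ‖x - q‖ ^ 2 := by
  obtain ⟨C, hC, hT⟩ := norm_coneInvolution_add_sub_le hα hq hq1
  have hq0 : q ≠ 0 := by rintro rfl; simp at hq1
  have hy : yPart q ≠ 0 := norm_pos_iff.1 (norm_yPart_pos hq hq0)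
  have hz : zPart q ≠ 0 := norm_pos_iff.1 (norm_zPart_pos hα hq hq0)
  refine ⟨C + 2 * (2 ^ e + e * 2 ^ e), by positivity, fun u L M hL hu x hx hxq => ?_⟩
  have hM : 0 ≤ M := (norm_nonneg _).trans hL
  have hx0 : x ≠ 0 := by
    rintro rfl; rw [zero_sub, norm_neg, hq1] at hxq; norm_num at hxq
  have hTx := coneInvolution_mem_cone (q := q) hx
  have hTd := norm_coneInvolution_sub hy hz hx0
  -- The factor |v|^e is 1 + O(|v - q|), so it does not change the linear part of u at q. The
  -- estimate is applied at x and at its image.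
  have key : ∀ v ∈ cone m n α, ‖v - q‖ ≤ 1 / 2 →
      |u v * ‖v‖ ^ e - L (v - q)| ≤ (2 ^ e + e * 2 ^ e) * M * ‖v - q‖ ^ 2 := by
    intro v hv hvq
    obtain ⟨h1, h2, h3⟩ := norm_bounds_of_near hq1 hvq
    have h4 := abs_pow_sub_one_le e h1 hvq
    have h5 := hu v hv hvq
    have h6 : |L (v - q)| ≤ M * ‖v - q‖ :=
      (L.le_opNorm _).trans (by gcongr)
    have h7 : ‖v‖ ^ e ≤ 2 ^ e := by gcongr
    have h8 : u v * ‖v‖ ^ e - L (v - q)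
        = (u v - L (v - q)) * ‖v‖ ^ e + L (v - q) * (‖v‖ ^ e - 1) := by ring
    rw [h8]
    refine (abs_add_le _ _).trans ?_
    rw [abs_mul, abs_mul, abs_of_nonneg (by positivity : 0 ≤ ‖v‖ ^ e)]
    calc |u v - L (v - q)| * ‖v‖ ^ e + |L (v - q)| * |‖v‖ ^ e - 1|
        ≤ (M * ‖v - q‖ ^ 2) * 2 ^ e + (M * ‖v - q‖) * (e * 2 ^ e * ‖v - q‖) := by gcongr
      _ = _ := by ring
  have k1 := key x hx hxq
  have k2 := key _ hTx (hTd.le.trans hxq)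
  -- The sum of the two linear parts is L of a second order quantity: this is where the first order
  -- term disappears.
  have k3 : |L (coneInvolution q x + x - (2 : ℝ) • q)| ≤ M * (C * ‖x - q‖ ^ 2) :=
    (L.le_opNorm _).trans (by gcongr; exact hT x hx hxq)
  rw [hTd] at k2
  have k4 : u x * ‖x‖ ^ e + u (coneInvolution q x) * ‖coneInvolution q x‖ ^ e
      = (u x * ‖x‖ ^ e - L (x - q)) + (u (coneInvolution q x) * ‖coneInvolution q x‖ ^ e
        - L (coneInvolution q x - q)) + L (coneInvolution q x + x - (2 : ℝ) • q) := by
    have : coneInvolution q x + x - (2 : ℝ) • q = (x - q) + (coneInvolution q x - q) := by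
      rw [two_smul]; abel
    rw [this, map_add]; ring
  rw [k4]
  refine (abs_add_le _ _).trans ((add_le_add_left (abs_add_le _ _) _).trans ?_)
  nlinarith

lemma integrableOn_weighted_sq_mul_kernel (hα : 0 < α) (hN : 2 ≤ m + n) (hs0 : 0 ≤ s) (hs1 : s < 1)
    {q : Space m n} (hq : q ∈ cone m n α) (hq1 : ‖q‖ = 1) :
    IntegrableOn (fun x => ‖x - q‖ ^ 2 * kernel s q x) (Metric.ball q (1 / 2))
      (weightedMeasure m n α) := by
  have hq0 : q ≠ 0 := by rintro rfl; simp at hq1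
  have hB : MeasurableSet (Metric.ball q (1 / 2)) := Metric.isOpen_ball.measurableSet
  have hmeas : Measurable fun x => ‖x - q‖ ^ 2 * kernel s q x :=
    ((measurable_id.sub_const q).norm.pow_const 2).mul (measurable_kernel_left q)
  rw [integrableOn_weightedMeasure_iff hB]
  refine ((integrableOn_sq_mul_kernel hα hN hs0 hs1 hq hq0 (1 / 2)).const_mul
    (2 ^ (m + n - 2))).mono'
    (((measurable_norm.pow_const _).inv).mul hmeas).aestronglyMeasurable ?_
  filter_upwards [ae_restrict_mem hB] with x hx
  have h := norm_bounds_of_near hq1 (mem_ball_iff_norm.1 hx).le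
  have h0 : 0 ≤ ‖x - q‖ ^ 2 * kernel s q x := mul_nonneg (by positivity) (kernel_nonneg _ _)
  rw [Real.norm_of_nonneg (mul_nonneg (by positivity) h0)]
  refine mul_le_mul_of_nonneg_right ?_ h0
  rw [← inv_pow]
  have : ‖x‖⁻¹ ≤ 2 := by
    rw [inv_le_comm₀ (by linarith) (by norm_num)]; linarith
  gcongr

-- Averaging the integrand with its image under `coneInvolution` replaces it near q by something
-- bounded by a multiple of |x-q|²·kernel, which is integrable, so dominated convergence gives the
-- limit ε → 0. The constant C does not depend on u; this yields bounds that are uniform in ε and,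
-- after rescaling, locally uniform in the base point.
set_option maxHeartbeats 1000000 in
theorem exists_hasPV (hα : 0 < α) (hN : 2 ≤ m + n) (hs0 : 0 ≤ s) (hs1 : s < 1)
    {q : Space m n} (hq : q ∈ cone m n α) (hq1 : ‖q‖ = 1) :
    ∃ C : ℝ, 0 ≤ C ∧ ∀ (u : Space m n → ℝ) (L : Space m n →L[ℝ] ℝ) (M : ℝ), Measurable u → ‖L‖ ≤ M →
      (∀ x ∈ cone m n α, ‖x - q‖ ≤ 1 / 2 → |u x - L (x - q)| ≤ M * ‖x - q‖ ^ 2) →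
      IntegrableOn (fun x => u x * kernel s q x) (Metric.ball q (1 / 2))ᶜ (surfaceMeasure m n α) →
      (∃ I : ℝ, HasPV (surfaceMeasure m n α) q (fun x => u x * kernel s q x) I) ∧
      ∀ ε : ℝ, 0 < ε → |∫ x in (Metric.ball q ε)ᶜ, u x * kernel s q x ∂(surfaceMeasure m n α)|
        ≤ C * M + ∫ x in (Metric.ball q (1 / 2))ᶜ, |u x * kernel s q x| ∂(surfaceMeasure m n α) := by
  have hq0 : q ≠ 0 := by rintro rfl; simp at hq1
  have hy : yPart q ≠ 0 := norm_pos_iff.1 (norm_yPart_pos hq hq0)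
  have hz : zPart q ≠ 0 := norm_pos_iff.1 (norm_zPart_pos hα hq hq0)
  set e := m + n - 2 with he
  obtain ⟨C, hC, hsym⟩ := exists_abs_symmetrized_le hα hq hq1 e
  have hDK := integrableOn_weighted_sq_mul_kernel (s := s) hα hN hs0 hs1 hq hq1
  set σ := surfaceMeasure m n α with hσ
  set ν := (weightedMeasure m n α).restrict (Metric.ball q 1) with hν
  set T := coneInvolution q with hTdef
  have hT : MeasurePreserving T ν ν := measurePreserving_coneInvolution hα hN hq hq1
  set B : Set (Space m n) := Metric.ball q (1 / 2) with hBdef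
  have hB : MeasurableSet B := Metric.isOpen_ball.measurableSet
  have hB1 : B ⊆ Metric.ball q 1 := Metric.ball_subset_ball (by norm_num)
  have hball : ∀ ε : ℝ, MeasurableSet (Metric.ball q ε) := fun ε => Metric.isOpen_ball.measurableSet
  set D : Space m n → ℝ := fun x => ‖x - q‖ ^ 2 * kernel s q x with hD
  have hDB : IntegrableOn D B ν := by
    rw [hν, IntegrableOn, Measure.restrict_restrict hB, Set.inter_eq_self_of_subset_left hB1]
    exact hDK
  refine ⟨1 / 2 * (C * ∫ x in B, D x ∂ν), ?_, ?_⟩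
  · have : 0 ≤ ∫ x in B, D x ∂ν := integral_nonneg fun x => mul_nonneg (by positivity)
      (kernel_nonneg _ _)
    exact mul_nonneg (by norm_num) (mul_nonneg hC this)
  intro u L M hu hL hTay hfar
  have hM : 0 ≤ M := (norm_nonneg _).trans hL
  have hsym := hsym u L M hL hTay
  set f : Space m n → ℝ := fun x => u x * kernel s q x with hf
  have hfm : Measurable f := hu.mul (measurable_kernel_left q)
  -- The factor |x|^e, with e = N - 2, undoes the density of the weighted measure, so that F dν = f
  -- dσ near q.
  set F : Space m n → ℝ := fun x => ‖x‖ ^ e * f x with hF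
  have hFm : Measurable F := (measurable_norm.pow_const _).mul hfm
  set S : ℝ → Set (Space m n) := fun ε => B ∩ (Metric.ball q ε)ᶜ with hS
  have hSm : ∀ ε, MeasurableSet (S ε) := fun ε => hB.inter (hball ε).compl
  -- integrability on the truncated regions
  have hfS : ∀ ε, 0 < ε → IntegrableOn f (S ε) σ := by
    intro ε hε
    refine (((integrableOn_kernel_compl_ball hα hN hs0 q hε).mono_set
      Set.inter_subset_right).const_mul M).mono' hfm.aestronglyMeasurable ?_
    filter_upwards [ae_restrict_mem (hSm ε), ae_restrict_of_ae ae_mem_cone] with x hx hxc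
    have hxq : ‖x - q‖ ≤ 1 / 2 := (mem_ball_iff_norm.1 hx.1).le
    rw [Real.norm_eq_abs, abs_mul, abs_of_nonneg (kernel_nonneg _ _)]
    refine mul_le_mul_of_nonneg_right ?_ (kernel_nonneg _ _)
    have h1 := hTay x hxc hxq
    have h2 : |L (x - q)| ≤ M * ‖x - q‖ := (L.le_opNorm _).trans (by gcongr)
    have h3 : |u x| ≤ |u x - L (x - q)| + |L (x - q)| := by
      simpa using abs_add_le (u x - L (x - q)) (L (x - q))
    have h4 : M * ‖x - q‖ ≤ M * (1 / 2) := by gcongr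
    have h5 : M * ‖x - q‖ ^ 2 ≤ M * (1 / 2) ^ 2 := by gcongr
    linarith
  have hFS : ∀ ε, 0 < ε → Integrable ((S ε).indicator F) ν := by
    intro ε hε
    rw [integrable_indicator_iff (hSm ε), IntegrableOn, hν, Measure.restrict_restrict (hSm ε),
      Set.inter_eq_self_of_subset_left (Set.inter_subset_left.trans hB1), ← IntegrableOn,
      integrableOn_weightedMeasure_iff (hSm ε)]
    refine (hfS ε hε).congr_fun (fun x hx => ?_) (hSm ε)
    have h := norm_bounds_of_near hq1 (mem_ball_iff_norm.1 hx.1).le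
    have h0 : ‖x‖ ^ e ≠ 0 := pow_ne_zero _ (by linarith)
    simp only [hF]
    rw [inv_mul_cancel_left₀ h0]
  have hint : ∀ ε, ∫ x in S ε, f x ∂σ = ∫ x, (S ε).indicator F x ∂ν := by
    intro ε
    rw [integral_indicator (hSm ε), hν, Measure.restrict_restrict (hSm ε),
      Set.inter_eq_self_of_subset_left (Set.inter_subset_left.trans hB1),
      integral_weightedMeasure_restrict (hSm ε)]
    refine setIntegral_congr_fun (hSm ε) fun x hx => ?_
    have h := norm_bounds_of_near hq1 (mem_ball_iff_norm.1 hx.1).le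
    have h0 : ‖x‖ ^ e ≠ 0 := pow_ne_zero _ (by linarith)
    simp only [hF]
    rw [inv_mul_cancel_left₀ h0]
  have hae : ∀ᵐ x ∂ν, x ∈ cone m n α ∧ x ≠ 0 := by
    have h1 : ∀ᵐ x ∂(weightedMeasure m n α), x ∈ cone m n α :=
      (withDensity_absolutelyContinuous _ _) ae_mem_cone
    filter_upwards [ae_restrict_of_ae h1, ae_restrict_mem (hball 1)] with x hx hx1
    refine ⟨hx, ?_⟩
    rintro rfl
    rw [mem_ball_iff_norm, zero_sub, norm_neg, hq1] at hx1
    exact lt_irrefl _ hx1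
  set G : Space m n → ℝ := fun x => F x + F (T x) with hG
  have hGm : Measurable G := hFm.add (hFm.comp (measurable_coneInvolution q))
  -- Both ν and the truncated region are invariant under T, the latter because T keeps the distance
  -- to q; so F and F ∘ T have the same integral.
  have hhalf : ∀ ε, 0 < ε → ∫ x in S ε, f x ∂σ = 1 / 2 * ∫ x, (S ε).indicator G x ∂ν := by
    intro ε hε
    have hm : AEStronglyMeasurable ((S ε).indicator F) ν :=
      (hFm.indicator (hSm ε)).aestronglyMeasurable
    have h1 : ∫ x, (S ε).indicator F (T x) ∂ν = ∫ x, (S ε).indicator F x ∂ν := by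
      have hm' : AEStronglyMeasurable ((S ε).indicator F) (Measure.map T ν) := by
        rw [hT.map_eq]; exact hm
      rw [← integral_map hT.measurable.aemeasurable hm', hT.map_eq]
    have h2 : Integrable (fun x => (S ε).indicator F (T x)) ν :=
      (hT.integrable_comp hm).2 (hFS ε hε)
    have h3 : ∫ x, (S ε).indicator G x ∂ν
        = ∫ x, (S ε).indicator F x + (S ε).indicator F (T x) ∂ν := by
      refine integral_congr_ae ?_
      filter_upwards [hae] with x hx
      have h4 : T x ∈ S ε ↔ x ∈ S ε := by
        simp only [hS, hBdef, Set.mem_inter_iff, Set.mem_compl_iff, mem_ball_iff_norm, hTdef,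
          norm_coneInvolution_sub hy hz hx.2]
      by_cases h5 : x ∈ S ε
      · rw [Set.indicator_of_mem h5, Set.indicator_of_mem h5, Set.indicator_of_mem (h4.2 h5)]
      · rw [Set.indicator_of_notMem h5, Set.indicator_of_notMem h5,
          Set.indicator_of_notMem (fun h => h5 (h4.1 h)), add_zero]
    rw [h3, integral_add (hFS ε hε) h2, h1, hint]
    ring
  have hGbound : ∀ ε, ∀ᵐ x ∂ν, ‖(S ε).indicator G x‖ ≤ B.indicator (fun x => C * M * D x) x := by
    intro ε
    filter_upwards [hae] with x hx
    by_cases h5 : x ∈ S ε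
    · rw [Set.indicator_of_mem h5, Set.indicator_of_mem h5.1]
      have hker : kernel s q (T x) = kernel s q x := by
        rw [kernel, kernel, hTdef, norm_coneInvolution_sub hy hz hx.2]
      have h6 : G x = (u x * ‖x‖ ^ e + u (T x) * ‖T x‖ ^ e) * kernel s q x := by
        simp only [hG, hF, hf, hker]; ring
      rw [h6, Real.norm_eq_abs, abs_mul, abs_of_nonneg (kernel_nonneg _ _)]
      have h7 := hsym x hx.1 (mem_ball_iff_norm.1 h5.1).le
      simp only [hD]
      rw [← mul_assoc]
      exact mul_le_mul_of_nonneg_right h7 (kernel_nonneg _ _)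
    · rw [Set.indicator_of_notMem h5, norm_zero]
      exact Set.indicator_nonneg (fun x _ => mul_nonneg (by positivity)
        (mul_nonneg (by positivity) (kernel_nonneg _ _))) x
  have hbi : Integrable (B.indicator (fun x => C * M * D x)) ν :=
    (integrable_indicator_iff hB).2 (hDB.const_mul _)
  have hlim : Tendsto (fun ε => ∫ x, (S ε).indicator G x ∂ν) (𝓝[>] 0)
      (𝓝 (∫ x, (B \ {q}).indicator G x ∂ν)) := by
    refine tendsto_integral_filter_of_dominated_convergence
      (B.indicator (fun x => C * M * D x)) ?_ (Eventually.of_forall hGbound) hbi ?_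
    · exact Eventually.of_forall fun ε => (hGm.indicator (hSm ε)).aestronglyMeasurable
    · refine ae_of_all _ fun x => ?_
      by_cases hxq : x = q
      · refine tendsto_const_nhds.congr' ?_
        filter_upwards [self_mem_nhdsWithin] with ε hε
        rw [Set.indicator_of_notMem (fun h => h.2 hxq), Set.indicator_of_notMem]
        rintro ⟨_, h⟩
        exact h (by rw [hxq]; exact Metric.mem_ball_self hε)
      · have h0 : 0 < ‖x - q‖ := norm_pos_iff.2 (sub_ne_zero.2 hxq)
        refine tendsto_const_nhds.congr' ?_
        filter_upwards [Ioo_mem_nhdsGT h0] with ε hε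
        have h6 : x ∉ Metric.ball q ε := by rw [mem_ball_iff_norm]; linarith [hε.2]
        by_cases hxB : x ∈ B
        · rw [Set.indicator_of_mem (show x ∈ B \ {q} from ⟨hxB, hxq⟩),
            Set.indicator_of_mem (show x ∈ S ε from ⟨hxB, h6⟩)]
        · rw [Set.indicator_of_notMem (fun h => hxB h.1), Set.indicator_of_notMem (fun h => hxB h.1)]
  have hsplit : ∀ ε, ε < 1 / 2 → (Metric.ball q ε)ᶜ = Bᶜ ∪ S ε := by
    intro ε hε
    ext x
    simp only [hS, hBdef, Set.mem_union, Set.mem_inter_iff, Set.mem_compl_iff, mem_ball_iff_norm]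
    constructor
    · intro h
      by_cases h2 : ‖x - q‖ < 1 / 2
      · exact Or.inr ⟨h2, h⟩
      · exact Or.inl h2
    · rintro (h | h)
      · intro h2; exact h (h2.trans hε)
      · exact h.2
  have hfint : ∀ ε, 0 < ε → IntegrableOn f (Metric.ball q ε)ᶜ σ := by
    intro ε hε
    by_cases h : ε < 1 / 2
    · rw [hsplit ε h]; exact hfar.union (hfS ε hε)
    · exact hfar.mono_set (Set.compl_subset_compl.2 (Metric.ball_subset_ball (not_lt.1 h)))
  have hfsplit : ∀ ε, 0 < ε → ε < 1 / 2 → ∫ x in (Metric.ball q ε)ᶜ, f x ∂σ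
      = ∫ x in Bᶜ, f x ∂σ + 1 / 2 * ∫ x, (S ε).indicator G x ∂ν := by
    intro ε hε h
    rw [hsplit ε h, setIntegral_union _ (hSm ε) hfar (hfS ε hε), hhalf ε hε]
    exact Set.disjoint_left.2 fun x hx hx' => hx hx'.1
  refine ⟨⟨∫ x in Bᶜ, f x ∂σ + 1 / 2 * ∫ x, (B \ {q}).indicator G x ∂ν, hfint, ?_⟩, ?_⟩
  · refine ((hlim.const_mul (1 / 2)).const_add (∫ x in Bᶜ, f x ∂σ)).congr' ?_
    filter_upwards [Ioo_mem_nhdsGT (by norm_num : (0 : ℝ) < 1 / 2)] with ε hε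
    exact (hfsplit ε hε.1 hε.2).symm
  · intro ε hε
    have h1 : |∫ x in Bᶜ, f x ∂σ| ≤ ∫ x in Bᶜ, |f x| ∂σ := abs_integral_le_integral_abs
    have h2 : |∫ x, (S ε).indicator G x ∂ν| ≤ C * M * ∫ x in B, D x ∂ν := by
      have := norm_integral_le_of_norm_le hbi (hGbound ε)
      rwa [integral_indicator hB, integral_const_mul, Real.norm_eq_abs] at this
    by_cases h : ε < 1 / 2
    · rw [hfsplit ε hε h]
      refine (abs_add_le _ _).trans ?_
      rw [abs_mul, abs_of_pos (by norm_num : (0 : ℝ) < 1 / 2)]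
      linarith
    -- For ε ≥ 1/2 the whole domain lies in the far region and the far integral alone suffices.
    · have h3 : |∫ x in (Metric.ball q ε)ᶜ, f x ∂σ| ≤ ∫ x in (Metric.ball q ε)ᶜ, |f x| ∂σ :=
        abs_integral_le_integral_abs
      have h4 : ∫ x in (Metric.ball q ε)ᶜ, |f x| ∂σ ≤ ∫ x in Bᶜ, |f x| ∂σ :=
        setIntegral_mono_set hfar.abs (ae_of_all _ fun x => abs_nonneg _)
          (LE.le.eventuallyLE
            (Set.compl_subset_compl.2 (Metric.ball_subset_ball (not_lt.1 h))))
      have h5 : 0 ≤ C * M * ∫ x in B, D x ∂ν := (abs_nonneg _).trans h2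
      linarith

/-! ### Scaling of integrals against the kernel -/

lemma norm_similarity {r : ℝ} (hr : 0 < r) (Q : Space m n ≃ₗᵢ[ℝ] Space m n) (x : Space m n) :
    ‖similarity hr Q x‖ = r * ‖x‖ := by
  rw [similarity_apply, norm_smul, Q.norm_map, Real.norm_of_nonneg hr.le]

lemma norm_similarity_sub {r : ℝ} (hr : 0 < r) (Q : Space m n ≃ₗᵢ[ℝ] Space m n)
    (p x : Space m n) : ‖similarity hr Q x - similarity hr Q p‖ = r * ‖x - p‖ := by
  rw [similarity_apply, similarity_apply, ← smul_sub, ← map_sub, norm_smul, Q.norm_map,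
    Real.norm_of_nonneg hr.le]

lemma kernel_similarity {r : ℝ} (hr : 0 < r) (Q : Space m n ≃ₗᵢ[ℝ] Space m n) (p x : Space m n) :
    kernel s (similarity hr Q p) (similarity hr Q x)
      = (r ^ ((m : ℝ) + n + s))⁻¹ * kernel s p x := by
  rw [kernel, kernel, norm_similarity_sub, Real.mul_rpow hr.le (norm_nonneg _)]
  rw [one_div, one_div, mul_inv]

lemma preimage_ball_similarity {r : ℝ} (hr : 0 < r) (Q : Space m n ≃ₗᵢ[ℝ] Space m n)
    (p : Space m n) (ε : ℝ) :
    similarity hr Q ⁻¹' (Metric.ball (similarity hr Q p) ε)ᶜ = (Metric.ball p (ε / r))ᶜ := by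
  ext x
  rw [Set.mem_preimage, Set.mem_compl_iff, Set.mem_compl_iff, mem_ball_iff_norm, mem_ball_iff_norm,
    norm_similarity_sub, lt_div_iff₀' hr]

/-- Scaling of the measure against scaling of the kernel: N-1-(N+s) = -(1+s), the origin of every
factor |p|^{-(1+s)}. -/
lemma pow_mul_inv_rpow {r : ℝ} (hr : 0 < r) (hN : 2 ≤ m + n) :
    r ^ (m + n - 1) * (r ^ ((m : ℝ) + n + s))⁻¹ = (r ^ (1 + s))⁻¹ := by
  rw [← Real.rpow_natCast, ← Real.rpow_neg hr.le, ← Real.rpow_add hr, ← Real.rpow_neg hr.le,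
    Nat.cast_sub (by omega)]
  congr 1; push_cast; ring

lemma integral_compl_ball_similarity (hN : 2 ≤ m + n) {r : ℝ} (hr : 0 < r)
    {Q : Space m n ≃ₗᵢ[ℝ] Space m n} (hQ : PreservesParts Q) {f g : Space m n → ℝ}
    (hfg : ∀ x, f (similarity hr Q x) = (r ^ ((m : ℝ) + n + s))⁻¹ * g x) (q : Space m n) (ε : ℝ) :
    ∫ x in (Metric.ball (similarity hr Q q) ε)ᶜ, f x ∂(surfaceMeasure m n α)
      = (r ^ (1 + s))⁻¹ * ∫ x in (Metric.ball q (ε / r))ᶜ, g x ∂(surfaceMeasure m n α) := by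
  have h := setIntegral_similarity (α := α) hr hQ f
    (S := (Metric.ball (similarity hr Q q) ε)ᶜ) Metric.isOpen_ball.measurableSet.compl
  simp only [hfg, preimage_ball_similarity] at h
  rw [integral_const_mul] at h
  rw [← pow_mul_inv_rpow hr hN, mul_assoc, h, mul_inv_cancel_left₀ (by positivity)]

lemma integrableOn_compl_ball_similarity {r : ℝ} (hr : 0 < r)
    {Q : Space m n ≃ₗᵢ[ℝ] Space m n} (hQ : PreservesParts Q) {f g : Space m n → ℝ}
    (hfg : ∀ x, f (similarity hr Q x) = (r ^ ((m : ℝ) + n + s))⁻¹ * g x) (q : Space m n) (ε : ℝ)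
    (hg : IntegrableOn g (Metric.ball q (ε / r))ᶜ (surfaceMeasure m n α)) :
    IntegrableOn f (Metric.ball (similarity hr Q q) ε)ᶜ (surfaceMeasure m n α) := by
  rw [← integrableOn_similarity_iff hr hQ f Metric.isOpen_ball.measurableSet.compl,
    preimage_ball_similarity]
  simp only [hfg]
  exact hg.const_mul _

lemma HasPV.similarity (hN : 2 ≤ m + n) {r : ℝ} (hr : 0 < r)
    {Q : Space m n ≃ₗᵢ[ℝ] Space m n} (hQ : PreservesParts Q) {f g : Space m n → ℝ}
    (hfg : ∀ x, f (similarity hr Q x) = (r ^ ((m : ℝ) + n + s))⁻¹ * g x) {q : Space m n} {L : ℝ}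
    (hg : HasPV (surfaceMeasure m n α) q g L) :
    HasPV (surfaceMeasure m n α) (NonlocalCone.similarity hr Q q) f ((r ^ (1 + s))⁻¹ * L) := by
  refine ⟨fun ε hε => integrableOn_compl_ball_similarity hr hQ hfg q ε (hg.1 _ (by positivity)), ?_⟩
  simp only [integral_compl_ball_similarity hN hr hQ hfg]
  refine Tendsto.const_mul _ (hg.2.comp ?_)
  refine tendsto_nhdsWithin_iff.2 ⟨?_, ?_⟩
  · have : Tendsto (fun ε : ℝ => ε / r) (𝓝 0) (𝓝 (0 / r)) := tendsto_id.div_const r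
    rw [zero_div] at this
    exact this.mono_left nhdsWithin_le_nhds
  · filter_upwards [self_mem_nhdsWithin] with ε hε
    exact div_pos hε hr

/-! ### The potential -/

/-- The cosine of the angle between `v` and `w`. -/
def cosine {E : Type*} [NormedAddCommGroup E] [InnerProductSpace ℝ E] (v w : E) : ℝ :=
  inner ℝ v w / (‖v‖ * ‖w‖)

lemma cosine_le_one {E : Type*} [NormedAddCommGroup E] [InnerProductSpace ℝ E] (v w : E) :
    cosine v w ≤ 1 :=
  div_le_one_of_le₀ (real_inner_le_norm v w) (by positivity)

lemma neg_one_le_cosine {E : Type*} [NormedAddCommGroup E] [InnerProductSpace ℝ E] (v w : E) :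
    -1 ≤ cosine v w :=
  (abs_le.1 (abs_real_inner_div_norm_mul_norm_le_one v w)).1

/-- |w - v|² = (|v| - |w|)² + 2|v||w|(1 - cos). -/
lemma one_sub_cosine_le {E : Type*} [NormedAddCommGroup E] [InnerProductSpace ℝ E] {v w : E}
    (hv : v ≠ 0) (hw : w ≠ 0) : 1 - cosine v w ≤ ‖w - v‖ ^ 2 / (2 * (‖v‖ * ‖w‖)) := by
  have hv' : 0 < ‖v‖ := norm_pos_iff.2 hv
  have hw' : 0 < ‖w‖ := norm_pos_iff.2 hw
  rw [le_div_iff₀ (by positivity), cosine, sub_mul, div_mul_eq_mul_div, mul_left_comm,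
    mul_div_assoc, mul_div_assoc, div_self (by positivity), norm_sub_sq_real, real_inner_comm]
  nlinarith [sq_nonneg (‖v‖ - ‖w‖)]

/-- No block has to be nonzero: with division by zero equal to zero, a vanishing block contributes 0
on both sides. -/
lemma inner_normal (p x : Space m n) : inner ℝ (normal α x) (normal α p)
    = (α ^ 2 * cosine (yPart p) (yPart x) + cosine (zPart p) (zPart x)) / (1 + α ^ 2) := by
  have hy : yPart (WithLp.toLp 2 (Sum.elim (fun i => α * yPart x i / ‖yPart x‖)
      (fun j => -(zPart x j / ‖zPart x‖))) : Space m n) = (α / ‖yPart x‖) • yPart x := by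
    ext i; simp [yPart]; ring
  have hy' : yPart (WithLp.toLp 2 (Sum.elim (fun i => α * yPart p i / ‖yPart p‖)
      (fun j => -(zPart p j / ‖zPart p‖))) : Space m n) = (α / ‖yPart p‖) • yPart p := by
    ext i; simp [yPart]; ring
  have hz : zPart (WithLp.toLp 2 (Sum.elim (fun i => α * yPart x i / ‖yPart x‖)
      (fun j => -(zPart x j / ‖zPart x‖))) : Space m n) = (-1 / ‖zPart x‖) • zPart x := by
    ext i; simp [zPart]; ring
  have hz' : zPart (WithLp.toLp 2 (Sum.elim (fun i => α * yPart p i / ‖yPart p‖)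
      (fun j => -(zPart p j / ‖zPart p‖))) : Space m n) = (-1 / ‖zPart p‖) • zPart p := by
    ext i; simp [zPart]; ring
  have hsq : (1 / Real.sqrt (1 + α ^ 2)) * (1 / Real.sqrt (1 + α ^ 2)) = 1 / (1 + α ^ 2) := by
    rw [div_mul_div_comm, one_mul, Real.mul_self_sqrt (by positivity)]
  rw [normal, normal, inner_smul_left, inner_smul_right, ← mul_assoc, RCLike.conj_to_real, hsq,
    inner_eq_parts, hy, hy', hz, hz', inner_smul_left, inner_smul_right, inner_smul_left,
    inner_smul_right, RCLike.conj_to_real, RCLike.conj_to_real, cosine, cosine,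
    real_inner_comm (yPart x), real_inner_comm (zPart x)]
  simp only [div_eq_mul_inv, mul_inv]
  ring

lemma cosine_self {E : Type*} [NormedAddCommGroup E] [InnerProductSpace ℝ E] {v : E}
    (hv : v ≠ 0) : cosine v v = 1 := by
  have hv' : 0 < ‖v‖ := norm_pos_iff.2 hv
  rw [cosine, real_inner_self_eq_norm_mul_norm, div_self (by positivity)]

lemma potentialIntegrand_eq {p : Space m n} (hy : yPart p ≠ 0) (hz : zPart p ≠ 0)
    (x : Space m n) : potentialIntegrand s α p x
      = ((α ^ 2 * (1 - cosine (yPart p) (yPart x)) + (1 - cosine (zPart p) (zPart x)))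
        / (1 + α ^ 2)) * kernel s p x := by
  rw [potentialIntegrand, inner_sub_left, inner_normal, inner_normal, cosine_self hy,
    cosine_self hz]
  ring

lemma cosine_smul_smul {E : Type*} [NormedAddCommGroup E] [InnerProductSpace ℝ E] {v w : E}
    {r : ℝ} (hr : 0 < r) : cosine (r • v) (r • w) = cosine v w := by
  rw [cosine, cosine, inner_smul_left, inner_smul_right, norm_smul, norm_smul,
    Real.norm_of_nonneg hr.le, RCLike.conj_to_real, ← mul_assoc, mul_mul_mul_comm,
    mul_div_mul_left _ _ (by positivity)]

lemma cosine_yPart_similarity {r : ℝ} (hr : 0 < r)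
    {Q : Space m n ≃ₗᵢ[ℝ] Space m n} (hQ : PreservesParts Q) (p x : Space m n) :
    cosine (yPart (similarity hr Q p)) (yPart (similarity hr Q x)) = cosine (yPart p) (yPart x) := by
  rw [similarity_apply, similarity_apply, yPart_smul, yPart_smul, cosine_smul_smul hr, cosine,
    cosine, hQ.inner_yPart, (hQ p).1, (hQ x).1]

lemma cosine_zPart_similarity {r : ℝ} (hr : 0 < r)
    {Q : Space m n ≃ₗᵢ[ℝ] Space m n} (hQ : PreservesParts Q) (p x : Space m n) :
    cosine (zPart (similarity hr Q p)) (zPart (similarity hr Q x)) = cosine (zPart p) (zPart x) := by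
  rw [similarity_apply, similarity_apply, zPart_smul, zPart_smul, cosine_smul_smul hr, cosine,
    cosine, hQ.inner_zPart, (hQ p).2, (hQ x).2]

lemma potentialIntegrand_similarity {r : ℝ} (hr : 0 < r)
    {Q : Space m n ≃ₗᵢ[ℝ] Space m n} (hQ : PreservesParts Q) (p x : Space m n) :
    potentialIntegrand s α (similarity hr Q p) (similarity hr Q x)
      = (r ^ ((m : ℝ) + n + s))⁻¹ * potentialIntegrand s α p x := by
  rw [potentialIntegrand, potentialIntegrand, inner_sub_left, inner_sub_left, inner_normal,
    inner_normal, inner_normal, inner_normal, kernel_similarity]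
  simp only [cosine_yPart_similarity hr hQ, cosine_zPart_similarity hr hQ]
  ring

lemma potential_similarity (hN : 2 ≤ m + n) {r : ℝ} (hr : 0 < r)
    {Q : Space m n ≃ₗᵢ[ℝ] Space m n} (hQ : PreservesParts Q) (p : Space m n) :
    potential s α (similarity hr Q p) = (r ^ (1 + s))⁻¹ * potential s α p := by
  have h := integral_similarity (α := α) hr hQ (potentialIntegrand s α (similarity hr Q p))
  simp only [potentialIntegrand_similarity hr hQ] at h
  rw [integral_const_mul] at h
  rw [potential, potential, ← pow_mul_inv_rpow hr hN, mul_assoc, h,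
    mul_inv_cancel_left₀ (by positivity)]

lemma measurable_cosine {E : Type*} [NormedAddCommGroup E] [InnerProductSpace ℝ E]
    [MeasurableSpace E] [BorelSpace E] (v : E) : Measurable (cosine v) := by
  unfold cosine
  exact (continuous_const.inner continuous_id).measurable.div (measurable_norm.const_mul _)

lemma measurable_potentialIntegrand {p : Space m n} (hy : yPart p ≠ 0) (hz : zPart p ≠ 0) :
    Measurable (potentialIntegrand s α p) := by
  rw [show potentialIntegrand s α p = _ from funext (potentialIntegrand_eq hy hz)]
  have h1 : Measurable fun x : Space m n => cosine (yPart p) (yPart x) :=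
    (measurable_cosine _).comp continuous_yPart.measurable
  have h2 : Measurable fun x : Space m n => cosine (zPart p) (zPart x) :=
    (measurable_cosine _).comp continuous_zPart.measurable
  exact ((((h1.const_sub 1).const_mul (α ^ 2)).add (h2.const_sub 1)).div_const _).mul
    (measurable_kernel_left p)

/-- The normals make 1 - ⟨ν(x), ν(q)⟩ a combination of terms 1 - cos, which are O(|x-q|²) near q and
bounded elsewhere. The potential therefore converges absolutely, without a principal value. -/
lemma integrable_potentialIntegrand (hα : 0 < α) (hN : 2 ≤ m + n) (hs0 : 0 ≤ s) (hs1 : s < 1)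
    {q : Space m n} (hq : q ∈ cone m n α) (hq1 : ‖q‖ = 1) :
    Integrable (potentialIntegrand s α q) (surfaceMeasure m n α) := by
  have hq0 : q ≠ 0 := by rintro rfl; simp at hq1
  have hy : yPart q ≠ 0 := norm_pos_iff.1 (norm_yPart_pos hq hq0)
  have hz : zPart q ≠ 0 := norm_pos_iff.1 (norm_zPart_pos hα hq hq0)
  have hy' : 0 < ‖yPart q‖ := norm_pos_iff.2 hy
  have hz' : 0 < ‖zPart q‖ := norm_pos_iff.2 hz
  have hm := measurable_potentialIntegrand (s := s) (α := α) hy hz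
  have hB : MeasurableSet (Metric.ball q (1 / 2)) := Metric.isOpen_ball.measurableSet
  have hco : ∀ x : Space m n, 0 ≤ (α ^ 2 * (1 - cosine (yPart q) (yPart x))
      + (1 - cosine (zPart q) (zPart x))) / (1 + α ^ 2) := by
    intro x
    have h1 := sub_nonneg.2 (cosine_le_one (yPart q) (yPart x))
    have h2 := sub_nonneg.2 (cosine_le_one (zPart q) (zPart x))
    positivity
  rw [← integrableOn_univ, ← Set.union_compl_self (Metric.ball q (1 / 2))]
  refine IntegrableOn.union ?_ ?_
  · refine ((integrableOn_sq_mul_kernel hα hN hs0 hs1 hq hq0 (1 / 2)).const_mul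
      (1 / ‖yPart q‖ ^ 2 + 1 / ‖zPart q‖ ^ 2)).mono' hm.aestronglyMeasurable ?_
    filter_upwards [ae_restrict_mem hB, ae_restrict_of_ae ae_mem_cone] with x hx hxc
    obtain ⟨-, hx1, -⟩ := norm_bounds_of_near hq1 (mem_ball_iff_norm.1 hx).le
    obtain ⟨h1, h2⟩ := parts_of_mem_cone hq hq1 hxc
    rw [potentialIntegrand_eq hy hz, Real.norm_of_nonneg (mul_nonneg (hco x) (kernel_nonneg _ _)),
      ← mul_assoc]
    refine mul_le_mul_of_nonneg_right ?_ (kernel_nonneg _ _)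
    have hxy : 0 < ‖yPart x‖ := by rw [h1]; positivity
    have hxz : 0 < ‖zPart x‖ := by rw [h2]; positivity
    have e1 : 1 - cosine (yPart q) (yPart x) ≤ 1 / ‖yPart q‖ ^ 2 * ‖x - q‖ ^ 2 := by
      refine (one_sub_cosine_le hy (norm_pos_iff.1 hxy)).trans ?_
      rw [h1, ← yPart_sub, one_div_mul_eq_div]
      apply div_le_div₀ (by positivity) (by gcongr; exact norm_yPart_le _) (by positivity)
      nlinarith [mul_pos hy' hy']
    have e2 : 1 - cosine (zPart q) (zPart x) ≤ 1 / ‖zPart q‖ ^ 2 * ‖x - q‖ ^ 2 := by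
      refine (one_sub_cosine_le hz (norm_pos_iff.1 hxz)).trans ?_
      rw [h2, ← zPart_sub, one_div_mul_eq_div]
      apply div_le_div₀ (by positivity) (by gcongr; exact norm_zPart_le _) (by positivity)
      nlinarith [mul_pos hz' hz']
    rw [div_le_iff₀ (by positivity)]
    have f1 : 0 ≤ 1 / ‖yPart q‖ ^ 2 * ‖x - q‖ ^ 2 := by positivity
    have f2 : 0 ≤ 1 / ‖zPart q‖ ^ 2 * ‖x - q‖ ^ 2 := by positivity
    nlinarith [mul_le_mul_of_nonneg_left e1 (sq_nonneg α), mul_nonneg (sq_nonneg α) f2]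
  · refine ((integrableOn_kernel_compl_ball hα hN hs0 q (by norm_num : (0 : ℝ) < 1 / 2)).const_mul
      2).mono' hm.aestronglyMeasurable (ae_of_all _ fun x => ?_)
    rw [potentialIntegrand_eq hy hz, Real.norm_of_nonneg (mul_nonneg (hco x) (kernel_nonneg _ _))]
    refine mul_le_mul_of_nonneg_right ?_ (kernel_nonneg _ _)
    rw [div_le_iff₀ (by positivity)]
    have h1 := neg_one_le_cosine (yPart q) (yPart x)
    have h2 := neg_one_le_cosine (zPart q) (zPart x)
    nlinarith [sq_nonneg α]

lemma integrable_potentialIntegrand_and_potential_eq (hα : 0 < α) (hN : 2 ≤ m + n) (hs0 : 0 ≤ s)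
    (hs1 : s < 1) {q : Space m n} (hq : q ∈ cone m n α) (hq1 : ‖q‖ = 1) {p : Space m n}
    (hp : p ∈ cone m n α) (hp0 : p ≠ 0) :
    Integrable (potentialIntegrand s α p) (surfaceMeasure m n α) ∧
      potential s α p = potential s α q / ‖p‖ ^ (1 + s) := by
  obtain ⟨Q, hQ, hQp⟩ := exists_similarity hp hp0 hq hq1
  constructor
  · rw [← hQp, ← integrable_similarity_iff (norm_pos_iff.2 hp0) hQ]
    simp only [potentialIntegrand_similarity _ hQ]
    exact (integrable_potentialIntegrand hα hN hs0 hs1 hq hq1).const_mul _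
  · conv_lhs => rw [← hQp]
    rw [potential_similarity hN _ hQ, div_eq_inv_mul]

/-! ### First order Taylor expansion -/

lemma abs_sub_fderiv_le {E : Type*} [NormedAddCommGroup E] [NormedSpace ℝ E] {f : E → ℝ} {p : E}
    {ρ K : ℝ} (hd : ∀ z ∈ Metric.closedBall p ρ, DifferentiableAt ℝ f z)
    (hK : ∀ z ∈ Metric.closedBall p ρ, ‖fderiv ℝ f z - fderiv ℝ f p‖ ≤ K * ‖z - p‖) (hK0 : 0 ≤ K)
    {x : E} (hx : ‖x - p‖ ≤ ρ) :
    |f x - f p - fderiv ℝ f p (x - p)| ≤ K * ‖x - p‖ ^ 2 := by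
  have hsub : Metric.closedBall p ‖x - p‖ ⊆ Metric.closedBall p ρ :=
    Metric.closedBall_subset_closedBall hx
  have h := Convex.norm_image_sub_le_of_norm_fderiv_le' (𝕜 := ℝ) (f := f) (φ := fderiv ℝ f p)
    (C := K * ‖x - p‖) (s := Metric.closedBall p ‖x - p‖) (x := p) (y := x)
    (fun z hz => hd z (hsub hz)) (fun z hz => (hK z (hsub hz)).trans (by
      have := mem_closedBall_iff_norm.1 hz
      gcongr)) (convex_closedBall _ _) (Metric.mem_closedBall_self (norm_nonneg _))
      (mem_closedBall_iff_norm.2 le_rfl)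
  rw [Real.norm_eq_abs, mul_assoc, ← pow_two] at h
  exact h

lemma exists_taylor_bound {E : Type*} [NormedAddCommGroup E] [NormedSpace ℝ E] {f : E → ℝ} {p : E}
    (hf : ContDiffAt ℝ 2 f p) :
    ∃ ρ > 0, ∃ K, 0 ≤ K ∧ ∀ x, ‖x - p‖ ≤ ρ →
      |f x - f p - fderiv ℝ f p (x - p)| ≤ K * ‖x - p‖ ^ 2 := by
  have h1 : ContDiffAt ℝ 1 (fderiv ℝ f) p := hf.fderiv_right (by norm_num)
  obtain ⟨K, t, ht, hK⟩ := h1.exists_lipschitzOnWith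
  have hd : ∀ᶠ z in 𝓝 p, DifferentiableAt ℝ f z := by
    filter_upwards [hf.eventually (by simp)] with z hz
    exact hz.differentiableAt (by simp)
  obtain ⟨ρ, hρ, hsub⟩ := Metric.nhds_basis_closedBall.mem_iff.1 (inter_mem ht hd)
  refine ⟨ρ, hρ, K, K.2, fun x hx => abs_sub_fderiv_le (fun z hz => (hsub hz).2) (fun z hz => ?_)
    K.2 hx⟩
  have := hK.dist_le_mul z (hsub hz).1 p (mem_of_mem_nhds ht)
  rwa [dist_eq_norm, dist_eq_norm] at this

/-! ### The Hardy constant -/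

/-- The weight `|x|^{-(N-2-s)/2}`. -/
def weight (s : ℝ) (x : Space m n) : ℝ := ‖x‖ ^ (-(((m : ℝ) + (n : ℝ) - 2 - s) / 2))

lemma weight_nonneg (x : Space m n) : 0 ≤ weight s x := Real.rpow_nonneg (norm_nonneg _) _

lemma weight_pos {x : Space m n} (hx : x ≠ 0) : 0 < weight s x :=
  Real.rpow_pos_of_pos (norm_pos_iff.2 hx) _

lemma measurable_weightFun : Measurable (weight s : Space m n → ℝ) :=
  measurable_norm.pow_const _

lemma weight_eq_one {q : Space m n} (hq1 : ‖q‖ = 1) : weight s q = 1 := by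
  rw [weight, hq1, Real.one_rpow]

lemma weight_similarity {r : ℝ} (hr : 0 < r) (Q : Space m n ≃ₗᵢ[ℝ] Space m n) (x : Space m n) :
    weight s (similarity hr Q x) = r ^ (-(((m : ℝ) + n - 2 - s) / 2)) * weight s x := by
  rw [weight, norm_similarity, Real.mul_rpow hr.le (norm_nonneg _), weight]

lemma weight_ratio_similarity {r : ℝ} (hr : 0 < r) (Q : Space m n ≃ₗᵢ[ℝ] Space m n)
    {q : Space m n} (hq1 : ‖q‖ = 1) (x : Space m n) :
    weight s (similarity hr Q x) / weight s (similarity hr Q q) = weight s x := by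
  rw [weight_similarity, weight_similarity, weight_eq_one hq1, mul_one,
    mul_div_cancel_left₀ _ (Real.rpow_pos_of_pos hr _).ne']

lemma contDiffAt_weight {q : Space m n} (hq : q ≠ 0) : ContDiffAt ℝ 2 (weight s) q := by
  unfold weight
  exact (contDiffAt_norm ℝ hq).rpow_const_of_ne (norm_ne_zero_iff.2 hq)

/-- Taylor's formula gives the bound only on some radius ρ, whereas `exists_hasPV` asks for radius
1/2. Between the two, the left side is bounded and |x-q|² ≥ ρ², so a larger constant works. -/
lemma exists_weight_taylor {q : Space m n} (hq1 : ‖q‖ = 1) :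
    ∃ M : ℝ, ‖fderiv ℝ (weight s) q‖ ≤ M ∧ ∀ x : Space m n, ‖x - q‖ ≤ 1 / 2 →
      |weight s x - 1 - fderiv ℝ (weight s) q (x - q)| ≤ M * ‖x - q‖ ^ 2 := by
  have hq0 : q ≠ 0 := by rintro rfl; simp at hq1
  obtain ⟨ρ, hρ, K, hK, h⟩ := exists_taylor_bound (contDiffAt_weight (s := s) hq0)
  set φ := fderiv ℝ (weight s) q with hφ
  set γ := -(((m : ℝ) + n - 2 - s) / 2) with hγ
  set A : ℝ := 2 ^ |γ| + 1 + ‖φ‖ with hA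
  have hA0 : 0 ≤ A := by positivity
  refine ⟨K + A / ρ ^ 2 + ‖φ‖, by have : 0 ≤ K + A / ρ ^ 2 := by positivity
                                  linarith, fun x hx => ?_⟩
  by_cases hxρ : ‖x - q‖ ≤ ρ
  · have h1 := h x hxρ
    rw [weight_eq_one hq1] at h1
    refine h1.trans ?_
    have : 0 ≤ A / ρ ^ 2 + ‖φ‖ := by positivity
    nlinarith [sq_nonneg ‖x - q‖]
  · obtain ⟨-, h2, h3⟩ := norm_bounds_of_near hq1 hx
    have hw : weight s x ≤ 2 ^ |γ| := by
      have hx0 : 0 < ‖x‖ := by linarith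
      rw [weight, ← hγ]
      rcases le_total 0 γ with hg | hg
      · rw [abs_of_nonneg hg]; exact Real.rpow_le_rpow hx0.le h3 hg
      · rw [abs_of_nonpos hg, ← inv_inv ‖x‖, Real.inv_rpow (by positivity), ← Real.rpow_neg (by positivity)]
        apply Real.rpow_le_rpow (by positivity) _ (by linarith)
        rw [inv_le_comm₀ hx0 (by norm_num)]; linarith
    have hw0 := weight_nonneg (s := s) x
    have h4 : |φ (x - q)| ≤ ‖φ‖ := (φ.le_opNorm _).trans (by nlinarith [norm_nonneg φ])
    have h5 : |weight s x - 1 - φ (x - q)| ≤ A := by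
      obtain ⟨h6, h7⟩ := abs_le.1 h4
      rw [abs_le, hA]
      constructor <;> linarith [norm_nonneg φ]
    refine h5.trans ?_
    have h8 : A ≤ A / ρ ^ 2 * ‖x - q‖ ^ 2 := by
      rw [div_mul_eq_mul_div, le_div_iff₀ (by positivity)]
      have : ρ ≤ ‖x - q‖ := (not_le.1 hxρ).le
      gcongr
    have : 0 ≤ K + ‖φ‖ := by positivity
    nlinarith [sq_nonneg ‖x - q‖]

/-- This places the exponent of w strictly inside the window of `integrable_rpow_mul_decay`. -/
lemma weight_exponent_bounds (hN : 2 ≤ m + n) (hs0 : 0 ≤ s) :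
    1 - ((m : ℝ) + n) < -(((m : ℝ) + n - 2 - s) / 2) ∧ -(((m : ℝ) + n - 2 - s) / 2) < 1 + s := by
  have h : (2 : ℝ) ≤ (m : ℝ) + n := by exact_mod_cast hN
  constructor <;> linarith

lemma integrableOn_weight_mul_kernel (hα : 0 < α) (hN : 2 ≤ m + n) (hs0 : 0 ≤ s)
    (p : Space m n) {ε : ℝ} (hε : 0 < ε) :
    IntegrableOn (fun x : Space m n => weight s x * kernel s p x) (Metric.ball p ε)ᶜ
      (surfaceMeasure m n α) :=
  integrableOn_kernel_mul_compl_ball hα hN hs0 (weight_exponent_bounds hN hs0).1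
    (weight_exponent_bounds hN hs0).2 p hε

lemma hardyIntegrand_eq (q : Space m n) :
    hardyIntegrand s q = fun x => (1 - weight s x) * kernel s q x := rfl

lemma hasPV_hardyIntegrand (hα : 0 < α) (hN : 2 ≤ m + n) (hs0 : 0 ≤ s) (hs1 : s < 1)
    {q : Space m n} (hq : q ∈ cone m n α) (hq1 : ‖q‖ = 1) :
    HasPV (surfaceMeasure m n α) q (hardyIntegrand s q) (hardyConstant s α q) ∧
    ∃ C : ℝ, ∀ ε : ℝ, 0 < ε →
      |∫ x in (Metric.ball q ε)ᶜ, hardyIntegrand s q x ∂(surfaceMeasure m n α)| ≤ C := by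
  obtain ⟨C, hC, h⟩ := exists_hasPV (s := s) hα hN hs0 hs1 hq hq1
  obtain ⟨M, hM, hT⟩ := exists_weight_taylor (s := s) hq1
  have h1 := h (fun x => 1 - weight s x) (-fderiv ℝ (weight s) q) M
    (measurable_weightFun.const_sub 1) (by rwa [norm_neg]) (fun x _ hx => by
      rw [← abs_neg]
      convert hT x hx using 2
      rw [neg_apply]; ring) ?_
  · exact ⟨hasPV_pv h1.1, _, h1.2⟩
  · have h2 := (integrableOn_kernel_compl_ball (s := s) hα hN hs0 q (by norm_num : (0 : ℝ) < 1 / 2)).sub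
      (integrableOn_weight_mul_kernel hα hN hs0 q (by norm_num))
    refine h2.congr_fun (fun x _ => ?_) Metric.isOpen_ball.measurableSet.compl
    simp only [Pi.sub_apply]; ring

/-- The truncated Hardy integrals at any point of the cone other than the vertex. -/
lemma hasPV_weight_ratio (hα : 0 < α) (hN : 2 ≤ m + n) (hs0 : 0 ≤ s) (hs1 : s < 1)
    {q : Space m n} (hq : q ∈ cone m n α) (hq1 : ‖q‖ = 1) :
    ∃ C : ℝ, 0 ≤ C ∧ ∀ p ∈ cone m n α, p ≠ 0 →
      HasPV (surfaceMeasure m n α) p (fun x => (1 - weight s x / weight s p) * kernel s p x)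
        (hardyConstant s α q / ‖p‖ ^ (1 + s)) ∧
      ∀ ε : ℝ, 0 < ε → |∫ x in (Metric.ball p ε)ᶜ, (1 - weight s x / weight s p) * kernel s p x
        ∂(surfaceMeasure m n α)| ≤ C / ‖p‖ ^ (1 + s) := by
  obtain ⟨h1, C, hC⟩ := hasPV_hardyIntegrand (s := s) hα hN hs0 hs1 hq hq1
  refine ⟨C, (abs_nonneg _).trans (hC 1 one_pos), fun p hp hp0 => ?_⟩
  obtain ⟨Q, hQ, hQp⟩ := exists_similarity hp hp0 hq hq1
  have hp' : 0 < ‖p‖ := norm_pos_iff.2 hp0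
  -- By homogeneity of w, the ratio w(x)/w(p) pulls back to w itself at the unit point q, so the
  -- integrand becomes the Hardy integrand up to a power of |p|.
  have hfg : ∀ x, (fun x => (1 - weight s x / weight s p) * kernel s p x) (similarity hp' Q x)
      = (‖p‖ ^ ((m : ℝ) + n + s))⁻¹ * hardyIntegrand s q x := by
    intro x
    simp only
    conv_lhs => rw [← congrArg (weight s) hQp, ← congrArg (fun v => kernel s v _) hQp]
    rw [weight_ratio_similarity hp' Q hq1, kernel_similarity, hardyIntegrand_eq]
    ring
  constructor
  · have h2 := HasPV.similarity (s := s) hN hp' hQ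
      (f := fun x => (1 - weight s x / weight s p) * kernel s p x) hfg h1
    rwa [hQp, inv_mul_eq_div] at h2
  · intro ε hε
    have h3 := integral_compl_ball_similarity (α := α) (s := s) hN hp' hQ
      (f := fun x => (1 - weight s x / weight s p) * kernel s p x) hfg q ε
    rw [hQp] at h3
    rw [h3, abs_mul, abs_of_nonneg (by positivity), inv_mul_eq_div]
    gcongr
    exact hC _ (by positivity)

lemma hardyConstant_eq (hα : 0 < α) (hN : 2 ≤ m + n) (hs0 : 0 ≤ s) (hs1 : s < 1)
    {p q : Space m n} (hp : p ∈ cone m n α) (hp1 : ‖p‖ = 1) (hq : q ∈ cone m n α)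
    (hq1 : ‖q‖ = 1) : hardyConstant s α p = hardyConstant s α q := by
  have hp0 : p ≠ 0 := by rintro rfl; simp at hp1
  obtain ⟨C, -, h⟩ := hasPV_weight_ratio (s := s) hα hN hs0 hs1 hq hq1
  have h1 := (h p hp hp0).1
  rw [weight_eq_one hp1, hp1, Real.one_rpow, div_one] at h1
  simp only [div_one] at h1
  exact h1.pv_eq

/-! ### Test functions -/

lemma exists_bounds_of_isTestFunction {h : Space m n → ℝ} (hh : IsTestFunction h) :
    ∃ K : ℝ, 0 ≤ K ∧ (∀ x, |h x| ≤ K) ∧ (∀ x, ‖fderiv ℝ h x‖ ≤ K) ∧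
      ∀ p x, |h x - h p - fderiv ℝ h p (x - p)| ≤ K * ‖x - p‖ ^ 2 := by
  obtain ⟨hsm, hcs, -⟩ := hh
  obtain ⟨K₀, hK₀⟩ := hcs.exists_bound_of_continuous hsm.continuous
  have hcs' := hcs.fderiv (𝕜 := ℝ)
  have hsm' : ContDiff ℝ 1 (fderiv ℝ h) := hsm.fderiv_right (by norm_cast)
  obtain ⟨K₁, hK₁⟩ := hcs'.exists_bound_of_continuous hsm'.continuous
  obtain ⟨K₂, hK₂⟩ := ContDiff.lipschitzWith_of_hasCompactSupport hcs' hsm' (by norm_num)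
  have hK₀' : 0 ≤ K₀ := (norm_nonneg _).trans (hK₀ 0)
  have hK₁' : 0 ≤ K₁ := (norm_nonneg _).trans (hK₁ 0)
  have hK₂' : 0 ≤ (K₂ : ℝ) := K₂.2
  refine ⟨K₀ + K₁ + K₂, by positivity, fun x => (hK₀ x).trans (by linarith),
    fun x => (hK₁ x).trans (by linarith), fun p x => ?_⟩
  have h1 := abs_sub_fderiv_le (f := h) (p := p) (ρ := ‖x - p‖) (K := K₂) (x := x)
    (fun z _ => (hsm.differentiable (by simp)).differentiableAt) (fun z _ => by
      have := hK₂.dist_le_mul z p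
      rwa [dist_eq_norm, dist_eq_norm] at this) hK₂' le_rfl
  refine h1.trans ?_
  gcongr
  linarith

/-- Principal values of test functions, with a bound that is uniform on compact sets. -/
lemma hasPV_testFunction (hα : 0 < α) (hN : 2 ≤ m + n) (hs0 : 0 ≤ s) (hs1 : s < 1)
    {q : Space m n} (hq : q ∈ cone m n α) (hq1 : ‖q‖ = 1) {h : Space m n → ℝ}
    (hh : IsTestFunction h) :
    (∀ p ∈ cone m n α, p ≠ 0 → HasPV (surfaceMeasure m n α) p (fun x => (h x - h p) * kernel s p x)
        (pv (surfaceMeasure m n α) p (fun x => (h x - h p) * kernel s p x))) ∧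
    ∀ a b : ℝ, 0 < a → ∃ C : ℝ, ∀ p ∈ cone m n α, a ≤ ‖p‖ → ‖p‖ ≤ b → ∀ ε : ℝ, 0 < ε →
      |∫ x in (Metric.ball p ε)ᶜ, (h x - h p) * kernel s p x ∂(surfaceMeasure m n α)| ≤ C := by
  obtain ⟨C, hC, hPV⟩ := exists_hasPV (s := s) hα hN hs0 hs1 hq hq1
  obtain ⟨K, hK, hK0, hK1, hK2⟩ := exists_bounds_of_isTestFunction hh
  have hkint := integrableOn_kernel_compl_ball (s := s) hα hN hs0 q (by norm_num : (0 : ℝ) < 1 / 2)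
  set I : ℝ := ∫ x in (Metric.ball q (1 / 2))ᶜ, kernel s q x ∂(surfaceMeasure m n α) with hI
  have key : ∀ p ∈ cone m n α, p ≠ 0 →
      (∃ L, HasPV (surfaceMeasure m n α) p (fun x => (h x - h p) * kernel s p x) L) ∧
      ∀ ε : ℝ, 0 < ε →
        |∫ x in (Metric.ball p ε)ᶜ, (h x - h p) * kernel s p x ∂(surfaceMeasure m n α)|
        ≤ (‖p‖ ^ (1 + s))⁻¹ * (C * (K * (‖p‖ + ‖p‖ ^ 2)) + 2 * K * I) := by
    intro p hp hp0
    obtain ⟨Q, hQ, hQp⟩ := exists_similarity hp hp0 hq hq1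
    have hp' : 0 < ‖p‖ := norm_pos_iff.2 hp0
    set u : Space m n → ℝ := fun x => h (similarity hp' Q x) - h p with hu
    have hum : Measurable u :=
      (hh.1.continuous.comp (similarity hp' Q).continuous).measurable.sub_const _
    have hub : ∀ x, |u x| ≤ 2 * K := fun x => by
      have := abs_sub (h (similarity hp' Q x)) (h p)
      linarith [hK0 (similarity hp' Q x), hK0 p]
    set L : Space m n →L[ℝ] ℝ :=
      (fderiv ℝ h p).comp (‖p‖ • (Q : Space m n ≃L[ℝ] Space m n).toContinuousLinearMap) with hL
    have hLv : ∀ v, L v = fderiv ℝ h p (‖p‖ • Q v) := fun v => rfl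
    -- Rescaling to q gives |p| in the linear part and |p|² in the quadratic remainder;
    -- `exists_hasPV` wants one constant above both.
    have hLn : ‖L‖ ≤ K * (‖p‖ + ‖p‖ ^ 2) := by
      refine ContinuousLinearMap.opNorm_le_bound _ (by positivity) fun v => ?_
      rw [hLv]
      refine ((fderiv ℝ h p).le_opNorm _).trans ?_
      rw [norm_smul, Q.norm_map, norm_norm]
      have := hK1 p
      calc ‖fderiv ℝ h p‖ * (‖p‖ * ‖v‖) ≤ K * (‖p‖ * ‖v‖) := by gcongr
        _ ≤ K * ((‖p‖ + ‖p‖ ^ 2) * ‖v‖) := by gcongr; nlinarith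
        _ = _ := by ring
    have hint : IntegrableOn (fun x => u x * kernel s q x) (Metric.ball q (1 / 2))ᶜ
        (surfaceMeasure m n α) := by
      refine (hkint.const_mul (2 * K)).mono' (hum.mul (measurable_kernel_left q)).aestronglyMeasurable
        (ae_of_all _ fun x => ?_)
      rw [Real.norm_eq_abs, abs_mul, abs_of_nonneg (kernel_nonneg _ _)]
      exact mul_le_mul_of_nonneg_right (hub x) (kernel_nonneg _ _)
    obtain ⟨h1, h2⟩ := hPV u L (K * (‖p‖ + ‖p‖ ^ 2)) hum hLn (fun x _ _ => by
      have h3 := hK2 p (similarity hp' Q x)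
      have h4 : similarity hp' Q x - p = ‖p‖ • Q (x - q) := by
        have h5 : ‖p‖ • Q q = p := hQp
        rw [similarity_apply, map_sub, smul_sub, h5]
      rw [hLv, ← h4]
      refine h3.trans ?_
      rw [h4, norm_smul, Q.norm_map, norm_norm, mul_pow, ← mul_assoc]
      gcongr
      linarith) hint
    have hfg : ∀ x, (fun x => (h x - h p) * kernel s p x) (similarity hp' Q x)
        = (‖p‖ ^ ((m : ℝ) + n + s))⁻¹ * (u x * kernel s q x) := by
      intro x
      simp only [hu]
      conv_lhs => rw [← congrArg (fun v => kernel s v _) hQp]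
      rw [kernel_similarity]
      ring
    constructor
    · obtain ⟨L₁, hL₁⟩ := h1
      have h5 := HasPV.similarity (s := s) hN hp' hQ
        (f := fun x => (h x - h p) * kernel s p x) hfg hL₁
      rw [hQp] at h5
      exact ⟨_, h5⟩
    · intro ε hε
      have h6 := integral_compl_ball_similarity (α := α) (s := s) hN hp' hQ
        (f := fun x => (h x - h p) * kernel s p x) (g := fun x => u x * kernel s q x) hfg q ε
      rw [hQp] at h6
      rw [h6, abs_mul, abs_of_nonneg (by positivity)]
      gcongr
      refine (h2 _ (by positivity)).trans ?_
      gcongr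
      rw [hI, ← integral_const_mul]
      refine setIntegral_mono hint.abs (hkint.const_mul _) fun x => ?_
      simp only
      rw [abs_mul, abs_of_nonneg (kernel_nonneg _ _)]
      exact mul_le_mul_of_nonneg_right (hub x) (kernel_nonneg _ _)
  refine ⟨fun p hp hp0 => hasPV_pv (key p hp hp0).1, fun a b ha => ?_⟩
  refine ⟨(a ^ (1 + s))⁻¹ * (C * (K * (b + b ^ 2)) + 2 * K * I), fun p hp hpa hpb ε hε => ?_⟩
  have hp0 : p ≠ 0 := norm_pos_iff.1 (ha.trans_le hpa)
  refine ((key p hp hp0).2 ε hε).trans ?_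
  have hI0 : 0 ≤ I := integral_nonneg fun x => kernel_nonneg _ _
  gcongr

/-! ### Truncated double integrals -/

open Classical in
/-- The kernel, truncated to `|x - p| ≥ ε`. -/
def truncKernel (s ε : ℝ) (p x : Space m n) : ℝ := if ε ≤ ‖x - p‖ then kernel s p x else 0

lemma truncKernel_nonneg (ε : ℝ) (p x : Space m n) : 0 ≤ truncKernel s ε p x := by
  unfold truncKernel; split_ifs
  · exact kernel_nonneg _ _
  · exact le_rfl

lemma truncKernel_le (ε : ℝ) (p x : Space m n) : truncKernel s ε p x ≤ kernel s p x := by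
  unfold truncKernel; split_ifs
  · exact le_rfl
  · exact kernel_nonneg _ _

lemma truncKernel_comm (ε : ℝ) (p x : Space m n) : truncKernel s ε p x = truncKernel s ε x p := by
  rw [truncKernel, truncKernel, kernel_comm, norm_sub_rev]

lemma measurable_truncKernel (ε : ℝ) :
    Measurable fun z : Space m n × Space m n => truncKernel s ε z.1 z.2 := by
  unfold truncKernel
  exact Measurable.ite (measurableSet_le measurable_const (measurable_snd.sub measurable_fst).norm)
    measurable_kernel measurable_const

lemma mul_truncKernel_eq_indicator (ε : ℝ) (p : Space m n) (f : Space m n → ℝ) :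
    (fun x => f x * truncKernel s ε p x)
      = (Metric.ball p ε)ᶜ.indicator fun x => f x * kernel s p x := by
  ext x
  by_cases h : ε ≤ ‖x - p‖
  · rw [Set.indicator_of_mem (by rwa [Set.mem_compl_iff, mem_ball_iff_norm, not_lt]), truncKernel,
      if_pos h]
  · rw [Set.indicator_of_notMem (by rwa [Set.mem_compl_iff, not_not, mem_ball_iff_norm, ← not_le]),
      truncKernel, if_neg h, mul_zero]

lemma setIntegral_compl_ball_eq (ε : ℝ) (p : Space m n) (f : Space m n → ℝ) :
    ∫ x in (Metric.ball p ε)ᶜ, f x * kernel s p x ∂(surfaceMeasure m n α)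
      = ∫ x, f x * truncKernel s ε p x ∂(surfaceMeasure m n α) := by
  rw [mul_truncKernel_eq_indicator, integral_indicator Metric.isOpen_ball.measurableSet.compl]

lemma HasPV.integrable_truncKernel {f : Space m n → ℝ} {p : Space m n} {L : ℝ}
    (h : HasPV (surfaceMeasure m n α) p (fun x => f x * kernel s p x) L) {ε : ℝ} (hε : 0 < ε) :
    Integrable (fun x => f x * truncKernel s ε p x) (surfaceMeasure m n α) := by
  rw [mul_truncKernel_eq_indicator, integrable_indicator_iff Metric.isOpen_ball.measurableSet.compl]
  exact h.1 ε hε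

lemma integrable_of_bounded_annulus (hα : 0 < α) {f : Space m n → ℝ} {a b B : ℝ} (ha : 0 < a)
    (hf : AEStronglyMeasurable f (surfaceMeasure m n α))
    (hB : ∀ᵐ p ∂(surfaceMeasure m n α), ‖f p‖ ≤ {p : Space m n | a ≤ ‖p‖ ∧ ‖p‖ ≤ b}.indicator
      (fun _ => B) p) :
    Integrable f (surfaceMeasure m n α) := by
  refine Integrable.mono' ?_ hf hB
  rw [integrable_indicator_iff (isCompact_annulus a b).measurableSet]
  exact integrableOn_const (surfaceMeasure_annulus_lt_top hα ha b).ne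

/-- Dominated convergence in p: the truncated inner integrals are bounded uniformly in ε on the
annulus containing the support of φ, and that annulus has finite measure. It is used with v(p,x) =
h(x) - h(p) and with v(p,x) = 1 - w(x)/w(p). -/
theorem integrable_mul_pv_and_tendsto (hα : 0 < α) (hN : 2 ≤ m + n) {φ : Space m n → ℝ}
    {v : Space m n × Space m n → ℝ} {L : Space m n → ℝ} {a b B C : ℝ} (ha : 0 < a)
    (hφm : Measurable φ) (hφB : ∀ p, |φ p| ≤ B) (hφ0 : ∀ p, φ p ≠ 0 → a ≤ ‖p‖ ∧ ‖p‖ ≤ b)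
    (hv : Measurable v)
    (hL : ∀ p ∈ cone m n α, p ≠ 0 →
      HasPV (surfaceMeasure m n α) p (fun x => v (p, x) * kernel s p x) (L p))
    (hC : ∀ p ∈ cone m n α, a ≤ ‖p‖ → ‖p‖ ≤ b → ∀ ε : ℝ, 0 < ε →
      |∫ x in (Metric.ball p ε)ᶜ, v (p, x) * kernel s p x ∂(surfaceMeasure m n α)| ≤ C) :
    Integrable (fun p => φ p * L p) (surfaceMeasure m n α) ∧
    (∀ ε : ℝ, 0 < ε → Integrable (fun p => φ p *
      ∫ x, v (p, x) * truncKernel s ε p x ∂(surfaceMeasure m n α)) (surfaceMeasure m n α)) ∧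
    Tendsto (fun ε : ℝ => ∫ p, φ p *
      ∫ x, v (p, x) * truncKernel s ε p x ∂(surfaceMeasure m n α) ∂(surfaceMeasure m n α))
      (𝓝[>] 0) (𝓝 (∫ p, φ p * L p ∂(surfaceMeasure m n α))) := by
  have := sigmaFinite_surfaceMeasure (m := m) (n := n) hα hN
  set σ := surfaceMeasure m n α with hσ
  set S : Set (Space m n) := {p : Space m n | a ≤ ‖p‖ ∧ ‖p‖ ≤ b} with hS
  have hSm : MeasurableSet S := (isCompact_annulus a b).measurableSet
  set F : ℝ → Space m n → ℝ := fun ε p => φ p * ∫ x, v (p, x) * truncKernel s ε p x ∂σ with hF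
  have hFm : ∀ ε, AEStronglyMeasurable (F ε) σ := by
    intro ε
    have h1 : StronglyMeasurable fun z : Space m n × Space m n =>
        v z * truncKernel s ε z.1 z.2 := (hv.mul (measurable_truncKernel ε)).stronglyMeasurable
    have h2 : StronglyMeasurable fun p => ∫ x, v (p, x) * truncKernel s ε p x ∂σ :=
      h1.integral_prod_right
    exact (hφm.stronglyMeasurable.mul h2).aestronglyMeasurable
  have hFb : ∀ ε, 0 < ε → ∀ᵐ p ∂σ, ‖F ε p‖ ≤ S.indicator (fun _ => B * C) p := by
    intro ε hε
    filter_upwards [ae_mem_cone] with p hp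
    by_cases h0 : φ p = 0
    · simp only [hF, h0, zero_mul, norm_zero]
      by_cases hpS : p ∈ S
      · rw [Set.indicator_of_mem hpS]
        exact mul_nonneg ((abs_nonneg _).trans (hφB p))
          ((abs_nonneg _).trans (hC p hp hpS.1 hpS.2 ε hε))
      · rw [Set.indicator_of_notMem hpS]
    · have hpS := hφ0 p h0
      rw [Set.indicator_of_mem (show p ∈ S from hpS), Real.norm_eq_abs]
      simp only [hF]
      rw [abs_mul, ← setIntegral_compl_ball_eq ε p (fun x => v (p, x))]
      exact mul_le_mul (hφB p) (hC p hp hpS.1 hpS.2 ε hε) (abs_nonneg _)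
        ((abs_nonneg _).trans (hφB p))
  have hlim : ∀ᵐ p ∂σ, Tendsto (fun ε => F ε p) (𝓝[>] 0) (𝓝 (φ p * L p)) := by
    filter_upwards [ae_mem_cone, ae_ne_zero hN] with p hp hp0
    have h1 := (hL p hp hp0).2
    refine (h1.const_mul (φ p)).congr fun ε => ?_
    simp only [hF]
    rw [← setIntegral_compl_ball_eq ε p (fun x => v (p, x))]
  have hbound : Integrable (S.indicator fun _ => B * C) σ := by
    rw [integrable_indicator_iff hSm]
    exact integrableOn_const (surfaceMeasure_annulus_lt_top hα ha b).ne
  -- L is known only pointwise, as a limit; its measurability is inherited from the truncated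
  -- integrals.
  have hLm : AEStronglyMeasurable (fun p => φ p * L p) σ :=
    aestronglyMeasurable_of_tendsto_ae (𝓝[>] (0 : ℝ)) hFm hlim
  refine ⟨?_, fun ε hε => hbound.mono' (hFm ε) (hFb ε hε), ?_⟩
  · refine hbound.mono' hLm ?_
    -- Countably many radii suffice for the limit and allow a single null set for all the bounds.
    have h2 : ∀ᵐ p ∂σ, ∀ k : ℕ, ‖F (1 / ((k : ℝ) + 1)) p‖ ≤ S.indicator (fun _ => B * C) p :=
      ae_all_iff.2 fun k => hFb _ (by positivity)
    filter_upwards [hlim, h2] with p hp hpb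
    have h3 : Tendsto (fun k : ℕ => 1 / ((k : ℝ) + 1)) atTop (𝓝[>] 0) :=
      tendsto_nhdsWithin_iff.2 ⟨tendsto_one_div_add_atTop_nhds_zero_nat,
        Eventually.of_forall fun k => by
          have : (0 : ℝ) < 1 / ((k : ℝ) + 1) := by positivity
          exact this⟩
    exact le_of_tendsto (hp.comp h3).norm (Eventually.of_forall hpb)
  · refine tendsto_integral_filter_of_dominated_convergence _
      (Eventually.of_forall hFm) ?_ hbound hlim
    filter_upwards [self_mem_nhdsWithin] with ε hε
    exact hFb ε hε

/-! ### The ground state representation -/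

lemma exists_annulus_of_isTestFunction {h : Space m n → ℝ} (hh : IsTestFunction h) :
    ∃ a b : ℝ, 0 < a ∧ ∀ p, h p ≠ 0 → a ≤ ‖p‖ ∧ ‖p‖ ≤ b := by
  obtain ⟨-, hcs, h0⟩ := hh
  have h1 : (tsupport h)ᶜ ∈ 𝓝 (0 : Space m n) := (isClosed_tsupport h).isOpen_compl.mem_nhds h0
  obtain ⟨a, ha, hsub⟩ := Metric.mem_nhds_iff.1 h1
  obtain ⟨b, hb⟩ := hcs.isCompact.isBounded.exists_norm_le
  refine ⟨a, b, ha, fun p hp => ⟨?_, hb p (subset_tsupport h hp)⟩⟩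
  by_contra hlt
  exact hsub (mem_ball_zero_iff.2 (not_le.1 hlt)) (subset_tsupport h hp)

/-- The integrand `w(p) w(x) (h(p)/w(p) - h(x)/w(x))² K`, with the kernel truncated at `ε`. -/
def groundStateIntegrand (s ε : ℝ) (h : Space m n → ℝ) (z : Space m n × Space m n) : ℝ :=
  (h z.1 ^ 2 / weight s z.1 * weight s z.2 + h z.2 ^ 2 / weight s z.2 * weight s z.1
    - 2 * (h z.1 * h z.2)) * truncKernel s ε z.1 z.2

lemma two_mul_abs_le {a b u v : ℝ} (hu : 0 < u) (hv : 0 < v) :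
    2 * |a * b| ≤ a ^ 2 / u * v + b ^ 2 / v * u := by
  have h1 : a ^ 2 / u * v + b ^ 2 / v * u - 2 * |a * b| = (|a| * v - |b| * u) ^ 2 / (u * v) := by
    rw [abs_mul]; field_simp; rw [← sq_abs a, ← sq_abs b]; ring
  have h2 : 0 ≤ (|a| * v - |b| * u) ^ 2 / (u * v) := by positivity
  linarith

/-- Away from the vertex this is a completed square; at the vertex, where w may vanish by
convention, h = 0 saves the inequality. -/
lemma two_mul_abs_mul_le {h : Space m n → ℝ} (h0 : h 0 = 0) (p x : Space m n) :
    2 * |h p * h x| ≤ h p ^ 2 / weight s p * weight s x + h x ^ 2 / weight s x * weight s p := by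
  have e1 := weight_nonneg (s := s) p
  have e2 := weight_nonneg (s := s) x
  by_cases hp : p = 0
  · rw [hp, h0]; simp; rw [hp] at e1; positivity
  by_cases hx : x = 0
  · rw [hx, h0]; simp; rw [hx] at e2; positivity
  exact two_mul_abs_le (weight_pos hp) (weight_pos hx)

lemma groundStateIntegrand_nonneg {h : Space m n → ℝ} (h0 : h 0 = 0) (ε : ℝ)
    (z : Space m n × Space m n) : 0 ≤ groundStateIntegrand s ε h z := by
  refine mul_nonneg ?_ (truncKernel_nonneg _ _ _)
  have := two_mul_abs_mul_le (s := s) h0 z.1 z.2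
  linarith [le_abs_self (h z.1 * h z.2)]

lemma exists_weight_lower_bound (s : ℝ) {a b : ℝ} (ha : 0 < a) :
    ∃ c > 0, ∀ p : Space m n, a ≤ ‖p‖ → ‖p‖ ≤ b → c ≤ weight s p := by
  by_cases hab : a ≤ b
  · set γ := -(((m : ℝ) + (n : ℝ) - 2 - s) / 2) with hγ
    refine ⟨min (a ^ γ) (b ^ γ), lt_min (by positivity)
      (Real.rpow_pos_of_pos (ha.trans_le hab) _), fun p hpa hpb => ?_⟩
    rw [weight, ← hγ]
    rcases le_total 0 γ with hg | hg
    · exact (min_le_left _ _).trans (Real.rpow_le_rpow ha.le hpa hg)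
    · exact (min_le_right _ _).trans
        (Real.rpow_le_rpow_of_nonpos (ha.trans_le hpa) hpb hg)
  · exact ⟨1, one_pos, fun p hpa hpb => absurd (hpa.trans hpb) hab⟩

/-- The truncated kernel is bounded uniformly for p in the support of h, so the integrand is
dominated by a product of an integrable function of p and one of x. -/
lemma integrable_sq_div_weight_mul (hα : 0 < α) (hN : 2 ≤ m + n) (hs0 : 0 ≤ s)
    {h : Space m n → ℝ} (hh : IsTestFunction h) {ε : ℝ} (hε : 0 < ε) :
    Integrable (fun z : Space m n × Space m n =>
      h z.1 ^ 2 / weight s z.1 * weight s z.2 * truncKernel s ε z.1 z.2)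
      ((surfaceMeasure m n α).prod (surfaceMeasure m n α)) := by
  have := sigmaFinite_surfaceMeasure (m := m) (n := n) hα hN
  obtain ⟨K, hK, hK0, -, -⟩ := exists_bounds_of_isTestFunction hh
  obtain ⟨a, b, ha, hab⟩ := exists_annulus_of_isTestFunction hh
  obtain ⟨c, hc, hcw⟩ := exists_weight_lower_bound (m := m) (n := n) s (b := b) ha
  have hhm : Measurable h := hh.1.continuous.measurable
  have hwm := measurable_weightFun (m := m) (n := n) (s := s)
  have h1 : Integrable (fun p => h p ^ 2 / weight s p) (surfaceMeasure m n α) := by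
    refine integrable_of_bounded_annulus (a := a) (b := b) (B := K ^ 2 / c) hα ha
      ((hhm.pow_const 2).div hwm).aestronglyMeasurable (ae_of_all _ fun p => ?_)
    by_cases hp : h p = 0
    · rw [hp]
      simp only [ne_eq, OfNat.ofNat_ne_zero, not_false_eq_true, zero_pow, zero_div, norm_zero]
      exact Set.indicator_nonneg (fun _ _ => by positivity) _
    · obtain ⟨hp1, hp2⟩ := hab p hp
      rw [Set.indicator_of_mem (show p ∈ {p : Space m n | a ≤ ‖p‖ ∧ ‖p‖ ≤ b} from ⟨hp1, hp2⟩),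
        Real.norm_of_nonneg (div_nonneg (sq_nonneg _) (weight_nonneg p)), ← sq_abs]
      have := hcw p hp1 hp2
      have := hK0 p
      gcongr
  -- `max b 0` is used because `kernel_le` requires a nonnegative bound and the sign of b is not
  -- known.
  have h2 : Integrable (fun x : Space m n => weight s x *
      (((1 + max b 0) / ε + 1) ^ ((m : ℝ) + n + s) * (1 + ‖x‖) ^ (-((m : ℝ) + n + s))))
      (surfaceMeasure m n α) := by
    refine ((integrable_rpow_mul_decay hα hN hs0 (weight_exponent_bounds hN hs0).1
      (weight_exponent_bounds hN hs0).2).const_mul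
      (((1 + max b 0) / ε + 1) ^ ((m : ℝ) + n + s))).congr (ae_of_all _ fun x => ?_)
    simp only [weight]; ring
  refine (h1.mul_prod h2).mono' (((((hhm.comp measurable_fst).pow_const 2).div
    (hwm.comp measurable_fst)).mul (hwm.comp measurable_snd)).mul
    (measurable_truncKernel ε)).aestronglyMeasurable (ae_of_all _ fun z => ?_)
  have e1 : 0 ≤ h z.1 ^ 2 / weight s z.1 := div_nonneg (sq_nonneg _) (weight_nonneg _)
  have e2 := weight_nonneg (s := s) z.2
  rw [Real.norm_of_nonneg (mul_nonneg (mul_nonneg e1 e2) (truncKernel_nonneg _ _ _)), mul_assoc]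
  by_cases hp : h z.1 = 0
  · rw [hp]; simp
  · refine mul_le_mul_of_nonneg_left (mul_le_mul_of_nonneg_left ?_ e2) e1
    unfold truncKernel
    split_ifs with hz
    · exact kernel_le hs0 hε (le_max_right _ _) ((hab _ hp).2.trans (le_max_left _ _)) hz
    · positivity

/-- The symmetrized form of the truncated quadratic form. -/
lemma integral_groundStateIntegrand (hα : 0 < α) (hN : 2 ≤ m + n) (hs0 : 0 ≤ s)
    {h : Space m n → ℝ} (hh : IsTestFunction h) {ε : ℝ} (hε : 0 < ε) :
    Integrable (groundStateIntegrand s ε h)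
      ((surfaceMeasure m n α).prod (surfaceMeasure m n α)) ∧
    1 / 2 * ∫ z, groundStateIntegrand s ε h z ∂((surfaceMeasure m n α).prod (surfaceMeasure m n α))
      = ∫ p, ∫ x, (h p ^ 2 / weight s p * weight s x - h p * h x) * truncKernel s ε p x
          ∂(surfaceMeasure m n α) ∂(surfaceMeasure m n α) := by
  have := sigmaFinite_surfaceMeasure (m := m) (n := n) hα hN
  set σ := surfaceMeasure m n α with hσ
  have h0 : h 0 = 0 := image_eq_zero_of_notMem_tsupport hh.2.2
  have hG := integrable_sq_div_weight_mul (s := s) hα hN hs0 hh hε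
  rw [← hσ] at hG
  set G : Space m n × Space m n → ℝ := fun z =>
      h z.1 ^ 2 / weight s z.1 * weight s z.2 * truncKernel s ε z.1 z.2 with hGdef
  have hG' : Integrable (fun z => G z.swap) (σ.prod σ) := hG.swap
  have hhm : Measurable h := hh.1.continuous.measurable
  set P : Space m n × Space m n → ℝ := fun z => h z.1 * h z.2 * truncKernel s ε z.1 z.2 with hPdef
  -- The cross term is dominated by G plus its transpose through the inequality of
  -- `two_mul_abs_mul_le`.
  have hP : Integrable P (σ.prod σ) := by
    refine (hG.add hG').mono' (((hhm.comp measurable_fst).mul (hhm.comp measurable_snd)).mul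
      (measurable_truncKernel ε)).aestronglyMeasurable (ae_of_all _ fun z => ?_)
    have h1 := two_mul_abs_mul_le (s := s) h0 z.1 z.2
    have h2 := truncKernel_nonneg (s := s) ε z.1 z.2
    simp only [hPdef, hGdef, Pi.add_apply, Prod.fst_swap, Prod.snd_swap]
    rw [Real.norm_eq_abs, abs_mul, abs_of_nonneg h2, truncKernel_comm ε z.2 z.1, ← add_mul]
    refine mul_le_mul_of_nonneg_right ?_ h2
    linarith [abs_nonneg (h z.1 * h z.2)]
  have hEq : groundStateIntegrand s ε h = fun z => (G z - P z) + (G z.swap - P z) := by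
    ext z
    simp only [groundStateIntegrand, hGdef, hPdef, Prod.fst_swap, Prod.snd_swap,
      truncKernel_comm ε z.2 z.1]
    ring
  have hP' : ∀ z, P z.swap = P z := by
    intro z
    simp only [hPdef, Prod.fst_swap, Prod.snd_swap, truncKernel_comm ε z.2 z.1]
    ring
  refine ⟨by rw [hEq]; exact (hG.sub hP).add (hG'.sub hP), ?_⟩
  have hsw : ∫ z, G z.swap - P z ∂(σ.prod σ) = ∫ z, G z - P z ∂(σ.prod σ) := by
    rw [← integral_prod_swap (fun z => G z - P z)]
    simp only [hP']
  rw [hEq, integral_add (f := fun z => G z - P z) (g := fun z => G z.swap - P z) (hG.sub hP) (hG'.sub hP), hsw,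
    integral_prod (fun z => G z - P z) (hG.sub hP)]
  rw [← two_mul, ← mul_assoc]
  norm_num
  refine integral_congr_ae (ae_of_all _ fun p => integral_congr_ae (ae_of_all _ fun x => ?_))
  simp only [hGdef, hPdef]
  ring

/-- The ground state representation. Every singular term is truncated at the same ε, where the
identity is algebra plus the symmetry of the double integral, and the principal values on the other
side converge by `integrable_mul_pv_and_tendsto`. Only the limit is claimed, so the untruncated
double integral never appears. -/
theorem tendsto_groundState (hα : 0 < α) (hN : 2 ≤ m + n) (hs0 : 0 ≤ s) (hs1 : s < 1)
    {q : Space m n} (hq : q ∈ cone m n α) (hq1 : ‖q‖ = 1) {h : Space m n → ℝ}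
    (hh : IsTestFunction h) :
    Integrable (fun p => jacobi s α h p * h p) (surfaceMeasure m n α) ∧
    Integrable (fun p => h p ^ 2 / ‖p‖ ^ (1 + s)) (surfaceMeasure m n α) ∧
    Tendsto (fun ε : ℝ => 1 / 2 * ∫ z, groundStateIntegrand s ε h z
        ∂((surfaceMeasure m n α).prod (surfaceMeasure m n α))) (𝓝[>] 0)
      (𝓝 (-(∫ p, jacobi s α h p * h p ∂(surfaceMeasure m n α))
        - (hardyConstant s α q - potential s α q)
          * ∫ p, h p ^ 2 / ‖p‖ ^ (1 + s) ∂(surfaceMeasure m n α))) := by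
  obtain ⟨K, hK, hK0, -, -⟩ := exists_bounds_of_isTestFunction hh
  obtain ⟨a, b, ha, hab⟩ := exists_annulus_of_isTestFunction hh
  obtain ⟨hPV, hPVb⟩ := hasPV_testFunction (s := s) hα hN hs0 hs1 hq hq1 hh
  obtain ⟨C₁, hC₁⟩ := hPVb a b ha
  obtain ⟨C₂, hC₂0, hW⟩ := hasPV_weight_ratio (s := s) hα hN hs0 hs1 hq hq1
  set σ := surfaceMeasure m n α with hσ
  set H := hardyConstant s α q with hH
  set A := potential s α q with hA
  have hhm : Measurable h := hh.1.continuous.measurable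
  have hwm := measurable_weightFun (m := m) (n := n) (s := s)
  have h1 := integrable_mul_pv_and_tendsto (s := s) (φ := h)
    (v := fun z => h z.2 - h z.1) hα hN ha hhm hK0 hab
    ((hhm.comp measurable_snd).sub (hhm.comp measurable_fst)) hPV hC₁
  have h2 := integrable_mul_pv_and_tendsto (s := s) (φ := fun p => h p ^ 2)
    (v := fun z => 1 - weight s z.2 / weight s z.1) (L := fun p => H / ‖p‖ ^ (1 + s))
    (a := a) (b := b) (B := K ^ 2) (C := C₂ / a ^ (1 + s))
    hα hN ha (hhm.pow_const 2) (fun p => by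
      rw [abs_pow]
      have := hK0 p
      gcongr)
    (fun p hp => hab p (fun h => hp (by rw [h]; norm_num)))
    (((hwm.comp measurable_snd).div (hwm.comp measurable_fst)).const_sub 1)
    (fun p hp hp0 => (hW p hp hp0).1) (fun p hp hpa _ ε hε =>
      ((hW p hp (norm_pos_iff.1 (ha.trans_le hpa))).2 ε hε).trans (by gcongr))
  rw [← hσ] at h1 h2
  have h3 : Integrable (fun p => h p ^ 2 / ‖p‖ ^ (1 + s)) σ := by
    refine integrable_of_bounded_annulus (a := a) (b := b) (B := K ^ 2 / a ^ (1 + s)) hα ha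
      ((hhm.pow_const 2).div (measurable_norm.pow_const _)).aestronglyMeasurable
      (ae_of_all _ fun p => ?_)
    by_cases hp : h p = 0
    · rw [hp]
      simp only [ne_eq, OfNat.ofNat_ne_zero, not_false_eq_true, zero_pow, zero_div, norm_zero]
      exact Set.indicator_nonneg (fun _ _ => by positivity) _
    · obtain ⟨hp1, hp2⟩ := hab p hp
      rw [Set.indicator_of_mem (show p ∈ {p : Space m n | a ≤ ‖p‖ ∧ ‖p‖ ≤ b} from ⟨hp1, hp2⟩),
        Real.norm_of_nonneg (by positivity), ← sq_abs]
      have := hK0 p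
      gcongr
  set V : Space m n → ℝ := fun p => pv σ p (fun x => (h x - h p) * kernel s p x) with hV
  have hJ : (fun p => jacobi s α h p * h p)
      =ᵐ[σ] fun p => h p * V p + A * (h p ^ 2 / ‖p‖ ^ (1 + s)) := by
    filter_upwards [ae_mem_cone, ae_ne_zero hN] with p hp hp0
    rw [jacobi, (integrable_potentialIntegrand_and_potential_eq hα hN hs0 hs1 hq hq1 hp hp0).2]
    simp only [hV]
    ring
  have hJi : Integrable (fun p => h p * V p + A * (h p ^ 2 / ‖p‖ ^ (1 + s))) σ :=
    h1.1.add (h3.const_mul A)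
  refine ⟨hJi.congr hJ.symm, h3, ?_⟩
  have hval : -(∫ p, jacobi s α h p * h p ∂σ) - (H - A) * ∫ p, h p ^ 2 / ‖p‖ ^ (1 + s) ∂σ
      = -(∫ p, h p * V p ∂σ) - ∫ p, h p ^ 2 * (H / ‖p‖ ^ (1 + s)) ∂σ := by
    have e1 : ∫ p, h p ^ 2 * (H / ‖p‖ ^ (1 + s)) ∂σ
        = H * ∫ p, h p ^ 2 / ‖p‖ ^ (1 + s) ∂σ := by
      rw [← integral_const_mul]
      exact integral_congr_ae (ae_of_all _ fun p => by simp only; ring)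
    rw [integral_congr_ae hJ, integral_add h1.1 (h3.const_mul A), integral_const_mul, e1]
    ring
  rw [hval]
  refine ((h1.2.2.neg).sub h2.2.2).congr' ?_
  filter_upwards [self_mem_nhdsWithin] with ε hε
  have hε : 0 < ε := hε
  have j1 : Integrable (fun p => -(h p * ∫ x, (h x - h p) * truncKernel s ε p x ∂σ)) σ :=
    (h1.2.1 ε hε).neg
  have j2 : Integrable (fun p => h p ^ 2 *
    ∫ x, (1 - weight s x / weight s p) * truncKernel s ε p x ∂σ) σ := h2.2.1 ε hε
  rw [(integral_groundStateIntegrand hα hN hs0 hh hε).2, ← integral_neg,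
    ← integral_sub j1 j2]
  refine integral_congr_ae ?_
  filter_upwards [ae_mem_cone, ae_ne_zero hN] with p hp hp0
  have i1 := (hPV p hp hp0).integrable_truncKernel hε
  have i2 := (hW p hp hp0).1.integrable_truncKernel hε
  have k1 : Integrable (fun x => -(h p * ((h x - h p) * truncKernel s ε p x))) σ :=
    (i1.const_mul _).neg
  rw [← integral_const_mul, ← integral_const_mul, ← integral_neg,
    ← integral_sub k1 (i2.const_mul _)]
  refine integral_congr_ae (ae_of_all _ fun x => ?_)
  have := (weight_pos (s := s) hp0).ne'
  simp only
  field_simp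
  ring

/-! ### Logarithmic shells -/

/-- The measure of a set with respect to the scale invariant density `|x|^{-(N-1)}`. -/
def logMeasure (α : ℝ) (S : Set (Space m n)) : ℝ≥0∞ :=
  ∫⁻ x in S, ENNReal.ofReal (‖x‖ ^ (m + n - 1))⁻¹ ∂(surfaceMeasure m n α)

/-- The shell `{e^a ≤ |x| < e^b}`. -/
def expShell (m n : ℕ) (a b : ℝ) : Set (Space m n) := {x | Real.exp a ≤ ‖x‖ ∧ ‖x‖ < Real.exp b}

lemma measurableSet_expShell (a b : ℝ) : MeasurableSet (expShell m n a b) :=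
  (measurableSet_le measurable_const measurable_norm).inter
    (measurableSet_lt measurable_norm measurable_const)

lemma expShell_zero_one : expShell m n 0 1 = shell m n := by
  ext x; simp [expShell, shell]

/-- The density |x|^{-(N-1)} compensates the scaling of σ: in the variable log|x| the measure is
translation invariant, so the mass of a shell is linear in its logarithmic width. -/
lemma logMeasure_expShell_add (a b t : ℝ) :
    logMeasure α (expShell m n (a + t) (b + t)) = logMeasure α (expShell m n a b) := by
  have ht := Real.exp_pos t
  have h := lintegral_smul_surfaceMeasure (m := m) (n := n) (α := α) ht
    ((expShell m n (a + t) (b + t)).indicator fun x => ENNReal.ofReal (‖x‖ ^ (m + n - 1))⁻¹)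
  rw [lintegral_indicator (measurableSet_expShell _ _)] at h
  have h2 : ∀ x : Space m n, (expShell m n (a + t) (b + t)).indicator
      (fun x => ENNReal.ofReal (‖x‖ ^ (m + n - 1))⁻¹) (Real.exp t • x)
      = ENNReal.ofReal (Real.exp t ^ (m + n - 1))⁻¹ * (expShell m n a b).indicator
        (fun x => ENNReal.ofReal (‖x‖ ^ (m + n - 1))⁻¹) x := by
    intro x
    have hn : ‖Real.exp t • x‖ = ‖x‖ * Real.exp t := by
      rw [norm_smul, Real.norm_of_nonneg ht.le, mul_comm]
    have hiff : Real.exp t • x ∈ expShell m n (a + t) (b + t) ↔ x ∈ expShell m n a b := by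
      simp only [expShell, Set.mem_ofPred_eq, hn, Real.exp_add]
      rw [mul_le_mul_iff_left₀ ht, mul_lt_mul_iff_left₀ ht]
    by_cases hx : x ∈ expShell m n a b
    · rw [Set.indicator_of_mem hx, Set.indicator_of_mem (hiff.2 hx), hn,
        ← ENNReal.ofReal_mul (by positivity), mul_pow, mul_inv, mul_comm]
    · rw [Set.indicator_of_notMem hx, Set.indicator_of_notMem (fun h => hx (hiff.1 h)), mul_zero]
  simp only [h2] at h
  rw [lintegral_const_mul' _ _ ENNReal.ofReal_ne_top,
    lintegral_indicator (measurableSet_expShell _ _)] at h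
  have hne : ENNReal.ofReal (Real.exp t ^ (m + n - 1))⁻¹ ≠ 0 := by
    simpa using pow_pos ht _
  exact ((ENNReal.mul_right_inj hne ENNReal.ofReal_ne_top).1 h).symm

lemma logMeasure_union {S T : Set (Space m n)} (hT : MeasurableSet T) (hST : Disjoint S T) :
    logMeasure α (S ∪ T) = logMeasure α S + logMeasure α T :=
  lintegral_union hT hST

lemma expShell_union {a b c : ℝ} (hab : a ≤ b) (hbc : b ≤ c) :
    expShell m n a b ∪ expShell m n b c = expShell m n a c := by
  have h1 := Real.exp_le_exp.2 hab
  have h2 := Real.exp_le_exp.2 hbc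
  ext x
  simp only [expShell, Set.mem_union, Set.mem_ofPred_eq]
  constructor
  · rintro (⟨h, h'⟩ | ⟨h, h'⟩)
    · exact ⟨h, h'.trans_le h2⟩
    · exact ⟨h1.trans h, h'⟩
  · rintro ⟨h, h'⟩
    rcases lt_or_ge ‖x‖ (Real.exp b) with hx | hx
    · exact Or.inl ⟨h, hx⟩
    · exact Or.inr ⟨hx, h'⟩

lemma logMeasure_expShell_split {a b c : ℝ} (hab : a ≤ b) (hbc : b ≤ c) :
    logMeasure α (expShell m n a c)
      = logMeasure α (expShell m n a b) + logMeasure α (expShell m n b c) := by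
  rw [← expShell_union hab hbc, logMeasure_union (measurableSet_expShell _ _)]
  exact Set.disjoint_left.2 fun x hx hx' => absurd hx.2 (not_lt.2 hx'.1)

lemma logMeasure_expShell_zero_nat (k : ℕ) :
    logMeasure α (expShell m n 0 k) = k * logMeasure α (shell m n) := by
  induction k with
  | zero =>
    have : expShell m n 0 ((0 : ℕ) : ℝ) = ∅ := by
      ext x; simp [expShell]
    rw [this]; simp [logMeasure]
  | succ k ih =>
    rw [logMeasure_expShell_split (b := k) (by positivity) (by push_cast; linarith), ih]
    have h := logMeasure_expShell_add (m := m) (n := n) (α := α) 0 1 k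
    rw [expShell_zero_one, zero_add, add_comm 1 (k : ℝ)] at h
    push_cast
    rw [h, add_mul, one_mul]

lemma logMeasure_expShell_symm (k : ℕ) :
    logMeasure α (expShell m n (-k) k) = 2 * k * logMeasure α (shell m n) := by
  have h := logMeasure_expShell_add (m := m) (n := n) (α := α) 0 k (-k)
  rw [zero_add, add_neg_cancel] at h
  rw [logMeasure_expShell_split (b := 0) (by simp) (by simp), h, logMeasure_expShell_zero_nat]
  ring

lemma logMeasure_shell_lt_top (hα : 0 < α) : logMeasure α (shell m n) < ⊤ := by
  refine (setLIntegral_mono measurable_const (g := fun _ => (1 : ℝ≥0∞)) fun x hx => ?_).trans_lt ?_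
  · rw [← ENNReal.ofReal_one]
    exact ENNReal.ofReal_le_ofReal (inv_le_one_of_one_le₀ (one_le_pow₀ hx.1))
  · rw [setLIntegral_const, one_mul]
    exact surfaceMeasure_shell_lt_top hα

/-- This settles a degenerate case: if the shell had no mass, σ would vanish by polar coordinates
and the criterion would be trivial. Hence no lower bound on the Hausdorff measure has to be proved.
-/
lemma surfaceMeasure_eq_zero (hα : 0 < α) (hN : 2 ≤ m + n) (h : logMeasure α (shell m n) = 0) :
    surfaceMeasure m n α = 0 := by
  have h1 : surfaceMeasure m n α (shell m n) = 0 := by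
    set c := ENNReal.ofReal (Real.exp 1 ^ (m + n - 1))⁻¹ with hc
    have h2 : c * surfaceMeasure m n α (shell m n) ≤ logMeasure α (shell m n) := by
      rw [← setLIntegral_const]
      refine setLIntegral_mono ((measurable_norm.pow_const _).inv.ennreal_ofReal) fun x hx => ?_
      have hx0 : 0 < ‖x‖ := one_pos.trans_le hx.1
      refine ENNReal.ofReal_le_ofReal (inv_anti₀ (by positivity) ?_)
      exact pow_le_pow_left₀ hx0.le hx.2.le _
    rw [h, nonpos_iff_eq_zero, mul_eq_zero] at h2
    refine h2.resolve_left ?_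
    simpa [hc] using pow_pos (Real.exp_pos 1) _
  have h3 := lintegral_polar (m := m) (n := n) hα hN (measurable_const (a := (1 : ℝ≥0∞)))
  rw [setLIntegral_measure_zero _ _ h1, lintegral_one] at h3
  exact Measure.measure_univ_eq_zero.1 h3

/-! ### Logarithmic cutoffs -/

/-- A smooth cutoff function on the line: `1` on `[-1, 1]` and `0` outside `(-2, 2)`. -/
def lineBump : ContDiffBump (0 : ℝ) := ⟨1, 2, one_pos, one_lt_two⟩

open Classical in
/-- The cutoff `η(log |x| / k)`. -/
def logCutoff (k : ℝ) (x : Space m n) : ℝ := if x = 0 then 0 else lineBump (Real.log ‖x‖ / k)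

/-- The truncated ground state. -/
def truncGroundState (s k : ℝ) (x : Space m n) : ℝ := weight s x * logCutoff k x

lemma logCutoff_eq_zero {k : ℝ} (hk : 0 < k) {x : Space m n}
    (hx : x ∉ expShell m n (-(2 * k)) (2 * k)) : logCutoff k x = 0 := by
  by_cases hx0 : x = 0
  · rw [logCutoff, if_pos hx0]
  rw [logCutoff, if_neg hx0]
  have h0 : 0 < ‖x‖ := norm_pos_iff.2 hx0
  apply lineBump.zero_of_le_dist
  rw [Real.dist_eq, sub_zero, abs_div, abs_of_pos hk, le_div_iff₀ hk]
  change 2 * k ≤ _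
  by_contra h
  apply hx
  obtain ⟨h1, h2⟩ := abs_lt.1 (not_le.1 h)
  exact ⟨((Real.lt_log_iff_exp_lt h0).1 h1).le, (Real.log_lt_iff_lt_exp h0).1 h2⟩

lemma logCutoff_eq_one {k : ℝ} (hk : 0 < k) {x : Space m n}
    (hx : x ∈ expShell m n (-k) k) : logCutoff k x = 1 := by
  have h0 : 0 < ‖x‖ := (Real.exp_pos _).trans_le hx.1
  rw [logCutoff, if_neg (norm_pos_iff.1 h0)]
  apply lineBump.one_of_mem_closedBall
  rw [Metric.mem_closedBall, Real.dist_eq, sub_zero, abs_div, abs_of_pos hk]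
  change _ ≤ (1 : ℝ)
  rw [div_le_one hk, abs_le]
  exact ⟨(Real.le_log_iff_exp_le h0).2 hx.1, ((Real.log_lt_iff_lt_exp h0).2 hx.2).le⟩

lemma isTestFunction_truncGroundState {k : ℝ} (hk : 0 < k) :
    IsTestFunction (truncGroundState s k : Space m n → ℝ) := by
  have hnear : (truncGroundState s k : Space m n → ℝ) =ᶠ[𝓝 0] 0 := by
    filter_upwards [Metric.ball_mem_nhds (0 : Space m n) (Real.exp_pos (-(2 * k)))] with x hx
    rw [mem_ball_zero_iff] at hx
    rw [truncGroundState, logCutoff_eq_zero hk (fun h => absurd hx (not_lt.2 h.1)), mul_zero]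
    rfl
  refine ⟨contDiff_iff_contDiffAt.2 fun x => ?_, ?_, notMem_tsupport_iff_eventuallyEq.2 hnear⟩
  · by_cases hx : x = 0
    · rw [hx]
      exact contDiffAt_const.congr_of_eventuallyEq hnear
    · have h1 : (truncGroundState s k : Space m n → ℝ) =ᶠ[𝓝 x]
          fun x => weight s x * lineBump (Real.log ‖x‖ / k) := by
        filter_upwards [isOpen_ne.mem_nhds hx] with y hy
        rw [truncGroundState, logCutoff, if_neg hy]
      refine ContDiffAt.congr_of_eventuallyEq ?_ h1
      have h2 := contDiffAt_norm (n := ∞) ℝ hx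
      refine ContDiffAt.mul ?_ ?_
      · exact h2.rpow_const_of_ne (norm_ne_zero_iff.2 hx)
      · exact lineBump.contDiff.contDiffAt.comp x
          ((h2.log (norm_ne_zero_iff.2 hx)).div_const k)
  · refine HasCompactSupport.intro (isCompact_closedBall (0 : Space m n) (Real.exp (2 * k)))
      fun x hx => ?_
    rw [mem_closedBall_zero_iff, not_le] at hx
    rw [truncGroundState, logCutoff_eq_zero hk (fun h => absurd hx (not_lt.2 h.2.le)), mul_zero]

lemma exists_lineBump_lipschitz : ∃ C : ℝ, ∀ t t' : ℝ,
    |lineBump t - lineBump t'| ≤ C * |t - t'| := by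
  obtain ⟨C, hC⟩ := ContDiff.lipschitzWith_of_hasCompactSupport (n := 1)
    lineBump.hasCompactSupport lineBump.contDiff (by simp)
  exact ⟨C, fun t t' => by simpa [Real.dist_eq] using hC.dist_le_mul t t'⟩

/-! ### The remainder of the truncated ground state -/

/-- The integrand `w(p) w(x) (log |x| - log |p|)² K`. -/
def logIntegrand (s : ℝ) (p x : Space m n) : ℝ :=
  weight s p * weight s x * (Real.log ‖x‖ - Real.log ‖p‖) ^ 2 * kernel s p x

lemma logIntegrand_nonneg (p x : Space m n) : 0 ≤ logIntegrand s p x :=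
  mul_nonneg (mul_nonneg (mul_nonneg (weight_nonneg _) (weight_nonneg _)) (sq_nonneg _))
    (kernel_nonneg _ _)

lemma logIntegrand_comm (p x : Space m n) : logIntegrand s p x = logIntegrand s x p := by
  rw [logIntegrand, logIntegrand, kernel_comm]; ring

lemma measurable_logIntegrand :
    Measurable fun z : Space m n × Space m n => logIntegrand s z.1 z.2 := by
  unfold logIntegrand
  have hw := measurable_weightFun (m := m) (n := n) (s := s)
  exact (((hw.comp measurable_fst).mul (hw.comp measurable_snd)).mul
    (((Real.measurable_log.comp measurable_snd.norm).sub
      (Real.measurable_log.comp measurable_fst.norm)).pow_const 2)).mul measurable_kernel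

/-- It trades log² for a shift of the exponent by ±1/2, which still lies in the window of
integrability. -/
lemma log_sq_le {t : ℝ} (ht : 0 < t) :
    Real.log t ^ 2 ≤ 16 * (t ^ (1 / 2 : ℝ) + t ^ (-(1 / 2) : ℝ)) := by
  have key : ∀ u : ℝ, 1 ≤ u → Real.log u ^ 2 ≤ 16 * u ^ (1 / 2 : ℝ) := by
    intro u hu
    have h1 := Real.log_le_rpow_div (zero_le_one.trans hu) (ε := 1 / 4) (by norm_num)
    have h2 : 0 ≤ Real.log u := Real.log_nonneg hu
    have h3 : u ^ (1 / 2 : ℝ) = (u ^ (1 / 4 : ℝ)) ^ 2 := by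
      rw [← Real.rpow_natCast, ← Real.rpow_mul (by linarith)]; norm_num
    rw [h3]
    calc Real.log u ^ 2 ≤ (u ^ (1 / 4 : ℝ) / (1 / 4)) ^ 2 := by gcongr
      _ = _ := by ring
  have hp1 : 0 ≤ t ^ (1 / 2 : ℝ) := by positivity
  have hp2 : 0 ≤ t ^ (-(1 / 2) : ℝ) := by positivity
  rcases le_total 1 t with h | h
  · linarith [key t h]
  · have h1 := key t⁻¹ ((one_le_inv₀ ht).2 h)
    rw [Real.log_inv, neg_sq, Real.inv_rpow ht.le, ← Real.rpow_neg ht.le] at h1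
    linarith

lemma abs_log_le_of_near {t D : ℝ} (h : |t - 1| ≤ D) (ht : 1 / 2 ≤ t) : |Real.log t| ≤ 2 * D := by
  have ht0 : 0 < t := by linarith
  obtain ⟨h1, h2⟩ := abs_le.1 h
  have h3 := Real.log_le_sub_one_of_pos ht0
  have h4 := Real.one_sub_inv_le_log_of_pos ht0
  have hD : 0 ≤ D := (abs_nonneg _).trans h
  have h5 : -(2 * D) ≤ 1 - t⁻¹ := by
    have : t⁻¹ ≤ 1 + 2 * D := by
      rw [inv_le_iff_one_le_mul₀ ht0]
      nlinarith
    linarith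
  rw [abs_le]
  constructor <;> linarith

/-- Since |q| = 1, log²|x| is O(|x-q|²) near q and cancels the singularity; far away `log_sq_le`
reduces the claim to pure powers. -/
lemma integrable_logIntegrand (hα : 0 < α) (hN : 2 ≤ m + n) (hs0 : 0 ≤ s) (hs1 : s < 1)
    {q : Space m n} (hq : q ∈ cone m n α) (hq1 : ‖q‖ = 1) :
    Integrable (logIntegrand s q) (surfaceMeasure m n α) := by
  have hq0 : q ≠ 0 := by rintro rfl; simp at hq1
  have hm : Measurable (logIntegrand s q) := by
    unfold logIntegrand
    have hw := measurable_weightFun (m := m) (n := n) (s := s)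
    exact ((hw.const_mul _).mul (((Real.measurable_log.comp measurable_norm).sub_const _).pow_const
      2)).mul (measurable_kernel_left q)
  have hB : MeasurableSet (Metric.ball q (1 / 2)) := Metric.isOpen_ball.measurableSet
  obtain ⟨M, hM, hT⟩ := exists_weight_taylor (s := s) hq1
  have hM0 : 0 ≤ M := (norm_nonneg _).trans hM
  have heq : ∀ x, logIntegrand s q x = weight s x * Real.log ‖x‖ ^ 2 * kernel s q x := by
    intro x
    rw [logIntegrand, weight_eq_one hq1, hq1, Real.log_one, one_mul, sub_zero]
  have hN' : (2 : ℝ) ≤ (m : ℝ) + n := by exact_mod_cast hN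
  rw [← integrableOn_univ, ← Set.union_compl_self (Metric.ball q (1 / 2))]
  refine IntegrableOn.union ?_ ?_
  · refine ((integrableOn_sq_mul_kernel hα hN hs0 hs1 hq hq0 (1 / 2)).const_mul
      ((1 + 2 * M) * 4)).mono' hm.aestronglyMeasurable ?_
    filter_upwards [ae_restrict_mem hB] with x hx
    have hxq := (mem_ball_iff_norm.1 hx).le
    obtain ⟨h1, h2, -⟩ := norm_bounds_of_near hq1 hxq
    have h3 := abs_log_le_of_near h1 h2
    have h4 : weight s x ≤ 1 + 2 * M := by
      have h5 := (abs_le.1 (hT x hxq)).2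
      have h6 : |fderiv ℝ (weight s) q (x - q)| ≤ M * (1 / 2) :=
        ((fderiv ℝ (weight s) q).le_opNorm _).trans (by gcongr)
      have h7 := (abs_le.1 h6).2
      have h8 : M * ‖x - q‖ ^ 2 ≤ M * (1 / 2) ^ 2 := by gcongr
      linarith
    rw [Real.norm_of_nonneg (logIntegrand_nonneg _ _), heq, ← mul_assoc]
    refine mul_le_mul_of_nonneg_right ?_ (kernel_nonneg _ _)
    rw [← sq_abs (Real.log _)]
    calc weight s x * |Real.log ‖x‖| ^ 2 ≤ (1 + 2 * M) * (2 * ‖x - q‖) ^ 2 := by gcongr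
      _ = _ := by ring
  · set γ := -(((m : ℝ) + n - 2 - s) / 2) with hγ
    have i1 := integrableOn_kernel_mul_compl_ball (s := s) (γ := γ + 1 / 2) hα hN hs0
      (by linarith) (by linarith) q (by norm_num : (0 : ℝ) < 1 / 2)
    have i2 := integrableOn_kernel_mul_compl_ball (s := s) (γ := γ + -(1 / 2)) hα hN hs0
      (by linarith) (by linarith) q (by norm_num : (0 : ℝ) < 1 / 2)
    refine ((i1.add i2).const_mul 16).mono' hm.aestronglyMeasurable ?_
    filter_upwards [ae_restrict_of_ae (ae_ne_zero hN)] with x hx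
    have hx0 : 0 < ‖x‖ := norm_pos_iff.2 hx
    rw [Real.norm_of_nonneg (logIntegrand_nonneg _ _), heq]
    simp only [Pi.add_apply]
    rw [← add_mul, ← mul_assoc, Real.rpow_add hx0, Real.rpow_add hx0, ← mul_add]
    refine mul_le_mul_of_nonneg_right ?_ (kernel_nonneg _ _)
    have h1 := log_sq_le hx0
    have h2 : 0 ≤ ‖x‖ ^ γ := by positivity
    rw [weight, ← hγ]
    calc ‖x‖ ^ γ * Real.log ‖x‖ ^ 2 ≤ ‖x‖ ^ γ * _ := mul_le_mul_of_nonneg_left h1 h2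
      _ = _ := by ring

/-- The mass of `logIntegrand` at `p`, by scaling. -/
lemma lintegral_logIntegrand (hN : 2 ≤ m + n) {q : Space m n} (hq : q ∈ cone m n α)
    (hq1 : ‖q‖ = 1) {p : Space m n} (hp : p ∈ cone m n α) (hp0 : p ≠ 0) :
    ∫⁻ x, ENNReal.ofReal (logIntegrand s p x) ∂(surfaceMeasure m n α)
      = ENNReal.ofReal (‖p‖ ^ (m + n - 1))⁻¹ *
        ∫⁻ x, ENNReal.ofReal (logIntegrand s q x) ∂(surfaceMeasure m n α) := by
  obtain ⟨Q, hQ, hQp⟩ := exists_similarity hp hp0 hq hq1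
  have hp' : 0 < ‖p‖ := norm_pos_iff.2 hp0
  have h := lintegral_similarity (α := α) hp' hQ (fun x => ENNReal.ofReal (logIntegrand s p x))
  set r := ‖p‖ with hr
  set γ := -(((m : ℝ) + n - 2 - s) / 2) with hγ
  have h2 : ∫⁻ x, ENNReal.ofReal (logIntegrand s p (similarity hp' Q x)) ∂(surfaceMeasure m n α)
      = ∫⁻ x, ENNReal.ofReal (r ^ γ * r ^ γ * (r ^ ((m : ℝ) + n + s))⁻¹) *
        ENNReal.ofReal (logIntegrand s q x) ∂(surfaceMeasure m n α) := by
    refine lintegral_congr_ae ?_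
    filter_upwards [ae_ne_zero hN] with x hx
    have hx0 : 0 < ‖x‖ := norm_pos_iff.2 hx
    rw [← ENNReal.ofReal_mul (by positivity)]
    congr 1
    have e1 : weight s p = r ^ γ := rfl
    have e2 : weight s (similarity hp' Q x) = r ^ γ * weight s x := weight_similarity hp' Q x
    have e3 : kernel s p (similarity hp' Q x) = (r ^ ((m : ℝ) + n + s))⁻¹ * kernel s q x := by
      rw [← kernel_similarity hp' Q q x, hQp]
    rw [logIntegrand, logIntegrand, e1, e2, e3, norm_similarity, Real.log_mul hp'.ne' hx0.ne',
      weight_eq_one hq1, hq1, Real.log_one, ← hr]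
    ring
  rw [h2, lintegral_const_mul' _ _ ENNReal.ofReal_ne_top] at h
  have h3 : ENNReal.ofReal (r ^ (m + n - 1)) * ENNReal.ofReal (r ^ (m + n - 1))⁻¹ = 1 := by
    rw [← ENNReal.ofReal_mul (by positivity), mul_inv_cancel₀ (by positivity), ENNReal.ofReal_one]
  -- With 2γ = -(N-2-s) the exponents add up to -(N-1): this choice of w makes the mass at p the
  -- scale invariant density.
  have h4 : r ^ (m + n - 1) * (r ^ γ * r ^ γ * (r ^ ((m : ℝ) + n + s))⁻¹)
      = (r ^ (m + n - 1))⁻¹ := by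
    rw [← Real.rpow_natCast, ← Real.rpow_neg hp'.le, ← Real.rpow_neg hp'.le, ← Real.rpow_add hp',
      ← Real.rpow_add hp', ← Real.rpow_add hp', Nat.cast_sub (by omega)]
    congr 1
    push_cast
    rw [hγ]; ring
  rw [← one_mul (∫⁻ x, ENNReal.ofReal (logIntegrand s p x) ∂(surfaceMeasure m n α)), ← h3, mul_assoc,
    ← h, ← mul_assoc, ← ENNReal.ofReal_mul (by positivity), h4]

/-- Dividing by w leaves the cutoff, which is Lipschitz in log|x| with constant C/k. Its difference
vanishes unless one of the two points lies in the support shell, which gives the two indicators. -/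
lemma groundStateIntegrand_truncGroundState_le {C : ℝ}
    (hC : ∀ t t' : ℝ, |lineBump t - lineBump t'| ≤ C * |t - t'|) {k : ℝ} (hk : 0 < k) (ε : ℝ)
    {p x : Space m n} (hp : p ≠ 0) (hx : x ≠ 0) :
    ENNReal.ofReal (groundStateIntegrand s ε (truncGroundState s k) (p, x))
      ≤ ENNReal.ofReal ((C / k) ^ 2) *
        ((expShell m n (-(2 * k)) (2 * k)).indicator 1 p * ENNReal.ofReal (logIntegrand s p x)
        + (expShell m n (-(2 * k)) (2 * k)).indicator 1 x * ENNReal.ofReal (logIntegrand s p x)) := by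
  set S := expShell m n (-(2 * k)) (2 * k) with hS
  have hwp := weight_pos (s := s) hp
  have hwx := weight_pos (s := s) hx
  have heq : groundStateIntegrand s ε (truncGroundState s k) (p, x)
      = weight s p * weight s x * (logCutoff k x - logCutoff k p) ^ 2 * truncKernel s ε p x := by
    simp only [groundStateIntegrand, truncGroundState]
    field_simp
    ring
  have hle : groundStateIntegrand s ε (truncGroundState s k) (p, x)
      ≤ (C / k) ^ 2 * logIntegrand s p x := by
    have h1 : |logCutoff k x - logCutoff k p| ≤ C / k * |Real.log ‖x‖ - Real.log ‖p‖| := by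
      rw [logCutoff, logCutoff, if_neg hp, if_neg hx]
      refine (hC _ _).trans (le_of_eq ?_)
      rw [← sub_div, abs_div, abs_of_pos hk]; ring
    have h2 : (logCutoff k x - logCutoff k p) ^ 2
        ≤ (C / k) ^ 2 * (Real.log ‖x‖ - Real.log ‖p‖) ^ 2 := by
      rw [← sq_abs, ← sq_abs (Real.log ‖x‖ - _), ← mul_pow]
      gcongr
    have hK := truncKernel_le (s := s) ε p x
    have hK0 := truncKernel_nonneg (s := s) ε p x
    rw [heq, logIntegrand]
    calc weight s p * weight s x * (logCutoff k x - logCutoff k p) ^ 2 * truncKernel s ε p x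
        ≤ weight s p * weight s x * ((C / k) ^ 2 * (Real.log ‖x‖ - Real.log ‖p‖) ^ 2)
          * kernel s p x := by gcongr
      _ = _ := by ring
  by_cases hpx : p ∈ S ∨ x ∈ S
  · refine (ENNReal.ofReal_le_ofReal hle).trans ?_
    rw [ENNReal.ofReal_mul (by positivity)]
    gcongr
    rcases hpx with h | h
    · rw [Set.indicator_of_mem h, Pi.one_apply, one_mul]; exact le_self_add
    · rw [Set.indicator_of_mem h, Pi.one_apply, one_mul]; exact le_add_self
  · have hpS : p ∉ S := fun h => hpx (Or.inl h)
    have hxS : x ∉ S := fun h => hpx (Or.inr h)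
    rw [heq, logCutoff_eq_zero hk hpS, logCutoff_eq_zero hk hxS]
    simp

/-- Integrating out x costs M|p|^{-(N-1)}, so what remains is the logarithmic mass of the support
shell; the second indicator gives the same by symmetry. For a shell mass of order k the total is
O(1/k), uniformly in ε. -/
lemma lintegral_groundStateIntegrand_le (hα : 0 < α) (hN : 2 ≤ m + n)
    {q : Space m n} (hq : q ∈ cone m n α) (hq1 : ‖q‖ = 1) {C : ℝ}
    (hC : ∀ t t' : ℝ, |lineBump t - lineBump t'| ≤ C * |t - t'|) {k : ℝ} (hk : 0 < k) (ε : ℝ) :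
    ∫⁻ z, ENNReal.ofReal (groundStateIntegrand s ε (truncGroundState s k) z)
        ∂((surfaceMeasure m n α).prod (surfaceMeasure m n α))
      ≤ ENNReal.ofReal ((C / k) ^ 2) * (2 * (logMeasure α (expShell m n (-(2 * k)) (2 * k)) *
        ∫⁻ x, ENNReal.ofReal (logIntegrand s q x) ∂(surfaceMeasure m n α))) := by
  have := sigmaFinite_surfaceMeasure (m := m) (n := n) hα hN
  set S := expShell m n (-(2 * k)) (2 * k) with hS
  have hSm : MeasurableSet S := measurableSet_expShell _ _
  have hone : Measurable (S.indicator (1 : Space m n → ℝ≥0∞)) := measurable_one.indicator hSm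
  have hlm : Measurable fun z : Space m n × Space m n => ENNReal.ofReal (logIntegrand s z.1 z.2) :=
    measurable_logIntegrand.ennreal_ofReal
  set σ := surfaceMeasure m n α with hσ
  set M := ∫⁻ x, ENNReal.ofReal (logIntegrand s q x) ∂σ with hM
  set F : Space m n × Space m n → ℝ≥0∞ := fun z =>
    S.indicator 1 z.1 * ENNReal.ofReal (logIntegrand s z.1 z.2) with hF
  have hFm : Measurable F := (hone.comp measurable_fst).mul hlm
  have hne1 : ∀ᵐ z ∂(σ.prod σ), z.1 ≠ 0 := Measure.quasiMeasurePreserving_fst.ae (ae_ne_zero hN)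
  have hne2 : ∀ᵐ z ∂(σ.prod σ), z.2 ≠ 0 := Measure.quasiMeasurePreserving_snd.ae (ae_ne_zero hN)
  have hFint : ∫⁻ z, F z ∂(σ.prod σ) = logMeasure α S * M := by
    rw [lintegral_prod _ hFm.aemeasurable, logMeasure, ← hσ]
    have h1 : ∀ᵐ p ∂σ, ∫⁻ x, F (p, x) ∂σ
        = S.indicator (fun p => ENNReal.ofReal (‖p‖ ^ (m + n - 1))⁻¹) p * M := by
      filter_upwards [ae_mem_cone, ae_ne_zero hN] with p hp hp0
      by_cases hpS : p ∈ S
      · simp only [hF, Set.indicator_of_mem hpS, Pi.one_apply, one_mul]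
        exact lintegral_logIntegrand hN hq hq1 hp hp0
      · simp [hF, Set.indicator_of_notMem hpS]
    rw [lintegral_congr_ae h1, lintegral_mul_const, lintegral_indicator hSm]
    exact ((measurable_norm.pow_const _).inv.ennreal_ofReal).indicator hSm
  have hFsw : ∫⁻ z, F z.swap ∂(σ.prod σ) = ∫⁻ z, F z ∂(σ.prod σ) := lintegral_prod_swap F
  calc ∫⁻ z, ENNReal.ofReal (groundStateIntegrand s ε (truncGroundState s k) z) ∂(σ.prod σ)
      ≤ ∫⁻ z, ENNReal.ofReal ((C / k) ^ 2) * (F z + F z.swap) ∂(σ.prod σ) := by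
        refine lintegral_mono_ae ?_
        filter_upwards [hne1, hne2] with z hz1 hz2
        have h2 := groundStateIntegrand_truncGroundState_le (s := s) hC hk ε hz1 hz2
        simp only [hF, Prod.fst_swap, Prod.snd_swap]
        rw [logIntegrand_comm z.2 z.1]
        exact h2
    _ = _ := by
        rw [lintegral_const_mul' _ _ ENNReal.ofReal_ne_top, lintegral_add_left hFm, hFsw, hFint,
          two_mul]

/-- Where the cutoff equals 1, w²/|p|^{1+s} is exactly |p|^{-(N-1)}. -/
lemma le_integral_truncGroundState (hN : 2 ≤ m + n) {k : ℝ} (hk : 0 < k)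
    (hint : Integrable (fun p : Space m n => truncGroundState s k p ^ 2 / ‖p‖ ^ (1 + s))
      (surfaceMeasure m n α)) :
    logMeasure α (expShell m n (-k) k) ≤ ENNReal.ofReal
      (∫ p, truncGroundState s k p ^ 2 / ‖p‖ ^ (1 + s) ∂(surfaceMeasure m n α)) := by
  rw [ofReal_integral_eq_lintegral_ofReal hint (ae_of_all _ fun p => by positivity), logMeasure]
  refine le_trans ?_ (setLIntegral_le_lintegral (expShell m n (-k) k) _)
  refine setLIntegral_mono' (measurableSet_expShell _ _) fun p hp => ?_
  have hp0 : 0 < ‖p‖ := (Real.exp_pos _).trans_le hp.1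
  refine ENNReal.ofReal_le_ofReal (le_of_eq ?_)
  rw [truncGroundState, logCutoff_eq_one hk hp, mul_one, weight, ← Real.rpow_natCast,
    ← Real.rpow_natCast, ← Real.rpow_mul hp0.le, ← Real.rpow_sub hp0, ← Real.rpow_neg hp0.le,
    Nat.cast_sub (by omega)]
  congr 1
  push_cast; ring

/-! ### The stability criterion -/

lemma isStable_of_le (hα : 0 < α) (hN : 2 ≤ m + n) (hs0 : 0 ≤ s) (hs1 : s < 1)
    {q : Space m n} (hq : q ∈ cone m n α) (hq1 : ‖q‖ = 1)
    (hle : potential s α q ≤ hardyConstant s α q) : IsStable m n s α := by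
  intro h hh
  obtain ⟨-, -, hlim⟩ := tendsto_groundState (s := s) hα hN hs0 hs1 hq hq1 hh
  have h0 : h 0 = 0 := image_eq_zero_of_notMem_tsupport hh.2.2
  have h1 : 0 ≤ -(∫ p, jacobi s α h p * h p ∂(surfaceMeasure m n α))
      - (hardyConstant s α q - potential s α q)
        * ∫ p, h p ^ 2 / ‖p‖ ^ (1 + s) ∂(surfaceMeasure m n α) := by
    refine ge_of_tendsto' hlim fun ε => mul_nonneg (by norm_num) ?_
    exact integral_nonneg fun z => groundStateIntegrand_nonneg h0 ε z
  have h2 : 0 ≤ ∫ p, h p ^ 2 / ‖p‖ ^ (1 + s) ∂(surfaceMeasure m n α) :=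
    integral_nonneg fun p => by positivity
  have h3 := mul_nonneg (sub_nonneg.2 hle) h2
  linarith

/-- With D = A - H > 0, stability tested on the truncated ground states forces 2Dkc ≤ 4C²Mc/k for
every positive integer k, where c is the logarithmic mass of the shell. This fails for large k. -/
lemma le_of_isStable (hα : 0 < α) (hN : 2 ≤ m + n) (hs0 : 0 ≤ s) (hs1 : s < 1)
    {q : Space m n} (hq : q ∈ cone m n α) (hq1 : ‖q‖ = 1) (hst : IsStable m n s α) :
    potential s α q ≤ hardyConstant s α q := by
  by_contra hlt
  rw [not_le] at hlt
  have := sigmaFinite_surfaceMeasure (m := m) (n := n) hα hN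
  obtain ⟨C, hC⟩ := exists_lineBump_lipschitz
  set A := potential s α q with hA
  set H := hardyConstant s α q with hH
  set σ := surfaceMeasure m n α with hσ
  -- Without mass both constants are zero, so A > H is impossible.
  by_cases hc : logMeasure α (shell m n) = 0
  · have hz : σ = 0 := surfaceMeasure_eq_zero hα hN hc
    have hA0 : A = 0 := by rw [hA, potential, ← hσ, hz, integral_zero_measure]
    have hH0 : H = 0 := by
      have h1 := (hasPV_hardyIntegrand (s := s) hα hN hs0 hs1 hq hq1).1.2
      rw [← hσ, hz] at h1
      simp only [Measure.restrict_zero, integral_zero_measure] at h1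
      exact tendsto_nhds_unique h1 tendsto_const_nhds
    linarith
  have hctop := logMeasure_shell_lt_top (m := m) (n := n) hα
  set c := (logMeasure α (shell m n)).toReal with hcdef
  have hcpos : 0 < c := ENNReal.toReal_pos hc hctop.ne
  have hceq : logMeasure α (shell m n) = ENNReal.ofReal c := (ENNReal.ofReal_toReal hctop.ne).symm
  have hMint := integrable_logIntegrand (s := s) hα hN hs0 hs1 hq hq1
  set M := ∫ x, logIntegrand s q x ∂σ with hMdef
  have hM0 : 0 ≤ M := integral_nonneg fun x => logIntegrand_nonneg q x
  have hMeq : ∫⁻ x, ENNReal.ofReal (logIntegrand s q x) ∂σ = ENNReal.ofReal M :=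
    (ofReal_integral_eq_lintegral_ofReal hMint (ae_of_all _ fun x => logIntegrand_nonneg q x)).symm
  have key : ∀ k : ℕ, 0 < k → (A - H) * (2 * k * c) ≤ 4 * C ^ 2 * M * c / k := by
    intro k hk
    have hk' : (0 : ℝ) < k := by exact_mod_cast hk
    have hh := isTestFunction_truncGroundState (m := m) (n := n) (s := s) hk'
    set h : Space m n → ℝ := truncGroundState s k with hhdef
    have h0 : h 0 = 0 := image_eq_zero_of_notMem_tsupport hh.2.2
    obtain ⟨-, hint, hlim⟩ := tendsto_groundState (s := s) hα hN hs0 hs1 hq hq1 hh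
    have hI : 2 * k * c ≤ ∫ p, h p ^ 2 / ‖p‖ ^ (1 + s) ∂σ := by
      have h1 := le_integral_truncGroundState hN hk' hint
      rw [logMeasure_expShell_symm, hceq,
        show (2 : ℝ≥0∞) * k = ENNReal.ofReal (2 * k) by
          rw [ENNReal.ofReal_mul (by norm_num)]; simp,
        ← ENNReal.ofReal_mul (by positivity)] at h1
      exact (ENNReal.ofReal_le_ofReal_iff (integral_nonneg fun p => by positivity)).1 h1
    have hR : ∀ᶠ ε in 𝓝[>] (0 : ℝ),
        1 / 2 * ∫ z, groundStateIntegrand s ε h z ∂(σ.prod σ) ≤ 4 * C ^ 2 * M * c / k := by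
      filter_upwards [self_mem_nhdsWithin] with ε hε
      have hgi := (integral_groundStateIntegrand (s := s) hα hN hs0 hh hε).1
      have h2 := lintegral_groundStateIntegrand_le (s := s) hα hN hq hq1 hC hk' ε
      -- The cutoff lives on |log|x|| < 2k, a shell of logarithmic width 4k.
      have h3 : logMeasure α (expShell m n (-(2 * (k : ℝ))) (2 * k)) = ENNReal.ofReal (4 * k * c) := by
        have h4 := logMeasure_expShell_symm (m := m) (n := n) (α := α) (2 * k)
        push_cast at h4
        rw [h4, hceq, ENNReal.ofReal_mul (by positivity), ENNReal.ofReal_mul (by norm_num),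
          ENNReal.ofReal_natCast, ENNReal.ofReal_ofNat]
        ring
      rw [← hσ, h3, hMeq, ← ENNReal.ofReal_mul (by positivity), two_mul,
        ← ENNReal.ofReal_add (by positivity) (by positivity), ← ENNReal.ofReal_mul (by positivity),
        ← ofReal_integral_eq_lintegral_ofReal hgi
          (ae_of_all _ fun z => groundStateIntegrand_nonneg h0 ε z)] at h2
      have h5 := (ENNReal.ofReal_le_ofReal_iff (by positivity)).1 h2
      calc 1 / 2 * ∫ z, groundStateIntegrand s ε h z ∂(σ.prod σ)
          ≤ 1 / 2 * ((C / k) ^ 2 * (4 * k * c * M + 4 * k * c * M)) := by gcongr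
        _ = _ := by field_simp; ring
    have h6 := le_of_tendsto hlim hR
    have h7 := hst h hh
    rw [← hσ, ← hA, ← hH] at h6
    rw [← hσ] at h7
    have h8 : (A - H) * (2 * k * c) ≤ (A - H) * ∫ p, h p ^ 2 / ‖p‖ ^ (1 + s) ∂σ :=
      mul_le_mul_of_nonneg_left hI (by linarith)
    linarith
  -- The inequality to be contradicted is (A - H)k² ≤ 2C²M: k > 2C²M/(A - H) together with k > 1
  -- violates it.
  obtain ⟨k, hk⟩ := exists_nat_gt (max 1 (2 * C ^ 2 * M / (A - H)))
  have hk1 : (1 : ℝ) < k := (le_max_left _ _).trans_lt hk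
  have hk2 : 2 * C ^ 2 * M / (A - H) < k := (le_max_right _ _).trans_lt hk
  rw [div_lt_iff₀ (by linarith)] at hk2
  have h9 := key k (by exact_mod_cast zero_lt_one.trans hk1)
  rw [le_div_iff₀ (by linarith)] at h9
  have h10 : (A - H) * k * k ≤ 2 * C ^ 2 * M := by
    have : ((A - H) * k * k) * (2 * c) ≤ (2 * C ^ 2 * M) * (2 * c) := by linarith
    exact le_of_mul_le_mul_right this (by positivity)
  have h11 : 0 < (A - H) * k := mul_pos (by linarith) (by linarith)
  nlinarith

end NonlocalCone

end

/-! ### The main theorem -/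

theorem mainTheorem3 (m n : ℕ) (hm : 1 ≤ m) (hn : 1 ≤ n) (s : ℝ) (hs0 : 0 ≤ s) (hs1 : s < 1)
    (α : ℝ) (hα : NonlocalCone.IsConeParameter m n s α)
    (q : NonlocalCone.Space m n) (hq : q ∈ NonlocalCone.cone m n α) (hq1 : ‖q‖ = 1) :
    (∀ h : NonlocalCone.Space m n → ℝ, NonlocalCone.IsTestFunction h →
      (∀ p ∈ NonlocalCone.cone m n α, p ≠ 0 →
        ∃ L : ℝ, NonlocalCone.HasPV (NonlocalCone.surfaceMeasure m n α) p
          (fun x => (h x - h p) * NonlocalCone.kernel s p x) L) ∧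
      Integrable (fun p => NonlocalCone.jacobi s α h p * h p)
        (NonlocalCone.surfaceMeasure m n α)) ∧
    (∀ p ∈ NonlocalCone.cone m n α, p ≠ 0 →
      Integrable (NonlocalCone.potentialIntegrand s α p)
        (NonlocalCone.surfaceMeasure m n α) ∧
      NonlocalCone.potential s α p = NonlocalCone.potential s α q / ‖p‖ ^ (1 + s)) ∧
    (∃ L : ℝ, NonlocalCone.HasPV (NonlocalCone.surfaceMeasure m n α) q
      (NonlocalCone.hardyIntegrand s q) L) ∧
    (∀ p ∈ NonlocalCone.cone m n α, ‖p‖ = 1 →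
      NonlocalCone.hardyConstant s α p = NonlocalCone.hardyConstant s α q) ∧
    (NonlocalCone.IsStable m n s α ↔
      NonlocalCone.potential s α q ≤ NonlocalCone.hardyConstant s α q) := by
  have hN : 2 ≤ m + n := by omega
  have hα0 : 0 < α := by
    rcases hα with h | h
    · exact h.2.1
    · exact h.2.1
  refine ⟨fun h hh => ⟨fun p hp hp0 => ?_, ?_⟩, fun p hp hp0 => ?_, ?_, fun p hp hp1 => ?_, ?_, ?_⟩
  · exact ⟨_, (NonlocalCone.hasPV_testFunction hα0 hN hs0 hs1 hq hq1 hh).1 p hp hp0⟩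
  · exact (NonlocalCone.tendsto_groundState hα0 hN hs0 hs1 hq hq1 hh).1
  · exact NonlocalCone.integrable_potentialIntegrand_and_potential_eq hα0 hN hs0 hs1 hq hq1 hp hp0
  · exact ⟨_, (NonlocalCone.hasPV_hardyIntegrand hα0 hN hs0 hs1 hq hq1).1⟩
  · exact NonlocalCone.hardyConstant_eq hα0 hN hs0 hs1 hp hp1 hq hq1
  · exact NonlocalCone.le_of_isStable hα0 hN hs0 hs1 hq hq1
  · exact NonlocalCone.isStable_of_le hα0 hN hs0 hs1 hq hq1
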